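/- Let $N\ge 2$, let $\Omega\subset\mathbb R^N$ be a bounded domain with $C^\infty$ boundary, and let $D$ be a subdomain (nonempty, open, connected) with Lipschitz boundary and $\overline D\subset\Omega$. Let $p:\overline\Omega\to(1,\infty]$ satisfy $p=\infty$ on $D$, $p\in C^1(\overline\Omega\setminus D)$ (real-valued), $p^+:=\sup_{\overline\Omega\setminus\overline D}p<\infty$ and $p_-:=\inf_{\overline\Omega}p>N$. Let $g\in C(\overline\Omega)$ with $\int_{\partial\Omega}g\,dS=0$. For $k\in\mathbb N$ put $p_k:=\min\{p,k\}$, and for each $k>p^+$ let $u_k\in W^{1,p_k(\cdot)}(\Omega)\cap C(\overline\Omega)$ be a weak solution of $-\Delta_{p_k(x)}u=0$ in $\Omega$, $|\nabla u|^{p_k(x)-2}\frac{\partial u}{\partial\nu}=g$ on $\partial\Omega$, that is, $$\int_\Omega|\nabla u_k|^{p_k(x)-2}\nabla u_k\cdot\nabla v\,dx=\int_{\partial\Omega}g\,v\,dS\qquad\text{for all }v\in W^{1,p_k(\cdot)}(\Omega).$$ Suppose that a subsequence of $(u_k)$ converges to $u_\infty$ uniformly on $\overline\Omega$. Write $\Delta_{p(x)}\varphi=\operatorname{div}(|\nabla\varphi|^{p(x)-2}\nabla\varphi)$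 (at points of $\partial D$ and $\partial\Omega$, with the derivatives of $p$ taken from within $\overline\Omega\setminus D$) and $\Delta_\infty\varphi=\sum_{i,j}\partial_i\varphi\,\partial_j\varphi\,\partial_{ij}\varphi$. For $x\in\partial D$ let $N(x)$ be the set of all limits of outward unit normals $\nu_j$ to $\partial D$ at points $x_j\in\partial D$ at which the outward unit normal exists, with $x_j\to x$. On $\partial\Omega$, $\nu$ is the outward unit normal. Let $\operatorname{sgn}(0)=0$. Then $u_\infty$ is a viscosity solution of the problem $$\begin{cases}-\Delta_{p(x)}u=0&\text{in }\Omega\setminus\overline D,\\-\Delta_\infty u=0&\text{in }D,\\\operatorname{sgn}(|\nabla u|-1)\operatorname{sgn}\big(\tfrac{\partial u}{\partial\nu}\big)=0&\text{on }\partial D,\\|\nabla u|^{p(x)-2}\tfrac{\partial u}{\partial\nu}=g&\text{on }\partial\Omega,\end{cases}$$ in the following sense. First, $u_\infty$ is a viscosity supersolution: it is lower semicontinuous on $\overline\Omega$, and for every $\varphi\in C^2(\overline\Omega)$ and $x_0\in\overline\Omega$ such that $u_\infty-\varphi$ has a strict minimum over $\overline\Omega$ at $x_0$ and $u_\infty(x_0)=\varphi(x_0)$,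 - if $x_0\in\Omega\setminus\overline D$, then $-\Delta_{p(x_0)}\varphi(x_0)\ge0$; - if $x_0\in D$, then $-\Delta_\infty\varphi(x_0)\ge0$; - if $x_0\in\partial D$, then $\max\big\{-\Delta_{p(x_0)}\varphi(x_0),\,-\Delta_\infty\varphi(x_0),\,\sup_{\nu\in N(x_0)}\operatorname{sgn}(|\nabla\varphi(x_0)|-1)\operatorname{sgn}(\nabla\varphi(x_0)\cdot\nu)\big\}\ge0$; - if $x_0\in\partial\Omega$, then $\max\big\{|\nabla\varphi(x_0)|^{p(x_0)-2}\tfrac{\partial\varphi}{\partial\nu}(x_0)-g(x_0),\,-\Delta_{p(x_0)}\varphi(x_0)\big\}\ge0$. Second, $u_\infty$ is a viscosity subsolution: the same holds with upper semicontinuity, strict maximum, $\min$, $\inf$ and $\le0$ in place of lower semicontinuity, strict minimum, $\max$, $\sup$ and $\ge0$. -/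

import Mathlib

open Set Filter Topology MeasureTheory
open scoped ENNReal NNReal ContDiff Gradient RealInnerProductSpace

noncomputable section

namespace PxNeumann

/-! ### Domains and normals -/

/-- `Ω` has `C^∞` boundary: near each boundary point, `Ω` is, in a suitable direction `e`, the strict
subgraph of a smooth function of the coordinates orthogonal to `e`. -/
def HasSmoothBoundary {N : ℕ} (Ω : Set (EuclideanSpace ℝ (Fin N))) : Prop :=
  ∀ x ∈ frontier Ω, ∃ e : EuclideanSpace ℝ (Fin N), ‖e‖ = 1 ∧
    ∃ γ : EuclideanSpace ℝ (Fin N) → ℝ, ContDiff ℝ ∞ γ ∧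
      ∀ᶠ y in 𝓝 x, (y ∈ Ω ↔ ⟪e, y⟫ < γ (y - ⟪e, y⟫ • e))

/-- `D` has Lipschitz boundary: near each boundary point, `D` is, in a suitable direction `e`, the
strict subgraph of a Lipschitz function of the coordinates orthogonal to `e`. -/
def HasLipschitzBoundary {N : ℕ} (D : Set (EuclideanSpace ℝ (Fin N))) : Prop :=
  ∀ x ∈ frontier D, ∃ e : EuclideanSpace ℝ (Fin N), ‖e‖ = 1 ∧
    ∃ γ : EuclideanSpace ℝ (Fin N) → ℝ, (∃ K : ℝ≥0, LipschitzWith K γ) ∧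
      ∀ᶠ y in 𝓝 x, (y ∈ D ↔ ⟪e, y⟫ < γ (y - ⟪e, y⟫ • e))

/-- `ν` is the outward unit normal to `∂D` at `x`: for every `ε > 0`, near `x`, the points with
`(y - x)·ν < -ε|y - x|` lie in `D` and those with `(y - x)·ν > ε|y - x|` lie off the closure of `D`.
For a (sub)graph this says that the graph function is differentiable, with the usual normal. -/
def IsOutwardUnitNormal {N : ℕ} (D : Set (EuclideanSpace ℝ (Fin N)))
    (x ν : EuclideanSpace ℝ (Fin N)) : Prop :=
  ‖ν‖ = 1 ∧ ∀ ε : ℝ, 0 < ε → ∀ᶠ y in 𝓝 x,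
    (⟪y - x, ν⟫ < -ε * ‖y - x‖ → y ∈ D) ∧ (ε * ‖y - x‖ < ⟪y - x, ν⟫ → y ∉ closure D)

/-- The outward unit normal is unique when it exists. -/
theorem IsOutwardUnitNormal.unique {N : ℕ} {D : Set (EuclideanSpace ℝ (Fin N))}
    {x ν ν' : EuclideanSpace ℝ (Fin N)} (h : IsOutwardUnitNormal D x ν)
    (h' : IsOutwardUnitNormal D x ν') : ν = ν' := by
  by_contra hne
  have hlt : ⟪ν, ν'⟫ < 1 := (inner_lt_one_iff_real_of_norm_eq_one h.1 h'.1).2 hne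
  set d := ν' - ν with hd
  set δ := 1 - ⟪ν, ν'⟫ with hδ
  have hδ0 : 0 < δ := by simp only [hδ]; linarith
  have h1 : ⟪d, ν⟫ = -δ := by
    rw [hd, inner_sub_left, real_inner_self_eq_norm_sq, h.1, real_inner_comm]; simp [hδ]
  have h2 : ⟪d, ν'⟫ = δ := by
    rw [hd, inner_sub_left, real_inner_self_eq_norm_sq, h'.1]; simp [hδ]
  have hd0 : 0 < ‖d‖ := norm_pos_iff.2 (sub_ne_zero.2 (Ne.symm hne))
  set ε := δ / (2 * ‖d‖) with hε
  have hε0 : 0 < ε := by positivity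
  have hεd : ε * ‖d‖ = δ / 2 := by rw [hε]; field_simp
  have hlim : Tendsto (fun t : ℝ => x + t • d) (𝓝[>] 0) (𝓝 x) := by
    have : Tendsto (fun t : ℝ => x + t • d) (𝓝 0) (𝓝 (x + (0 : ℝ) • d)) :=
      (Continuous.tendsto (by fun_prop) 0)
    simpa using this.mono_left nhdsWithin_le_nhds
  obtain ⟨t, ⟨ha, hb⟩, ht⟩ := ((hlim.eventually ((h.2 ε hε0).and (h'.2 ε hε0))).and
    self_mem_nhdsWithin).exists
  have ht0 : (0 : ℝ) < t := ht
  have hn : ‖x + t • d - x‖ = t * ‖d‖ := by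
    rw [add_sub_cancel_left, norm_smul, Real.norm_of_nonneg ht0.le]
  refine hb.2 ?_ (subset_closure (ha.1 ?_))
  · rw [hn, add_sub_cancel_left, real_inner_smul_left, h2]; nlinarith
  · rw [hn, add_sub_cancel_left, real_inner_smul_left, h1]; nlinarith

/-- The set `N(x)` of generalized outward unit normals at `x`: all limits of outward unit normals
taken at boundary points that converge to `x`. -/
def generalizedNormals {N : ℕ} (D : Set (EuclideanSpace ℝ (Fin N)))
    (x : EuclideanSpace ℝ (Fin N)) : Set (EuclideanSpace ℝ (Fin N)) :=
  {ν | ∃ y n : ℕ → EuclideanSpace ℝ (Fin N),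
    (∀ j, y j ∈ frontier D ∧ IsOutwardUnitNormal D (y j) (n j)) ∧
      Tendsto y atTop (𝓝 x) ∧ Tendsto n atTop (𝓝 ν)}

/-! ### Variable exponent Sobolev spaces and weak solutions -/

/-- `f ∈ L^{q(·)}(Ω)` for a real-valued exponent `q`. -/
def MemVarLp {N : ℕ} {F : Type*} [NormedAddCommGroup F] (Ω : Set (EuclideanSpace ℝ (Fin N)))
    (q : EuclideanSpace ℝ (Fin N) → ℝ) (f : EuclideanSpace ℝ (Fin N) → F) : Prop :=
  AEStronglyMeasurable f (volume.restrict Ω) ∧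
    ∃ c : ℝ, 0 < c ∧ ∫⁻ x in Ω, ENNReal.ofReal ((c * ‖f x‖) ^ q x) < ⊤

/-- `G` is the weak gradient of `u` on `Ω`. -/
def HasWeakGradient {N : ℕ} (Ω : Set (EuclideanSpace ℝ (Fin N)))
    (u : EuclideanSpace ℝ (Fin N) → ℝ)
    (G : EuclideanSpace ℝ (Fin N) → EuclideanSpace ℝ (Fin N)) : Prop :=
  LocallyIntegrableOn u Ω ∧ LocallyIntegrableOn G Ω ∧
    ∀ φ : EuclideanSpace ℝ (Fin N) → ℝ, ContDiff ℝ ∞ φ → HasCompactSupport φ → tsupport φ ⊆ Ω →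
      ∫ x in Ω, u x • ∇ φ x = -∫ x in Ω, φ x • G x

/-- `u ∈ W^{1,q(·)}(Ω)` with weak gradient `G`. -/
def MemVarSobolev {N : ℕ} (Ω : Set (EuclideanSpace ℝ (Fin N)))
    (q : EuclideanSpace ℝ (Fin N) → ℝ) (u : EuclideanSpace ℝ (Fin N) → ℝ)
    (G : EuclideanSpace ℝ (Fin N) → EuclideanSpace ℝ (Fin N)) : Prop :=
  HasWeakGradient Ω u G ∧ MemVarLp Ω q u ∧ MemVarLp Ω q G

/-- The truncated exponent `p_k = min {p, k}`. -/
def truncExponent {N : ℕ} (p : EuclideanSpace ℝ (Fin N) → ℝ≥0∞) (k : ℕ)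
    (x : EuclideanSpace ℝ (Fin N)) : ℝ :=
  (min (p x) (k : ℝ≥0∞)).toReal

/-- `u` is (the continuous representative on the closure of `Ω` of) a weak solution of
`-Δ_{q(x)} u = 0` in `Ω`, `|∇u|^{q(x)-2} ∂u/∂n = g` on `∂Ω`. For exponents larger than the dimension,
each class in `W^{1,q(·)}(Ω)` has exactly one representative that is continuous on the closure, and
its boundary values are the trace; the test functions range over these representatives. The surface
measure is the normalized `(N-1)`-dimensional Hausdorff measure. -/
def IsWeakSolution {N : ℕ} (Ω : Set (EuclideanSpace ℝ (Fin N)))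
    (q g : EuclideanSpace ℝ (Fin N) → ℝ) (u : EuclideanSpace ℝ (Fin N) → ℝ) : Prop :=
  ContinuousOn u (closure Ω) ∧
    ∃ G : EuclideanSpace ℝ (Fin N) → EuclideanSpace ℝ (Fin N), MemVarSobolev Ω q u G ∧
      ∀ (v : EuclideanSpace ℝ (Fin N) → ℝ) (V : EuclideanSpace ℝ (Fin N) → EuclideanSpace ℝ (Fin N)),
        ContinuousOn v (closure Ω) → MemVarSobolev Ω q v V →
          ∫ x in Ω, ‖G x‖ ^ (q x - 2) * ⟪G x, V x⟫ = ∫ x in frontier Ω, g x * v x ∂μHE[N - 1]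

/-! ### Differential operators on `C²` functions -/

/-- The `q(x)`-Laplacian `div (|∇φ|^{q(x)-2} ∇φ)`, with derivatives taken within the set `s` where
the exponent `q` lives (so that it makes sense at boundary points of `s` too). -/
def varLaplacianWithin {N : ℕ} (s : Set (EuclideanSpace ℝ (Fin N)))
    (q φ : EuclideanSpace ℝ (Fin N) → ℝ) (x : EuclideanSpace ℝ (Fin N)) : ℝ :=
  LinearMap.trace ℝ (EuclideanSpace ℝ (Fin N))
    (fderivWithin ℝ (fun y => ‖∇ φ y‖ ^ (q y - 2) • ∇ φ y) s x).toLinearMap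

/-- The infinity Laplacian `∑ᵢⱼ ∂ᵢφ ∂ⱼφ ∂ᵢⱼφ = D²φ(∇φ, ∇φ)`. -/
def infLaplacian {N : ℕ} (φ : EuclideanSpace ℝ (Fin N) → ℝ) (x : EuclideanSpace ℝ (Fin N)) : ℝ :=
  iteratedFDeriv ℝ 2 φ x ![∇ φ x, ∇ φ x]

/-! ### Viscosity solutions of the limit problem -/

/-- Viscosity supersolutions of the transmission problem
`-Δ_{p(x)} u = 0` off the closure of `D`, `-Δ_∞ u = 0` in `D`,
`sgn (|∇u| - 1) sgn (∂u/∂ν) = 0` on `∂D`, `|∇u|^{p(x)-2} ∂u/∂ν = g` on `∂Ω`.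
The supremum over `N(x₀)` is taken in the extended reals. -/
def IsViscositySupersolution {N : ℕ} (Ω D : Set (EuclideanSpace ℝ (Fin N)))
    (p : EuclideanSpace ℝ (Fin N) → ℝ≥0∞) (g u : EuclideanSpace ℝ (Fin N) → ℝ) : Prop :=
  LowerSemicontinuousOn u (closure Ω) ∧
    ∀ (φ : EuclideanSpace ℝ (Fin N) → ℝ) (x₀ : EuclideanSpace ℝ (Fin N)),
      ContDiff ℝ 2 φ → x₀ ∈ closure Ω → u x₀ = φ x₀ →
      (∀ y ∈ closure Ω, y ≠ x₀ → u x₀ - φ x₀ < u y - φ y) →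
        (x₀ ∈ Ω \ closure D →
          0 ≤ -varLaplacianWithin (closure Ω \ D) (fun y => (p y).toReal) φ x₀) ∧
        (x₀ ∈ D → 0 ≤ -infLaplacian φ x₀) ∧
        (x₀ ∈ frontier D →
          0 ≤ max (max
            ((-varLaplacianWithin (closure Ω \ D) (fun y => (p y).toReal) φ x₀ : ℝ) : EReal)
            ((-infLaplacian φ x₀ : ℝ) : EReal))
            (⨆ ν ∈ generalizedNormals D x₀,
              ((Real.sign (‖∇ φ x₀‖ - 1) * Real.sign ⟪∇ φ x₀, ν⟫ : ℝ) : EReal))) ∧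
        (x₀ ∈ frontier Ω → ∃ ν, IsOutwardUnitNormal Ω x₀ ν ∧
          0 ≤ max (‖∇ φ x₀‖ ^ ((p x₀).toReal - 2) * ⟪∇ φ x₀, ν⟫ - g x₀)
            (-varLaplacianWithin (closure Ω \ D) (fun y => (p y).toReal) φ x₀))

/-- Viscosity subsolutions of the same transmission problem. -/
def IsViscositySubsolution {N : ℕ} (Ω D : Set (EuclideanSpace ℝ (Fin N)))
    (p : EuclideanSpace ℝ (Fin N) → ℝ≥0∞) (g u : EuclideanSpace ℝ (Fin N) → ℝ) : Prop :=
  UpperSemicontinuousOn u (closure Ω) ∧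
    ∀ (φ : EuclideanSpace ℝ (Fin N) → ℝ) (x₀ : EuclideanSpace ℝ (Fin N)),
      ContDiff ℝ 2 φ → x₀ ∈ closure Ω → u x₀ = φ x₀ →
      (∀ y ∈ closure Ω, y ≠ x₀ → u y - φ y < u x₀ - φ x₀) →
        (x₀ ∈ Ω \ closure D →
          -varLaplacianWithin (closure Ω \ D) (fun y => (p y).toReal) φ x₀ ≤ 0) ∧
        (x₀ ∈ D → -infLaplacian φ x₀ ≤ 0) ∧
        (x₀ ∈ frontier D →
          min (min
            ((-varLaplacianWithin (closure Ω \ D) (fun y => (p y).toReal) φ x₀ : ℝ) : EReal)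
            ((-infLaplacian φ x₀ : ℝ) : EReal))
            (⨅ ν ∈ generalizedNormals D x₀,
              ((Real.sign (‖∇ φ x₀‖ - 1) * Real.sign ⟪∇ φ x₀, ν⟫ : ℝ) : EReal)) ≤ 0) ∧
        (x₀ ∈ frontier Ω → ∃ ν, IsOutwardUnitNormal Ω x₀ ν ∧
          min (‖∇ φ x₀‖ ^ ((p x₀).toReal - 2) * ⟪∇ φ x₀, ν⟫ - g x₀)
            (-varLaplacianWithin (closure Ω \ D) (fun y => (p y).toReal) φ x₀) ≤ 0)

/-- Viscosity solutions: both super- and subsolutions. -/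
def IsViscositySolution {N : ℕ} (Ω D : Set (EuclideanSpace ℝ (Fin N)))
    (p : EuclideanSpace ℝ (Fin N) → ℝ≥0∞) (g u : EuclideanSpace ℝ (Fin N) → ℝ) : Prop :=
  IsViscositySupersolution Ω D p g u ∧ IsViscositySubsolution Ω D p g u

end PxNeumann

end

/-!
Why the theorem is true. Suppose a test function `φ` touches `u_∞` strictly from below at `x₀` and
violates the condition required there. By uniform convergence, for a suitable constant `c` and
infinitely many `k` the function `φ + c - u_k` is positive at `x₀` and negative on the closure of `Ω`
off a small ball. Its positive part, squared, is an admissible test function `v`, with gradient `V`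
a nonnegative multiple of `∇φ - ∇u_k`. Monotonicity of `X ↦ |X|^{q - 2} X` turns the weak
formulation for `u_k` into

  `∫_{∂Ω} g v ≤ ∫_Ω |∇φ|^{p_k - 2} ∇φ · V`                        (`HasBumpTests`),

in which `u_k` appears only through `v`. The right side is now integrated by parts, the smooth
factor being the field `F = |∇φ|^{p_k - 2} ∇φ`; in each case a violated condition makes the result
too small.

* Off `∂D` and `∂Ω` the divergence of `F` is bounded below by a positive constant. In `D` this holds
  for large `k`, because `div (|∇φ|^{k - 2} ∇φ)` has the sign of `|∇φ|² Δφ / (k - 2) + Δ_∞ φ`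
  (`exists_le_divergence_of_infLaplacian_pos`).
* At `∂D` the field jumps by `(|∇φ|^{k - 2} - |∇φ|^{p - 2}) ∇φ`. If the transmission condition fails
  for every generalized normal, this jump points into `D`, and the interface contributes with the
  favorable sign (`IsBumpTest.integral_inner_le_of_jump`). Since `∂D` is only Lipschitz, no trace or
  surface integral on `∂D` is used: the defining function of `D` is mollified, and its derivatives
  near `x₀` are controlled by the generalized normals at `x₀` through Rademacher's theorem
  (`IsDefiningFunction.exists_contDiff_approx`).
* At `∂Ω` the integration by parts leaves a boundary term, which has to be compared with the
  Hausdorff surface integral of `g v`. A cutoff in the defining function `ρ` turns it into an average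
  of integrals over translates of the boundary graph (`IsBumpTest.integral_inner_le_of_flux`); near
  `x₀` the surface measure is, up to a factor close to `1`, the Lebesgue measure of the parameters
  times `|∇ρ(x₀)|` (`exists_surfaceMeasure_bounds`), because the parametrization is nearly isometric
  to its differential there. The strict inequality between the flux of `F` and `g` at `x₀` absorbs
  the factor.

Subsolutions follow by changing the signs of `u_k` and `g`, under which the problem is odd.
-/

namespace PxNeumann

/-! ### Weak gradients: mollification and the chain rule -/

/-- Moving a bump function by a point of `Ω` that is far from the boundary gives an admissible test
function, so the derivative of a mollified function is the mollified weak gradient. -/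
theorem HasWeakGradient.fderiv_convolution_apply {N : ℕ} {Ω K : Set (EuclideanSpace ℝ (Fin N))}
    {u : EuclideanSpace ℝ (Fin N) → ℝ} {G : EuclideanSpace ℝ (Fin N) → EuclideanSpace ℝ (Fin N)}
    (hw : HasWeakGradient Ω u G) (hK : IsCompact K) (hKΩ : K ⊆ Ω)
    (φ : ContDiffBump (0 : EuclideanSpace ℝ (Fin N))) {x : EuclideanSpace ℝ (Fin N)}
    (hx : Metric.closedBall x φ.rOut ⊆ K) (h : EuclideanSpace ℝ (Fin N)) :
    HasFDerivAt (fun x => ∫ y, φ.normed volume (x - y) * K.indicator u y)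
      (fderiv ℝ (fun x => ∫ y, φ.normed volume (x - y) * K.indicator u y) x) x ∧
    fderiv ℝ (fun x => ∫ y, φ.normed volume (x - y) * K.indicator u y) x h =
      ∫ y, φ.normed volume (x - y) * ⟪K.indicator G y, h⟫ := by
  have hKm : MeasurableSet K := hK.isClosed.measurableSet
  have hui : Integrable (K.indicator u) := (integrable_indicator_iff hKm).2
    ((hw.1.mono_set hKΩ).integrableOn_isCompact hK)
  have hGi : Integrable (K.indicator G) := (integrable_indicator_iff hKm).2
    ((hw.2.1.mono_set hKΩ).integrableOn_isCompact hK)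
  set ρ := φ.normed volume with hρ
  have hρc : ContDiff ℝ ∞ ρ := φ.contDiff_normed
  have hρs : HasCompactSupport ρ := φ.hasCompactSupport_normed
  have hρ1 : ContDiff ℝ 1 ρ := hρc.of_le (by norm_cast)
  have hfun : (fun x => ∫ y, ρ (x - y) * K.indicator u y) =
      convolution ρ (K.indicator u) (ContinuousLinearMap.mul ℝ ℝ) volume := by
    ext x
    rw [convolution_eq_swap]; rfl
  have hd := hρs.hasFDerivAt_convolution_left (ContinuousLinearMap.mul ℝ ℝ) hρ1
    hui.locallyIntegrable x
  rw [hfun]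
  refine ⟨hd.differentiableAt.hasFDerivAt, ?_⟩
  rw [hd.fderiv, convolution_eq_swap]
  have hdc : Continuous (fderiv ℝ ρ) := hρ1.continuous_fderiv one_ne_zero
  have hds : HasCompactSupport (fderiv ℝ ρ) := hρs.fderiv ℝ
  have hint : Integrable (fun t => ((ContinuousLinearMap.mul ℝ ℝ).precompL
      (EuclideanSpace ℝ (Fin N)) (fderiv ℝ ρ (x - t))) (K.indicator u t)) := by
    have := (hds.convolutionExists_left ((ContinuousLinearMap.mul ℝ ℝ).precompL
      (EuclideanSpace ℝ (Fin N))) hdc hui.locallyIntegrable x).integrable_swap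
    exact this
  rw [ContinuousLinearMap.integral_apply hint]
  -- the test function `y ↦ ρ (x - y)`
  set χ : EuclideanSpace ℝ (Fin N) → ℝ := fun y => ρ (x - y) with hχ
  have hχc : ContDiff ℝ ∞ χ := hρc.comp (contDiff_const.sub contDiff_id)
  have hsupp : ∀ y, y ∉ K → ρ (x - y) = 0 := by
    intro y hy
    by_contra hne
    apply hy
    apply hx
    have : x - y ∈ Function.support ρ := hne
    rw [hρ, φ.support_normed_eq, mem_ball_zero_iff] at this
    rw [Metric.mem_closedBall, dist_eq_norm, norm_sub_rev]; exact this.le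
  have htK : tsupport χ ⊆ K := closure_minimal
    (fun y hy => by by_contra hn; exact hy (hsupp y hn)) hK.isClosed
  have hχs : HasCompactSupport χ := hK.of_isClosed_subset (isClosed_tsupport _) htK
  have key := hw.2.2 χ hχc hχs (htK.trans hKΩ)
  have hχ1 : ∀ y, fderiv ℝ χ y = -fderiv ℝ ρ (x - y) := by
    intro y
    have h1 : HasFDerivAt ρ (fderiv ℝ ρ (x - y)) (x - y) :=
      (hρ1.differentiable one_ne_zero _).hasFDerivAt
    have h2 := h1.comp y ((hasFDerivAt_id y).const_sub x)
    rw [show fderiv ℝ χ y = _ from h2.fderiv]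
    ext v; simp
  have hgradχ : Continuous (∇ χ) := by
    unfold gradient
    exact (LinearIsometryEquiv.continuous _).comp (hχc.continuous_fderiv (by simp))
  have hgs : ∀ y, y ∉ K → ∇ χ y = 0 := by
    intro y hy
    have : fderiv ℝ χ y = 0 := by
      by_contra hne
      exact hy (htK (support_fderiv_subset ℝ hne))
    simp [gradient, this]
  have e1 : ∫ y in Ω, u y • ∇ χ y = ∫ y, K.indicator u y • ∇ χ y := by
    rw [setIntegral_eq_integral_of_forall_compl_eq_zero (s := Ω) (μ := volume)
      (f := fun y => u y • ∇ χ y) (fun y hy => by rw [hgs y (fun h => hy (hKΩ h)), smul_zero])]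
    refine integral_congr_ae (Eventually.of_forall fun y => ?_)
    by_cases hy : y ∈ K
    · simp [hy]
    · simp [hgs y hy]
  have e2 : ∫ y in Ω, χ y • G y = ∫ y, χ y • K.indicator G y := by
    rw [setIntegral_eq_integral_of_forall_compl_eq_zero (s := Ω) (μ := volume)
      (f := fun y => χ y • G y) (fun y hy => by rw [show χ y = 0 from hsupp y (fun h => hy (hKΩ h)), zero_smul])]
    refine integral_congr_ae (Eventually.of_forall fun y => ?_)
    by_cases hy : y ∈ K
    · simp [hy]
    · simp [show χ y = 0 from hsupp y hy]
  rw [e1, e2] at key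
  have hbχ : ∃ C, ∀ y, ‖χ y‖ ≤ C := hχc.continuous.bounded_above_of_compact_support hχs
  obtain ⟨C, hC⟩ := hbχ
  have i2 : Integrable (fun y => χ y • K.indicator G y) :=
    hGi.bdd_smul C hχc.continuous.aestronglyMeasurable (Eventually.of_forall hC)
  have hbg : ∃ C, ∀ y, ‖∇ χ y‖ ≤ C := hgradχ.bounded_above_of_compact_support
    (hK.of_isClosed_subset (isClosed_tsupport _) (closure_minimal
      (fun y hy => by by_contra hn; exact hy (hgs y hn)) hK.isClosed))
  obtain ⟨C', hC'⟩ := hbg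
  have i1 : Integrable (fun y => K.indicator u y • ∇ χ y) :=
    hui.smul_bdd C' hgradχ.aestronglyMeasurable (Eventually.of_forall hC')
  have key2 := congrArg (fun w => ⟪h, w⟫) key
  simp only [inner_neg_right] at key2
  rw [← integral_inner i1, ← integral_inner i2] at key2
  have : ∀ y, ⟪h, K.indicator u y • ∇ χ y⟫ = -(fderiv ℝ ρ (x - y) h * K.indicator u y) := by
    intro y
    rw [inner_smul_right, real_inner_comm, gradient, InnerProductSpace.toDual_symm_apply, hχ1]
    simp [mul_comm]
  simp only [this, integral_neg, neg_inj] at key2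
  calc _ = ∫ y, fderiv ℝ ρ (x - y) h * K.indicator u y := by
        refine integral_congr_ae (Eventually.of_forall fun y => ?_)
        simp
    _ = _ := by
        rw [key2]
        refine integral_congr_ae (Eventually.of_forall fun y => ?_)
        simp only [hχ]
        rw [inner_smul_right, real_inner_comm]

set_option maxHeartbeats 600000 in
/-- Chain rule for the weak gradient of a continuous function, tested against `C¹` functions.
The gradients of the mollifications `uₙ` converge only weakly here: moving the mollifier to the
other factor, `∫ ψ f'(uₙ) (ρₙ * G) = ∫ (ρₙ * (ψ f'(uₙ))) G`, where the first factor converges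
pointwise and boundedly by continuity of `u`. -/
theorem HasWeakGradient.integral_comp_mul_fderiv {N : ℕ} {Ω : Set (EuclideanSpace ℝ (Fin N))}
    (hΩ : IsOpen Ω) {u : EuclideanSpace ℝ (Fin N) → ℝ}
    {G : EuclideanSpace ℝ (Fin N) → EuclideanSpace ℝ (Fin N)}
    (hu : ContinuousOn u Ω) (hw : HasWeakGradient Ω u G) {f f' : ℝ → ℝ}
    (hf : ∀ t, HasDerivAt f (f' t) t) (hf' : Continuous f')
    {ψ : EuclideanSpace ℝ (Fin N) → ℝ} (hψ : ContDiff ℝ 1 ψ) (hψs : HasCompactSupport ψ)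
    (hψΩ : tsupport ψ ⊆ Ω) (h : EuclideanSpace ℝ (Fin N)) :
    ∫ x in Ω, f (u x) * fderiv ℝ ψ x h = -∫ x in Ω, ψ x * (f' (u x) * ⟪G x, h⟫) := by
  have hfc : Continuous f := continuous_iff_continuousAt.2 fun t => (hf t).continuousAt
  set S := tsupport ψ with hS
  have hSc : IsCompact S := hψs
  obtain ⟨r, hr, hrΩ⟩ := hSc.exists_cthickening_subset_open hΩ hψΩ
  set K := Metric.cthickening r S with hK
  have hKc : IsCompact K := hSc.cthickening
  have hKm : MeasurableSet K := hKc.isClosed.measurableSet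
  have hGi : Integrable (K.indicator G) := (integrable_indicator_iff hKm).2
    ((hw.2.1.mono_set hrΩ).integrableOn_isCompact hKc)
  have huK : ContinuousOn u K := hu.mono hrΩ
  obtain ⟨M, hM⟩ := hKc.exists_bound_of_continuousOn huK
  have hM' : ∀ y, ‖K.indicator u y‖ ≤ max M 0 := by
    intro y
    by_cases hy : y ∈ K
    · simp only [hy, indicator_of_mem]; exact (hM y hy).trans (le_max_left _ _)
    · simp [hy]
  set R := max M 0 with hR
  have hui : Integrable (K.indicator u) := (integrable_indicator_iff hKm).2
    (huK.integrableOn_compact hKc)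
  -- mollifiers of radius `r / (n + 1)`
  obtain ⟨φ, hφ⟩ : ∃ φ : ℕ → ContDiffBump (0 : EuclideanSpace ℝ (Fin N)),
      ∀ n, (φ n).rOut = r / (n + 1) :=
    ⟨fun n => ⟨r / (n + 1) / 2, r / (n + 1), by positivity, half_lt_self (by positivity)⟩,
      fun n => rfl⟩
  have hφr : Tendsto (fun n => (φ n).rOut) atTop (𝓝 0) := by
    have := (tendsto_one_div_add_atTop_nhds_zero_nat (𝕜 := ℝ)).const_mul r
    simp only [mul_zero] at this
    refine this.congr fun n => ?_
    rw [hφ]; ring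
  have hφle : ∀ n, (φ n).rOut ≤ r := fun n => by
    rw [hφ]
    exact div_le_self hr.le (by linarith [Nat.cast_nonneg (α := ℝ) n])
  set ρ : ℕ → EuclideanSpace ℝ (Fin N) → ℝ := fun n => (φ n).normed volume with hρ
  set U : ℕ → EuclideanSpace ℝ (Fin N) → ℝ := fun n x => ∫ y, ρ n (x - y) * K.indicator u y
    with hU
  have hconv : ∀ n (w : EuclideanSpace ℝ (Fin N) → ℝ) x, ∫ y, ρ n (x - y) * w y =
      convolution (ρ n) w (ContinuousLinearMap.lsmul ℝ ℝ) volume x := by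
    intro n w x
    rw [convolution_eq_swap]; rfl
  have hball : ∀ x ∈ S, ∀ n, Metric.closedBall x (φ n).rOut ⊆ K := fun x hx n =>
    (Metric.closedBall_subset_closedBall (hφle n)).trans
      (Metric.closedBall_subset_cthickening hx r)
  have hρc : ∀ n, Continuous (ρ n) := fun n => (φ n).continuous_normed
  have hρs : ∀ n, HasCompactSupport (ρ n) := fun n => (φ n).hasCompactSupport_normed
  have hρint : ∀ n, Integrable (ρ n) := fun n => (hρc n).integrable_of_hasCompactSupport (hρs n)
  have hbound : ∀ n (w : EuclideanSpace ℝ (Fin N) → ℝ) (C : ℝ), (∀ y, ‖w y‖ ≤ C) →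
      ∀ x, ‖∫ y, ρ n (x - y) * w y‖ ≤ C := by
    intro n w C hwC x
    calc ‖∫ y, ρ n (x - y) * w y‖ ≤ ∫ y, ρ n (x - y) * C := by
          refine norm_integral_le_of_norm_le (((hρint n).comp_sub_left x).mul_const C)
            (Eventually.of_forall fun y => ?_)
          rw [norm_mul, Real.norm_of_nonneg ((φ n).nonneg_normed _)]
          exact mul_le_mul_of_nonneg_left (hwC y) ((φ n).nonneg_normed _)
      _ = C := by
          rw [integral_mul_const, integral_sub_left_eq_self (fun y => ρ n y) volume x,
            show ∫ y, ρ n y = 1 from (φ n).integral_normed, one_mul]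
  have hUb : ∀ n x, ‖U n x‖ ≤ R := fun n x => hbound n _ R hM' x
  have hUcont : ∀ n, Continuous (U n) := fun n => by
    have : U n = convolution (ρ n) (K.indicator u) (ContinuousLinearMap.lsmul ℝ ℝ) volume := by
      ext x; exact hconv n _ x
    rw [this]
    exact (hρs n).continuous_convolution_left _ (hρc n) hui.locallyIntegrable
  have hSK : ∀ x ∈ S, K ∈ 𝓝 x := fun x hx =>
    mem_of_superset (Metric.closedBall_mem_nhds x hr) (Metric.closedBall_subset_cthickening hx r)
  have hUlim : ∀ x ∈ S, Tendsto (fun q : ℕ × EuclideanSpace ℝ (Fin N) => U q.1 q.2)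
      (atTop ×ˢ 𝓝 x) (𝓝 (u x)) := by
    intro x hx
    have hcx : Tendsto (K.indicator u) (𝓝 x) (𝓝 (u x)) := by
      have h1 : ContinuousAt u x := huK.continuousAt (hSK x hx)
      refine h1.tendsto.congr' ?_
      filter_upwards [hSK x hx] with y hy
      simp [hy]
    have hcx' : Tendsto (Function.uncurry fun _ : ℕ × EuclideanSpace ℝ (Fin N) => K.indicator u)
        ((atTop ×ˢ 𝓝 x) ×ˢ 𝓝 x) (𝓝 (u x)) := by
      have h2 := hcx.comp (tendsto_snd (f := (atTop : Filter ℕ) ×ˢ 𝓝 x))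
      exact h2.congr fun _ => rfl
    have hr0 : Tendsto (fun q : ℕ × EuclideanSpace ℝ (Fin N) => (φ q.1).rOut) (atTop ×ˢ 𝓝 x)
        (𝓝 0) := hφr.comp tendsto_fst
    have := ContDiffBump.convolution_tendsto_right (μ := volume) hr0
      (Eventually.of_forall fun _ => hui.aestronglyMeasurable) hcx' tendsto_snd
    refine this.congr fun q => ?_
    exact (hconv q.1 _ q.2).symm
  have hUlim' : ∀ x ∈ S, Tendsto (fun n => U n x) atTop (𝓝 (u x)) := fun x hx =>
    (hUlim x hx).comp (tendsto_id.prodMk tendsto_const_nhds)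
  have hψ0 : ∀ x, x ∉ S → ψ x = 0 := fun x hx => image_eq_zero_of_notMem_tsupport hx
  have hdψ0 : ∀ x, x ∉ S → fderiv ℝ ψ x = 0 := fun x hx => by
    by_contra hne; exact hx (support_fderiv_subset ℝ hne)
  have hdψc : Continuous fun x => fderiv ℝ ψ x h :=
    (hψ.continuous_fderiv one_ne_zero).clm_apply continuous_const
  have hdψs : HasCompactSupport fun x => fderiv ℝ ψ x h := hψs.fderiv_apply ℝ h
  obtain ⟨Cf, hCf⟩ := (isCompact_Icc (a := -R) (b := R)).exists_bound_of_continuousOn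
    hfc.continuousOn
  obtain ⟨Cf', hCf'⟩ := (isCompact_Icc (a := -R) (b := R)).exists_bound_of_continuousOn
    hf'.continuousOn
  have hUI : ∀ n x, U n x ∈ Icc (-R) R := fun n x => abs_le.1 (hUb n x)
  obtain ⟨Cψ, hCψ⟩ := hψ.continuous.bounded_above_of_compact_support hψs
  -- the left-hand sides converge
  have lim1 : Tendsto (fun n => ∫ x, f (U n x) * fderiv ℝ ψ x h) atTop
      (𝓝 (∫ x, f (u x) * fderiv ℝ ψ x h)) := by
    refine tendsto_integral_of_dominated_convergence (fun x => Cf * ‖fderiv ℝ ψ x h‖)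
      (fun n => ((hfc.comp (hUcont n)).mul hdψc).aestronglyMeasurable)
      ((hdψc.integrable_of_hasCompactSupport hdψs).norm.const_mul _)
      (fun n => Eventually.of_forall fun x => ?_) (Eventually.of_forall fun x => ?_)
    · rw [norm_mul]
      exact mul_le_mul_of_nonneg_right (hCf _ (hUI n x)) (norm_nonneg _)
    · by_cases hx : x ∈ S
      · exact (((hfc.tendsto _).comp (hUlim' x hx))).mul_const _
      · simp [hdψ0 x hx]
  set Ψ : ℕ → EuclideanSpace ℝ (Fin N) → ℝ := fun n x => ψ x * f' (U n x) with hΨ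
  have hΨc : ∀ n, Continuous (Ψ n) := fun n => hψ.continuous.mul (hf'.comp (hUcont n))
  have hΨs : ∀ n, HasCompactSupport (Ψ n) := fun n => hψs.mul_right
  have hΨb : ∀ n x, ‖Ψ n x‖ ≤ Cψ * Cf' := fun n x => by
    rw [norm_mul]
    exact mul_le_mul (hCψ x) (hCf' _ (hUI n x)) (norm_nonneg _) ((norm_nonneg _).trans (hCψ x))
  set Gh : EuclideanSpace ℝ (Fin N) → ℝ := fun y => ⟪K.indicator G y, h⟫ with hGh
  have hGhi : Integrable Gh := hGi.inner_const h
  -- classical integration by parts for the mollified functions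
  have parts : ∀ n, ∫ x, f (U n x) * fderiv ℝ ψ x h =
      -∫ y, (∫ x, ρ n (y - x) * Ψ n x) * Gh y := by
    intro n
    have hUd : ∀ x ∈ S, HasFDerivAt (U n) (fderiv ℝ (U n) x) x ∧
        fderiv ℝ (U n) x h = ∫ y, ρ n (x - y) * Gh y := fun x hx =>
      hw.fderiv_convolution_apply hKc hrΩ (φ n) (hball x hx n) h
    have hfU : ∀ x ∈ S, HasFDerivAt (fun x => f (U n x)) (f' (U n x) • fderiv ℝ (U n) x) x :=
      fun x hx => (hf (U n x)).comp_hasFDerivAt x (hUd x hx).1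
    have hcv : Continuous fun x => ∫ y, ρ n (x - y) * Gh y := by
      have : (fun x => ∫ y, ρ n (x - y) * Gh y) =
          convolution (ρ n) Gh (ContinuousLinearMap.lsmul ℝ ℝ) volume := by
        ext x; exact hconv n _ x
      rw [this]
      exact (hρs n).continuous_convolution_left _ (hρc n) hGhi.locallyIntegrable
    have heq : (fun x => fderiv ℝ (fun x => f (U n x)) x h * ψ x) =
        fun x => Ψ n x * ∫ y, ρ n (x - y) * Gh y := by
      ext x
      by_cases hx : x ∈ S
      · rw [(hfU x hx).fderiv]
        simp only [smul_apply, smul_eq_mul, (hUd x hx).2, hΨ]; ring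
      · simp [hΨ, hψ0 x hx]
    have hi1 : Integrable fun x => fderiv ℝ (fun x => f (U n x)) x h * ψ x := by
      rw [heq]
      exact ((hΨc n).mul hcv).integrable_of_hasCompactSupport (hΨs n).mul_right
    rw [integral_mul_fderiv_eq_neg_fderiv_mul_of_integrable hi1
      (((hfc.comp (hUcont n)).mul hdψc).integrable_of_hasCompactSupport hdψs.mul_left)
      (((hfc.comp (hUcont n)).mul hψ.continuous).integrable_of_hasCompactSupport hψs.mul_left)
      (fun x hx => (hfU x hx).differentiableAt)
      (fun x _ => hψ.differentiable one_ne_zero x), heq]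
    congr 1
    simp_rw [← integral_const_mul, ← integral_mul_const]
    rw [integral_integral_swap]
    · refine integral_congr_ae (Eventually.of_forall fun y => ?_)
      refine integral_congr_ae (Eventually.of_forall fun x => ?_)
      have : ρ n (y - x) = ρ n (x - y) := by
        rw [← neg_sub, hρ]; exact (φ n).normed_neg _
      simp only [this]; ring
    · have hp : Integrable (fun q : EuclideanSpace ℝ (Fin N) × EuclideanSpace ℝ (Fin N) =>
          Ψ n q.1 * Gh q.2) (volume.prod volume) :=
        ((hΨc n).integrable_of_hasCompactSupport (hΨs n)).mul_prod hGhi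
      obtain ⟨Cρ, hCρ⟩ := (hρc n).bounded_above_of_compact_support (hρs n)
      have := hp.bdd_mul (c := Cρ) (f := fun q : EuclideanSpace ℝ (Fin N) ×
        EuclideanSpace ℝ (Fin N) => ρ n (q.1 - q.2))
        ((hρc n).comp (continuous_fst.sub continuous_snd)).aestronglyMeasurable
        (Eventually.of_forall fun q => hCρ _)
      refine this.congr (Eventually.of_forall fun q => ?_)
      simp only [Function.uncurry]; ring
  -- the right-hand sides converge
  have lim2 : Tendsto (fun n => ∫ y, (∫ x, ρ n (y - x) * Ψ n x) * Gh y) atTop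
      (𝓝 (∫ y, (ψ y * f' (u y)) * Gh y)) := by
    refine tendsto_integral_of_dominated_convergence (fun y => Cψ * Cf' * ‖Gh y‖)
      (fun n => ?_) (hGhi.norm.const_mul _)
      (fun n => Eventually.of_forall fun y => ?_) (Eventually.of_forall fun y => ?_)
    · have : (fun x => ∫ y, ρ n (x - y) * Ψ n y) =
          convolution (ρ n) (Ψ n) (ContinuousLinearMap.lsmul ℝ ℝ) volume := by
        ext x; exact hconv n _ x
      have hc : Continuous (fun x => ∫ y, ρ n (x - y) * Ψ n y) := by
        rw [this]
        exact (hρs n).continuous_convolution_left _ (hρc n) (hΨc n).locallyIntegrable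
      exact hc.aestronglyMeasurable.mul hGhi.aestronglyMeasurable
    · rw [norm_mul]
      exact mul_le_mul_of_nonneg_right (hbound n _ _ (hΨb n) y) (norm_nonneg _)
    · refine Tendsto.mul_const _ ?_
      have hj : Tendsto (Function.uncurry Ψ) (atTop ×ˢ 𝓝 y) (𝓝 (ψ y * f' (u y))) := by
        by_cases hy : y ∈ S
        · exact ((hψ.continuous.tendsto y).comp tendsto_snd).mul
            ((hf'.tendsto _).comp (hUlim y hy))
        · rw [hψ0 y hy, zero_mul]
          refine tendsto_const_nhds.congr' ?_
          have : ∀ᶠ z in 𝓝 y, z ∉ S := (isClosed_tsupport ψ).isOpen_compl.mem_nhds hy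
          filter_upwards [tendsto_snd.eventually this] with q hq
          simp [Function.uncurry, hΨ, hψ0 q.2 hq]
      have := ContDiffBump.convolution_tendsto_right (μ := volume) (φ := φ) (g := Ψ)
        (k := fun _ => y) (l := atTop) (x₀ := y) hφr
        (Eventually.of_forall fun n => (hΨc n).aestronglyMeasurable) hj tendsto_const_nhds
      exact this.congr fun n => (hconv n _ y).symm
  have hfin := tendsto_nhds_unique lim1 ((lim2.neg).congr fun n => (parts n).symm)
  rw [setIntegral_eq_integral_of_forall_compl_eq_zero
      (fun x hx => by rw [hdψ0 x (fun h => hx (hψΩ h))]; simp), hfin, neg_inj,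
    setIntegral_eq_integral_of_forall_compl_eq_zero
      (fun x hx => by rw [hψ0 x (fun h => hx (hψΩ h)), zero_mul])]
  refine integral_congr_ae (Eventually.of_forall fun y => ?_)
  by_cases hy : y ∈ S
  · have : y ∈ K := mem_of_mem_nhds (hSK y hy)
    simp only [hGh, this, indicator_of_mem]; ring
  · simp [hψ0 y hy]

theorem inner_gradient {N : ℕ} (φ : EuclideanSpace ℝ (Fin N) → ℝ)
    (x h : EuclideanSpace ℝ (Fin N)) : ⟪∇ φ x, h⟫ = fderiv ℝ φ x h := by
  rw [gradient, InnerProductSpace.toDual_symm_apply]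

theorem continuous_gradient {N : ℕ} {φ : EuclideanSpace ℝ (Fin N) → ℝ} (h : ContDiff ℝ 1 φ) :
    Continuous (∇ φ) := by
  unfold gradient
  exact (LinearIsometryEquiv.continuous _).comp (h.continuous_fderiv one_ne_zero)

theorem integrableOn_smul_of_tsupport_subset {N : ℕ} {F : Type*} [NormedAddCommGroup F]
    [NormedSpace ℝ F] {Ω : Set (EuclideanSpace ℝ (Fin N))} {η : EuclideanSpace ℝ (Fin N) → ℝ}
    {f : EuclideanSpace ℝ (Fin N) → F} (hf : LocallyIntegrableOn f Ω) (hη : Continuous η)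
    (hs : HasCompactSupport η) (hΩ : tsupport η ⊆ Ω) : IntegrableOn (fun x => η x • f x) Ω := by
  have h1 : IntegrableOn (fun x => η x • f x) (tsupport η) :=
    ((hf.mono_set hΩ).integrableOn_isCompact hs).continuousOn_smul hη.continuousOn hs
  have h2 := (integrableOn_iff_integrable_of_support_subset (s := tsupport η) (μ := volume)
    (f := fun x => η x • f x) fun x hx =>
      subset_tsupport η (fun h0 => hx (by simp [h0]))).1 h1
  exact h2.integrableOn

theorem integrableOn_smul_gradient {N : ℕ} {Ω : Set (EuclideanSpace ℝ (Fin N))}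
    {u ψ : EuclideanSpace ℝ (Fin N) → ℝ} (hu : LocallyIntegrableOn u Ω) (hψ : ContDiff ℝ 1 ψ)
    (hs : HasCompactSupport ψ) (hΩ : tsupport ψ ⊆ Ω) : IntegrableOn (fun x => u x • ∇ ψ x) Ω := by
  have hts : tsupport (∇ ψ) ⊆ tsupport ψ := by
    refine closure_minimal (fun x hx => support_fderiv_subset ℝ (f := ψ) fun h0 => hx ?_)
      (isClosed_tsupport ψ)
    simp [gradient, h0]
  have hK : IsCompact (tsupport (∇ ψ)) := hs.of_isClosed_subset (isClosed_tsupport _) hts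
  have h1 : IntegrableOn (fun x => u x • ∇ ψ x) (tsupport (∇ ψ)) :=
    ((hu.mono_set (hts.trans hΩ)).integrableOn_isCompact hK).smul_continuousOn
      (continuous_gradient hψ).continuousOn hK
  have h2 := (integrableOn_iff_integrable_of_support_subset (s := tsupport (∇ ψ)) (μ := volume)
    (f := fun x => u x • ∇ ψ x) fun x hx =>
      subset_tsupport _ (fun h0 => hx (by simp [h0]))).1 h1
  exact h2.integrableOn

/-- The weak gradient can be tested direction by direction. -/
theorem hasWeakGradient_of_forall_fderiv {N : ℕ} {Ω : Set (EuclideanSpace ℝ (Fin N))}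
    {u : EuclideanSpace ℝ (Fin N) → ℝ} {G : EuclideanSpace ℝ (Fin N) → EuclideanSpace ℝ (Fin N)}
    (hu : LocallyIntegrableOn u Ω) (hG : LocallyIntegrableOn G Ω)
    (h : ∀ ψ : EuclideanSpace ℝ (Fin N) → ℝ, ContDiff ℝ ∞ ψ → HasCompactSupport ψ →
      tsupport ψ ⊆ Ω → ∀ e, ∫ x in Ω, u x * fderiv ℝ ψ x e = -∫ x in Ω, ψ x * ⟪G x, e⟫) :
    HasWeakGradient Ω u G := by
  refine ⟨hu, hG, fun ψ hψ hs hΩ => ?_⟩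
  have hψ1 : ContDiff ℝ 1 ψ := hψ.of_le (by norm_cast)
  have i1 := integrableOn_smul_gradient hu hψ1 hs hΩ
  have i2 := integrableOn_smul_of_tsupport_subset hG hψ.continuous hs hΩ
  refine ext_inner_left ℝ fun e => ?_
  rw [inner_neg_right, ← integral_inner i1, ← integral_inner i2]
  have := h ψ hψ hs hΩ e
  simp only [real_inner_comm _ e, real_inner_smul_left, inner_gradient]
  exact this

theorem HasWeakGradient.integral_mul_fderiv {N : ℕ} {Ω : Set (EuclideanSpace ℝ (Fin N))}
    (hΩ : IsOpen Ω) {u : EuclideanSpace ℝ (Fin N) → ℝ}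
    {G : EuclideanSpace ℝ (Fin N) → EuclideanSpace ℝ (Fin N)}
    (hu : ContinuousOn u Ω) (hw : HasWeakGradient Ω u G)
    {ψ : EuclideanSpace ℝ (Fin N) → ℝ} (hψ : ContDiff ℝ 1 ψ) (hψs : HasCompactSupport ψ)
    (hψΩ : tsupport ψ ⊆ Ω) (h : EuclideanSpace ℝ (Fin N)) :
    ∫ x in Ω, u x * fderiv ℝ ψ x h = -∫ x in Ω, ψ x * ⟪G x, h⟫ := by
  have := hw.integral_comp_mul_fderiv hΩ hu (f := id) (f' := fun _ => 1) hasDerivAt_id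
    continuous_const hψ hψs hψΩ h
  simpa using this

theorem hasWeakGradient_of_contDiff {N : ℕ} {Ω : Set (EuclideanSpace ℝ (Fin N))}
    (hΩ : IsOpen Ω) {φ : EuclideanSpace ℝ (Fin N) → ℝ} (hφ : ContDiff ℝ 1 φ) :
    HasWeakGradient Ω φ (∇ φ) := by
  refine hasWeakGradient_of_forall_fderiv
    (hφ.continuous.continuousOn.locallyIntegrableOn hΩ.measurableSet)
    ((continuous_gradient hφ).continuousOn.locallyIntegrableOn hΩ.measurableSet)
    fun ψ hψ hs hsΩ e => ?_
  have hψ1 : ContDiff ℝ 1 ψ := hψ.of_le (by norm_cast)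
  have hψ0 : ∀ x, x ∉ tsupport ψ → ψ x = 0 := fun x hx => image_eq_zero_of_notMem_tsupport hx
  have hdψ0 : ∀ x, x ∉ tsupport ψ → fderiv ℝ ψ x = 0 := fun x hx => by
    by_contra hne; exact hx (support_fderiv_subset ℝ hne)
  have e1 : ∫ x in Ω, φ x * fderiv ℝ ψ x e = ∫ x, φ x * fderiv ℝ ψ x e :=
    setIntegral_eq_integral_of_forall_compl_eq_zero
      (fun x hx => by rw [hdψ0 x (fun h => hx (hsΩ h))]; simp)
  have e2 : ∫ x in Ω, ψ x * ⟪∇ φ x, e⟫ = ∫ x, ψ x * fderiv ℝ φ x e := by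
    simp only [inner_gradient]
    exact setIntegral_eq_integral_of_forall_compl_eq_zero
      (fun x hx => by rw [hψ0 x (fun h => hx (hsΩ h)), zero_mul])
  have hdc : Continuous fun x => fderiv ℝ ψ x e :=
    (hψ1.continuous_fderiv one_ne_zero).clm_apply continuous_const
  have hdc' : Continuous fun x => fderiv ℝ φ x e :=
    (hφ.continuous_fderiv one_ne_zero).clm_apply continuous_const
  rw [e1, e2, integral_mul_fderiv_eq_neg_fderiv_mul_of_integrable
    ((hdc'.mul hψ.continuous).integrable_of_hasCompactSupport hs.mul_left)
    ((hφ.continuous.mul hdc).integrable_of_hasCompactSupport (hs.fderiv_apply ℝ e).mul_left)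
    ((hφ.continuous.mul hψ.continuous).integrable_of_hasCompactSupport hs.mul_left)
    (fun x _ => hφ.differentiable one_ne_zero x) (fun x _ => hψ1.differentiable one_ne_zero x)]
  simp only [mul_comm]

theorem HasWeakGradient.sub {N : ℕ} {Ω : Set (EuclideanSpace ℝ (Fin N))}
    {u u' : EuclideanSpace ℝ (Fin N) → ℝ}
    {G G' : EuclideanSpace ℝ (Fin N) → EuclideanSpace ℝ (Fin N)}
    (h : HasWeakGradient Ω u G) (h' : HasWeakGradient Ω u' G') :
    HasWeakGradient Ω (fun x => u x - u' x) (fun x => G x - G' x) := by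
  have l1 : LocallyIntegrableOn (u - u') Ω := LocallyIntegrableOn.sub h.1 h'.1
  have l2 : LocallyIntegrableOn (G - G') Ω := LocallyIntegrableOn.sub h.2.1 h'.2.1
  rw [Pi.sub_def] at l1 l2
  refine ⟨l1, l2, fun ψ hψ hs hΩ => ?_⟩
  have hψ1 : ContDiff ℝ 1 ψ := hψ.of_le (by norm_cast)
  have i1 := integrableOn_smul_gradient h.1 hψ1 hs hΩ
  have i1' := integrableOn_smul_gradient h'.1 hψ1 hs hΩ
  have i2 := integrableOn_smul_of_tsupport_subset h.2.1 hψ.continuous hs hΩ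
  have i2' := integrableOn_smul_of_tsupport_subset h'.2.1 hψ.continuous hs hΩ
  simp only [sub_smul, smul_sub]
  rw [integral_sub i1 i1', integral_sub i2 i2', h.2.2 ψ hψ hs hΩ, h'.2.2 ψ hψ hs hΩ]
  abel

/-- Chain rule: `f ∘ u` has weak gradient `f'(u) G`. -/
theorem HasWeakGradient.comp {N : ℕ} {Ω : Set (EuclideanSpace ℝ (Fin N))}
    (hΩ : IsOpen Ω) {u : EuclideanSpace ℝ (Fin N) → ℝ}
    {G : EuclideanSpace ℝ (Fin N) → EuclideanSpace ℝ (Fin N)}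
    (hu : ContinuousOn u Ω) (hw : HasWeakGradient Ω u G) {f f' : ℝ → ℝ}
    (hf : ∀ t, HasDerivAt f (f' t) t) (hf' : Continuous f') :
    HasWeakGradient Ω (fun x => f (u x)) (fun x => f' (u x) • G x) := by
  have hfc : Continuous f := continuous_iff_continuousAt.2 fun t => (hf t).continuousAt
  refine hasWeakGradient_of_forall_fderiv
    ((hfc.comp_continuousOn hu).locallyIntegrableOn hΩ.measurableSet) ?_
    fun ψ hψ hs hsΩ e => ?_
  · exact hw.2.1.continuousOn_smul hΩ.isLocallyClosed (hf'.comp_continuousOn hu)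
  · rw [hw.integral_comp_mul_fderiv hΩ hu hf hf' (hψ.of_le (by norm_cast)) hs hsΩ]
    simp only [real_inner_smul_left]

/-! ### Integration by parts against a vector field -/

/-- The divergence `∑ᵢ ∂ᵢFᵢ` of a vector field. -/
noncomputable def divergence {N : ℕ} (F : EuclideanSpace ℝ (Fin N) → EuclideanSpace ℝ (Fin N))
    (x : EuclideanSpace ℝ (Fin N)) : ℝ :=
  LinearMap.trace ℝ (EuclideanSpace ℝ (Fin N)) (fderiv ℝ F x).toLinearMap

theorem continuous_trace {N : ℕ} :
    Continuous fun A : EuclideanSpace ℝ (Fin N) →L[ℝ] EuclideanSpace ℝ (Fin N) =>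
      LinearMap.trace ℝ (EuclideanSpace ℝ (Fin N)) A.toLinearMap := by
  let T : (EuclideanSpace ℝ (Fin N) →L[ℝ] EuclideanSpace ℝ (Fin N)) →ₗ[ℝ] ℝ :=
    (LinearMap.trace ℝ (EuclideanSpace ℝ (Fin N))).comp (ContinuousLinearMap.coeLM ℝ)
  exact T.continuous_of_finiteDimensional

theorem continuousOn_divergence {N : ℕ} {W : Set (EuclideanSpace ℝ (Fin N))} (hW : IsOpen W)
    {F : EuclideanSpace ℝ (Fin N) → EuclideanSpace ℝ (Fin N)} (hF : ContDiffOn ℝ 1 F W) :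
    ContinuousOn (divergence F) W :=
  continuous_trace.comp_continuousOn (hF.continuousOn_fderiv_of_isOpen hW le_rfl)

theorem divergence_smul {N : ℕ} {F : EuclideanSpace ℝ (Fin N) → EuclideanSpace ℝ (Fin N)}
    {η : EuclideanSpace ℝ (Fin N) → ℝ} {x : EuclideanSpace ℝ (Fin N)}
    (hη : DifferentiableAt ℝ η x) (hF : DifferentiableAt ℝ F x) :
    divergence (fun y => η y • F y) x = η x * divergence F x + fderiv ℝ η x (F x) := by
  have h := hη.hasFDerivAt.smul hF.hasFDerivAt
  unfold divergence
  rw [show fderiv ℝ (fun y => η y • F y) x = _ from h.fderiv]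
  simp only [ContinuousLinearMap.toLinearMap_add, ContinuousLinearMap.toLinearMap_smul, map_add,
    map_smul, smul_eq_mul]
  congr 1
  exact LinearMap.trace_smulRight (fderiv ℝ η x).toLinearMap (F x)

theorem contDiff_smul_of_tsupport_subset {N : ℕ} {W : Set (EuclideanSpace ℝ (Fin N))}
    (hW : IsOpen W) {F : EuclideanSpace ℝ (Fin N) → EuclideanSpace ℝ (Fin N)}
    (hF : ContDiffOn ℝ 1 F W) {η : EuclideanSpace ℝ (Fin N) → ℝ} (hη : ContDiff ℝ 1 η)
    (hsW : tsupport η ⊆ W) : ContDiff ℝ 1 (fun x => η x • F x) := by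
  refine contDiff_iff_contDiffAt.2 fun x => ?_
  by_cases hx : x ∈ tsupport η
  · exact hη.contDiffAt.smul (hF.contDiffAt (hW.mem_nhds (hsW hx)))
  · have : (fun y => η y • F y) =ᶠ[𝓝 x] fun _ => 0 := by
      filter_upwards [(isClosed_tsupport η).isOpen_compl.mem_nhds hx] with y hy
      rw [image_eq_zero_of_notMem_tsupport hy, zero_smul]
    exact contDiffAt_const.congr_of_eventuallyEq this

set_option maxHeartbeats 400000 in
/-- Integration by parts of a continuous function with a weak gradient against the vector field
`η F`, where the cutoff `η` is compactly supported in the open set where `F` is `C¹`. -/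
theorem HasWeakGradient.integral_mul_inner {N : ℕ} {Ω W : Set (EuclideanSpace ℝ (Fin N))}
    (hΩ : IsOpen Ω) {v : EuclideanSpace ℝ (Fin N) → ℝ}
    {V F : EuclideanSpace ℝ (Fin N) → EuclideanSpace ℝ (Fin N)}
    (hv : ContinuousOn v Ω) (hw : HasWeakGradient Ω v V) (hW : IsOpen W) (hWΩ : W ⊆ Ω)
    (hF : ContDiffOn ℝ 1 F W) {η : EuclideanSpace ℝ (Fin N) → ℝ} (hη : ContDiff ℝ 1 η)
    (hs : HasCompactSupport η) (hsW : tsupport η ⊆ W) :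
    ∫ x in Ω, η x * ⟪F x, V x⟫ =
      -∫ x in Ω, v x * (η x * divergence F x + fderiv ℝ η x (F x)) := by
  set H : EuclideanSpace ℝ (Fin N) → EuclideanSpace ℝ (Fin N) := fun x => η x • F x with hH
  have hH1 : ContDiff ℝ 1 H := contDiff_smul_of_tsupport_subset hW hF hη hsW
  have hHs : tsupport H ⊆ tsupport η :=
    closure_mono fun x hx h0 => hx (by simp [hH, h0])
  have hHc : HasCompactSupport H := hs.of_isClosed_subset (isClosed_tsupport _) hHs
  set b := EuclideanSpace.basisFun (Fin N) ℝ with hb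
  have hψ : ∀ i, ContDiff ℝ 1 (fun x => ⟪H x, b i⟫) := fun i => hH1.inner ℝ contDiff_const
  have hψt : ∀ i, tsupport (fun x => ⟪H x, b i⟫) ⊆ tsupport H := fun i =>
    closure_mono fun x hx h0 => hx (by simp [h0])
  have hψs : ∀ i, HasCompactSupport (fun x => ⟪H x, b i⟫) := fun i =>
    hHc.of_isClosed_subset (isClosed_tsupport _) (hψt i)
  have hψΩ : ∀ i, tsupport (fun x => ⟪H x, b i⟫) ⊆ Ω := fun i =>
    (hψt i).trans (hHs.trans (hsW.trans hWΩ))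
  have key : ∀ i, ∫ x in Ω, v x * fderiv ℝ (fun x => ⟪H x, b i⟫) x (b i) =
      -∫ x in Ω, ⟪H x, b i⟫ * ⟪V x, b i⟫ := fun i =>
    hw.integral_mul_fderiv hΩ hv (hψ i) (hψs i) (hψΩ i) (b i)
  have hvl : LocallyIntegrableOn v Ω := hw.1
  have i1 : ∀ i, IntegrableOn (fun x => v x * fderiv ℝ (fun x => ⟪H x, b i⟫) x (b i)) Ω := by
    intro i
    have hc : Continuous fun x => fderiv ℝ (fun x => ⟪H x, b i⟫) x (b i) :=
      ((hψ i).continuous_fderiv one_ne_zero).clm_apply continuous_const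
    have := integrableOn_smul_of_tsupport_subset hvl hc ((hψs i).fderiv_apply ℝ (b i))
      ((tsupport_fderiv_apply_subset ℝ (b i)).trans (hψΩ i))
    exact this.congr_fun_ae (Eventually.of_forall fun x => mul_comm _ _)
  have i2 : ∀ i, IntegrableOn (fun x => ⟪H x, b i⟫ * ⟪V x, b i⟫) Ω := by
    intro i
    have hVl : LocallyIntegrableOn (fun x => ⟪V x, b i⟫) Ω := by
      intro x hx
      obtain ⟨t, ht, hti⟩ := hw.2.1 x hx
      exact ⟨t, ht, hti.inner_const (b i)⟩
    exact integrableOn_smul_of_tsupport_subset hVl (hψ i).continuous (hψs i) (hψΩ i)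
  have hsum := Finset.sum_congr rfl fun i (_ : i ∈ Finset.univ) => key i
  rw [← integral_finsetSum _ (fun i _ => i1 i), Finset.sum_neg_distrib,
    ← integral_finsetSum _ (fun i _ => i2 i)] at hsum
  have e1 : ∀ x, ∑ i, ⟪H x, b i⟫ * ⟪V x, b i⟫ = η x * ⟪F x, V x⟫ := by
    intro x
    have := b.sum_inner_mul_inner (H x) (V x)
    simp only [real_inner_comm (V x)] at this ⊢
    rw [this, hH]
    exact real_inner_smul_right _ _ _
  have e2 : ∀ x ∈ Ω, ∑ i, v x * fderiv ℝ (fun x => ⟪H x, b i⟫) x (b i) =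
      v x * (η x * divergence F x + fderiv ℝ η x (F x)) := by
    intro x hx
    rw [← Finset.mul_sum]
    congr 1
    have hd : divergence H x = ∑ i, fderiv ℝ (fun x => ⟪H x, b i⟫) x (b i) := by
      unfold divergence
      rw [LinearMap.trace_eq_sum_inner _ b]
      refine Finset.sum_congr rfl fun i _ => ?_
      have := (((hH1.differentiable one_ne_zero) x).hasFDerivAt.inner ℝ
        (hasFDerivAt_const (b i) x))
      rw [this.fderiv]
      simp [real_inner_comm]
    rw [← hd]
    by_cases hxs : x ∈ tsupport η
    · exact divergence_smul (hη.differentiable one_ne_zero x)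
        ((hF.contDiffAt (hW.mem_nhds (hsW hxs))).differentiableAt one_ne_zero)
    · have h0 : H =ᶠ[𝓝 x] fun _ => 0 := by
        filter_upwards [(isClosed_tsupport η).isOpen_compl.mem_nhds hxs] with y hy
        simp only [hH]
        rw [image_eq_zero_of_notMem_tsupport hy, zero_smul]
      have h1 : fderiv ℝ η x = 0 := by
        by_contra hne; exact hxs (support_fderiv_subset ℝ hne)
      rw [divergence, h0.fderiv_eq, h1, image_eq_zero_of_notMem_tsupport hxs]
      simp
  simp only [e1] at hsum
  rw [setIntegral_congr_fun hΩ.measurableSet e2] at hsum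
  rw [hsum, neg_neg]

/-! ### Test functions built from touching functions -/

theorem hasDerivAt_max_zero_sq (t : ℝ) :
    HasDerivAt (fun s : ℝ => (max s 0) ^ 2) (2 * max t 0) t := by
  rcases lt_trichotomy t 0 with ht | rfl | ht
  · have : (fun s : ℝ => (max s 0) ^ 2) =ᶠ[𝓝 t] fun _ => 0 := by
      filter_upwards [Iio_mem_nhds ht] with s hs
      simp [max_eq_right (le_of_lt (mem_Iio.1 hs))]
    rw [max_eq_right ht.le, mul_zero]
    exact (hasDerivAt_const t (0 : ℝ)).congr_of_eventuallyEq this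
  · rw [hasDerivAt_iff_isLittleO]
    have h1 : (fun s : ℝ => s ^ 2) =o[𝓝 0] fun s : ℝ => s := by
      simpa using Asymptotics.isLittleO_pow_pow (𝕜 := ℝ) (m := 1) (n := 2) (by norm_num)
    refine Asymptotics.IsBigO.trans_isLittleO (g := fun s : ℝ => s ^ 2) ?_ (by simpa using h1)
    refine Asymptotics.isBigO_of_le _ fun s => ?_
    simp only [max_self, mul_zero, smul_zero, sub_zero, norm_pow, ne_eq, OfNat.ofNat_ne_zero,
      not_false_eq_true, zero_pow]
    refine pow_le_pow_left₀ (norm_nonneg _) ?_ 2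
    rw [Real.norm_of_nonneg (le_max_right _ _)]
    exact max_le (le_abs_self s) (norm_nonneg s)
  · have : (fun s : ℝ => (max s 0) ^ 2) =ᶠ[𝓝 t] fun s => s ^ 2 := by
      filter_upwards [Ioi_mem_nhds ht] with s hs
      rw [max_eq_left (le_of_lt (mem_Ioi.1 hs))]
    rw [max_eq_left ht.le]
    exact ((hasDerivAt_pow 2 t).congr_of_eventuallyEq this).congr_deriv (by simp)

/-- Monotonicity of the vector field `a ↦ |a|^{q-2} a`. -/
theorem inner_rpow_smul_sub_nonneg {E : Type*} [NormedAddCommGroup E] [InnerProductSpace ℝ E]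
    {q : ℝ} (hq : 2 ≤ q) (a b : E) :
    0 ≤ ⟪‖a‖ ^ (q - 2) • a - ‖b‖ ^ (q - 2) • b, a - b⟫ := by
  set A := ‖a‖ ^ (q - 2)
  set B := ‖b‖ ^ (q - 2)
  have hA : 0 ≤ A := Real.rpow_nonneg (norm_nonneg _) _
  have hB : 0 ≤ B := Real.rpow_nonneg (norm_nonneg _) _
  have h1 : ⟪A • a - B • b, a - b⟫ = A * ‖a‖ ^ 2 + B * ‖b‖ ^ 2 - (A + B) * ⟪a, b⟫ := by
    simp only [inner_sub_left, inner_sub_right, real_inner_smul_left, real_inner_self_eq_norm_sq,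
      real_inner_comm a b]
    ring
  have h2 : ⟪a, b⟫ ≤ ‖a‖ * ‖b‖ := real_inner_le_norm a b
  have h3 : 0 ≤ (A * ‖a‖ - B * ‖b‖) * (‖a‖ - ‖b‖) := by
    rcases le_total ‖a‖ ‖b‖ with h | h
    · have : A ≤ B := Real.rpow_le_rpow (norm_nonneg _) h (by linarith)
      refine mul_nonneg_of_nonpos_of_nonpos ?_ (by linarith)
      linarith [mul_le_mul this h (norm_nonneg a) hB]
    · have : B ≤ A := Real.rpow_le_rpow (norm_nonneg _) h (by linarith)
      refine mul_nonneg ?_ (by linarith)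
      linarith [mul_le_mul this h (norm_nonneg b) hA]
  rw [h1]
  nlinarith [mul_le_mul_of_nonneg_left h2 (add_nonneg hA hB)]

theorem MemVarLp.integrableOn_rpow {N : ℕ} {F : Type*} [NormedAddCommGroup F]
    {Ω : Set (EuclideanSpace ℝ (Fin N))} (hΩ : MeasurableSet Ω)
    {q : EuclideanSpace ℝ (Fin N) → ℝ} {G : EuclideanSpace ℝ (Fin N) → F} {k : ℝ}
    (hG : MemVarLp Ω q G) (hqm : AEMeasurable q (volume.restrict Ω))
    (hq : ∀ x ∈ Ω, 0 ≤ q x ∧ q x ≤ k) : IntegrableOn (fun x => ‖G x‖ ^ q x) Ω := by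
  obtain ⟨hm, c, hc, hfin⟩ := hG
  have hm' : AEStronglyMeasurable (fun x => (c * ‖G x‖) ^ q x) (volume.restrict Ω) :=
    ((hm.norm.aemeasurable.const_mul c).pow hqm).aestronglyMeasurable
  have h1 : IntegrableOn (fun x => (c * ‖G x‖) ^ q x) Ω := by
    refine ⟨hm', ?_⟩
    rw [hasFiniteIntegral_iff_ofReal (Eventually.of_forall fun x =>
      Real.rpow_nonneg (by positivity) _)]
    exact hfin
  refine (h1.const_mul (max 1 c⁻¹ ^ k)).mono'
    (hm.norm.aemeasurable.pow hqm).aestronglyMeasurable ?_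
  filter_upwards [ae_restrict_mem hΩ] with x hx
  have h0 : 0 ≤ ‖G x‖ ^ q x := Real.rpow_nonneg (norm_nonneg _) _
  rw [Real.norm_of_nonneg h0]
  have : ‖G x‖ ^ q x = c⁻¹ ^ q x * (c * ‖G x‖) ^ q x := by
    rw [← Real.mul_rpow (by positivity) (by positivity), inv_mul_cancel_left₀ hc.ne']
  rw [this]
  refine mul_le_mul_of_nonneg_right ?_ (Real.rpow_nonneg (by positivity) _)
  calc c⁻¹ ^ q x ≤ max 1 c⁻¹ ^ q x :=
        Real.rpow_le_rpow (by positivity) (le_max_right _ _) (hq x hx).1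
    _ ≤ max 1 c⁻¹ ^ k := Real.rpow_le_rpow_of_exponent_le (le_max_left _ _) (hq x hx).2

theorem memVarLp_of_norm_le {N : ℕ} {F : Type*} [NormedAddCommGroup F]
    {Ω : Set (EuclideanSpace ℝ (Fin N))} (hΩ : MeasurableSet Ω) (hΩb : Bornology.IsBounded Ω)
    {q : EuclideanSpace ℝ (Fin N) → ℝ} {V : EuclideanSpace ℝ (Fin N) → F}
    {G : EuclideanSpace ℝ (Fin N) → EuclideanSpace ℝ (Fin N)} {k C L : ℝ}
    (hG : IntegrableOn (fun x => ‖G x‖ ^ q x) Ω)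
    (hV : AEStronglyMeasurable V (volume.restrict Ω)) (hC : 1 ≤ C) (hL : 1 ≤ L)
    (hq : ∀ x ∈ Ω, 0 ≤ q x ∧ q x ≤ k) (hle : ∀ x ∈ Ω, ‖V x‖ ≤ C * (‖G x‖ + L)) :
    MemVarLp Ω q V := by
  have hC0 : 0 < C := by linarith
  refine ⟨hV, (2 * C)⁻¹, by positivity, ?_⟩
  have hfin : volume Ω ≠ ⊤ := hΩb.measure_lt_top.ne
  have hint : IntegrableOn (fun x => ‖G x‖ ^ q x + L ^ k) Ω := hG.add (integrableOn_const hfin)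
  have h2 := hint.2
  rw [hasFiniteIntegral_iff_norm] at h2
  refine lt_of_le_of_lt (lintegral_mono_ae ?_) h2
  filter_upwards [ae_restrict_mem hΩ] with x hx
  refine ENNReal.ofReal_le_ofReal ((?_ : _ ≤ _).trans (le_abs_self _))
  have h3 : (2 * C)⁻¹ * ‖V x‖ ≤ max ‖G x‖ L := by
    rw [inv_mul_le_iff₀ (by positivity)]
    have := hle x hx
    nlinarith [le_max_left ‖G x‖ L, le_max_right ‖G x‖ L]
  have hGq : 0 ≤ ‖G x‖ ^ q x := Real.rpow_nonneg (norm_nonneg _) _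
  have hLk : 0 ≤ L ^ k := Real.rpow_nonneg (by linarith) _
  calc ((2 * C)⁻¹ * ‖V x‖) ^ q x ≤ max ‖G x‖ L ^ q x :=
        Real.rpow_le_rpow (by positivity) h3 (hq x hx).1
    _ ≤ ‖G x‖ ^ q x + L ^ k := by
        rcases le_total ‖G x‖ L with h | h
        · rw [max_eq_right h]
          linarith [Real.rpow_le_rpow_of_exponent_le hL (hq x hx).2]
        · rw [max_eq_left h]; linarith

/-- `v` is a nonnegative test function, positive at `x₀`, that vanishes off the ball of radius `r`
around `x₀`, and `V` is its weak gradient. -/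
structure IsBumpTest {N : ℕ} (Ω : Set (EuclideanSpace ℝ (Fin N)))
    (x₀ : EuclideanSpace ℝ (Fin N)) (r : ℝ) (v : EuclideanSpace ℝ (Fin N) → ℝ)
    (V : EuclideanSpace ℝ (Fin N) → EuclideanSpace ℝ (Fin N)) : Prop where
  continuousOn : ContinuousOn v (closure Ω)
  hasWeakGradient : HasWeakGradient Ω v V
  integrableOn : IntegrableOn V Ω
  nonneg : ∀ x, 0 ≤ v x
  pos : 0 < v x₀
  eq_zero : ∀ x ∈ closure Ω, x ∉ Metric.ball x₀ r → v x = 0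
  grad_eq_zero : ∀ x ∈ Ω, x ∉ Metric.ball x₀ r → V x = 0

set_option maxHeartbeats 1000000 in
/-- If `w = φ - u` is positive at `x₀` and negative away from `x₀`, then testing the equation of `u`
with `(w⁺)²`, whose gradient is `2 w⁺ (∇φ - ∇u)`, and using the monotonicity of `a ↦ |a|^{q-2} a`
shows that `φ` satisfies the inequality of a supersolution against this test function. -/
theorem IsWeakSolution.exists_isBumpTest {N : ℕ} {Ω : Set (EuclideanSpace ℝ (Fin N))}
    (hΩ : IsOpen Ω) (hΩb : Bornology.IsBounded Ω) {q g u : EuclideanSpace ℝ (Fin N) → ℝ} {k : ℝ}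
    (hqm : AEMeasurable q (volume.restrict Ω)) (hq : ∀ x ∈ Ω, 2 ≤ q x ∧ q x ≤ k)
    (hu : IsWeakSolution Ω q g u) {φ : EuclideanSpace ℝ (Fin N) → ℝ} (hφ : ContDiff ℝ 1 φ)
    {x₀ : EuclideanSpace ℝ (Fin N)} {r : ℝ} (hpos : 0 < φ x₀ - u x₀)
    (hneg : ∀ x ∈ closure Ω, x ∉ Metric.ball x₀ r → φ x - u x < 0) :
    ∃ v V, IsBumpTest Ω x₀ r v V ∧
      IntegrableOn (fun x => ‖∇ φ x‖ ^ (q x - 2) * ⟪∇ φ x, V x⟫) Ω ∧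
      ∫ x in frontier Ω, g x * v x ∂μHE[N - 1] ≤
        ∫ x in Ω, ‖∇ φ x‖ ^ (q x - 2) * ⟪∇ φ x, V x⟫ := by
  obtain ⟨huc, G, ⟨hwG, -, hGL⟩, hweak⟩ := hu
  have hΩm := hΩ.measurableSet
  have hcomp : IsCompact (closure Ω) := hΩb.isCompact_closure
  have hq0 : ∀ x ∈ Ω, 0 ≤ q x ∧ q x ≤ k := fun x hx => ⟨by linarith [(hq x hx).1], (hq x hx).2⟩
  set w : EuclideanSpace ℝ (Fin N) → ℝ := fun x => φ x - u x with hw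
  have hwc : ContinuousOn w (closure Ω) := hφ.continuous.continuousOn.sub huc
  have hww : HasWeakGradient Ω w (fun x => ∇ φ x - G x) := (hasWeakGradient_of_contDiff hΩ hφ).sub hwG
  set f : ℝ → ℝ := fun s => (max s 0) ^ 2 with hf
  set f' : ℝ → ℝ := fun s => 2 * max s 0 with hf'
  have hfd : ∀ t, HasDerivAt f (f' t) t := hasDerivAt_max_zero_sq
  have hfc : Continuous f := by fun_prop
  have hf'c : Continuous f' := by fun_prop
  have hf'0 : ∀ t, 0 ≤ f' t := fun t => by positivity
  set v : EuclideanSpace ℝ (Fin N) → ℝ := fun x => f (w x) with hv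
  set V : EuclideanSpace ℝ (Fin N) → EuclideanSpace ℝ (Fin N) :=
    fun x => f' (w x) • (∇ φ x - G x) with hV
  have hvw : HasWeakGradient Ω v V := hww.comp hΩ (hwc.mono subset_closure) hfd hf'c
  have hvc : ContinuousOn v (closure Ω) := hfc.comp_continuousOn hwc
  have hgc : Continuous (∇ φ) := continuous_gradient hφ
  -- uniform bounds
  obtain ⟨C₀, hC₀⟩ := hcomp.exists_bound_of_continuousOn (hf'c.comp_continuousOn hwc)
  obtain ⟨C₁, hC₁⟩ := hcomp.exists_bound_of_continuousOn hvc
  obtain ⟨L₀, hL₀⟩ := hcomp.exists_bound_of_continuousOn hgc.continuousOn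
  set C := max 1 (max C₀ C₁) with hC
  set L := max 1 L₀ with hL
  have hC1 : 1 ≤ C := le_max_left _ _
  have hL1 : 1 ≤ L := le_max_left _ _
  have hf'C : ∀ x ∈ Ω, f' (w x) ≤ C := fun x hx =>
    (le_abs_self _).trans ((hC₀ x (subset_closure hx)).trans
      ((le_max_left _ _).trans (le_max_right _ _)))
  have hvC : ∀ x ∈ Ω, ‖v x‖ ≤ C := fun x hx => (hC₁ x (subset_closure hx)).trans
      ((le_max_right _ _).trans (le_max_right _ _))
  have hφL : ∀ x ∈ Ω, ‖∇ φ x‖ ≤ L := fun x hx => (hL₀ x (subset_closure hx)).trans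
    (le_max_right _ _)
  have hVle : ∀ x ∈ Ω, ‖V x‖ ≤ C * (‖G x‖ + L) := fun x hx => by
    simp only [hV]
    rw [norm_smul, Real.norm_of_nonneg (hf'0 _)]
    refine mul_le_mul (hf'C x hx) ?_ (norm_nonneg _) (by linarith)
    have := norm_sub_le (∇ φ x) (G x)
    linarith [hφL x hx]
  have hGint : IntegrableOn (fun x => ‖G x‖ ^ q x) Ω := hGL.integrableOn_rpow hΩm hqm hq0
  have hGm : AEStronglyMeasurable G (volume.restrict Ω) := hGL.1
  have hwm : AEStronglyMeasurable w (volume.restrict Ω) :=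
    (hwc.mono subset_closure).aestronglyMeasurable hΩm
  have hVm : AEStronglyMeasurable V (volume.restrict Ω) :=
    (hf'c.comp_aestronglyMeasurable hwm).smul (hgc.aestronglyMeasurable.sub hGm)
  have hvm : AEStronglyMeasurable v (volume.restrict Ω) := hfc.comp_aestronglyMeasurable hwm
  have hfin : volume Ω ≠ ⊤ := hΩb.measure_lt_top.ne
  have hsob : MemVarSobolev Ω q v V := by
    refine ⟨hvw, memVarLp_of_norm_le hΩm hΩb hGint hvm hC1 hL1 hq0 fun x hx => ?_,
      memVarLp_of_norm_le hΩm hΩb hGint hVm hC1 hL1 hq0 hVle⟩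
    refine (hvC x hx).trans ?_
    nlinarith [norm_nonneg (G x)]
  -- `t^s ≤ 1 + t^q` for `0 ≤ s ≤ q`
  have hrp : ∀ (t s q : ℝ), 0 ≤ t → 0 ≤ s → s ≤ q → t ^ s ≤ 1 + t ^ q := by
    intro t s q ht hs hsq
    rcases le_total t 1 with h | h
    · linarith [Real.rpow_le_one ht h hs, Real.rpow_nonneg ht q]
    · linarith [Real.rpow_le_rpow_of_exponent_le h hsq]
  have hGV : ∀ x ∈ Ω, ‖G x‖ ≤ 1 + ‖G x‖ ^ q x := fun x hx => by
    have := hrp ‖G x‖ 1 (q x) (norm_nonneg _) zero_le_one (by linarith [(hq x hx).1])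
    rwa [Real.rpow_one] at this
  have hconst : ∀ c : ℝ, IntegrableOn (fun _ : EuclideanSpace ℝ (Fin N) => c) Ω := fun c =>
    integrableOn_const hfin
  have hVint : IntegrableOn V Ω := by
    refine Integrable.mono' (((hconst 1).add hGint).add (hconst L) |>.const_mul C) hVm ?_
    filter_upwards [ae_restrict_mem hΩm] with x hx
    refine (hVle x hx).trans (mul_le_mul_of_nonneg_left ?_ (by linarith))
    have := hGV x hx
    simp only [Pi.add_apply]; linarith
  have hI1 : IntegrableOn (fun x => ‖∇ φ x‖ ^ (q x - 2) * ⟪∇ φ x, V x⟫) Ω := by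
    refine Integrable.mono' (hVint.norm.const_mul (L ^ k * L)) ?_ ?_
    · exact ((hgc.norm.aemeasurable).pow (hqm.sub_const 2)).aestronglyMeasurable.mul
        (hgc.aestronglyMeasurable.inner hVm)
    · filter_upwards [ae_restrict_mem hΩm] with x hx
      rw [norm_mul, Real.norm_of_nonneg (Real.rpow_nonneg (norm_nonneg _) _), mul_assoc]
      refine mul_le_mul ?_ ((norm_inner_le_norm _ _).trans
        (mul_le_mul_of_nonneg_right (hφL x hx) (norm_nonneg _))) (norm_nonneg _)
        (Real.rpow_nonneg (by linarith) _)
      have hq2 := hq x hx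
      exact (Real.rpow_le_rpow (norm_nonneg _) (hφL x hx) (by linarith)).trans
        (Real.rpow_le_rpow_of_exponent_le hL1 (by linarith))
  have hI2 : IntegrableOn (fun x => ‖G x‖ ^ (q x - 2) * ⟪G x, V x⟫) Ω := by
    refine Integrable.mono'
      ((hGint.add (((hconst 1).add hGint).const_mul L)).const_mul C) ?_ ?_
    · exact ((hGm.norm.aemeasurable).pow (hqm.sub_const 2)).aestronglyMeasurable.mul
        (hGm.inner hVm)
    · filter_upwards [ae_restrict_mem hΩm] with x hx
      have hq2 := hq x hx
      have hG0 := norm_nonneg (G x)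
      have hA := Real.rpow_nonneg hG0 (q x - 2)
      rw [norm_mul, Real.norm_of_nonneg hA]
      have e1 : ‖G x‖ ^ (q x - 2) * ‖G x‖ = ‖G x‖ ^ (q x - 1) := by
        rw [← Real.rpow_add_one' hG0 (by linarith)]; ring_nf
      have e2 : ‖G x‖ ^ (q x - 1) * ‖G x‖ = ‖G x‖ ^ (q x) := by
        rw [← Real.rpow_add_one' hG0 (by linarith)]; ring_nf
      have h1 := hrp ‖G x‖ (q x - 1) (q x) hG0 (by linarith) (by linarith)
      calc ‖G x‖ ^ (q x - 2) * ‖⟪G x, V x⟫‖ ≤ ‖G x‖ ^ (q x - 2) * (‖G x‖ * (C * (‖G x‖ + L))) :=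
            mul_le_mul_of_nonneg_left ((norm_inner_le_norm _ _).trans
              (mul_le_mul_of_nonneg_left (hVle x hx) hG0)) hA
        _ = C * (‖G x‖ ^ (q x) + L * ‖G x‖ ^ (q x - 1)) := by rw [← e2, ← e1]; ring
        _ ≤ _ := by
            simp only [Pi.add_apply]
            gcongr
  refine ⟨v, V, ⟨hvc, hvw, hVint, fun x => by positivity, ?_, fun x hx hxr => ?_,
    fun x hx hxr => ?_⟩, hI1, ?_⟩
  · simp only [hv, hf, hw]
    rw [max_eq_left hpos.le]; positivity
  · simp [hv, hf, max_eq_right (hneg x hx hxr).le, hw]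
  · simp [hV, hf', max_eq_right (hneg x (subset_closure hx) hxr).le, hw]
  · rw [← hweak v V hvc hsob]
    refine integral_mono_ae hI2 hI1 ?_
    refine Eventually.filter_mono (ae_mono le_rfl) ?_
    filter_upwards [ae_restrict_mem hΩm] with x hx
    have hm := inner_rpow_smul_sub_nonneg (hq x hx).1 (∇ φ x) (G x)
    have h2 : ⟪‖∇ φ x‖ ^ (q x - 2) • ∇ φ x - ‖G x‖ ^ (q x - 2) • G x, V x⟫ =
        f' (w x) * ⟪‖∇ φ x‖ ^ (q x - 2) • ∇ φ x - ‖G x‖ ^ (q x - 2) • G x, ∇ φ x - G x⟫ := by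
      simp only [hV]; exact real_inner_smul_right _ _ _
    have h3 := mul_nonneg (hf'0 (w x)) hm
    rw [← h2, inner_sub_left, real_inner_smul_left, real_inner_smul_left] at h3
    linarith

/-! ### The vector fields `|∇φ|^{q-2} ∇φ` and their divergence -/

theorem contDiff_gradient {N : ℕ} {φ : EuclideanSpace ℝ (Fin N) → ℝ} (hφ : ContDiff ℝ 2 φ) :
    ContDiff ℝ 1 (∇ φ) := by
  have h : ContDiff ℝ 1 (fderiv ℝ φ) := hφ.fderiv_right (by norm_num)
  exact ((InnerProductSpace.toDual ℝ (EuclideanSpace ℝ (Fin N))).symm.contDiff).comp h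

theorem infLaplacian_eq_inner {N : ℕ} {φ : EuclideanSpace ℝ (Fin N) → ℝ} (hφ : ContDiff ℝ 2 φ)
    (x : EuclideanSpace ℝ (Fin N)) :
    infLaplacian φ x = ⟪∇ φ x, fderiv ℝ (∇ φ) x (∇ φ x)⟫ := by
  have h : ContDiff ℝ 1 (fderiv ℝ φ) := hφ.fderiv_right (by norm_num)
  have hd : DifferentiableAt ℝ (fderiv ℝ φ) x := h.differentiable one_ne_zero x
  have h1 : HasFDerivAt (∇ φ) _ x :=
    ((InnerProductSpace.toDual ℝ (EuclideanSpace ℝ (Fin N))).symm.toContinuousLinearEquiv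
      |>.hasFDerivAt (x := fderiv ℝ φ x)).comp x hd.hasFDerivAt
  rw [infLaplacian, iteratedFDeriv_two_apply, h1.fderiv, real_inner_comm]
  exact (InnerProductSpace.toDual_symm_apply (x := ∇ φ x)
    (y := fderiv ℝ (fderiv ℝ φ) x (∇ φ x))).symm

theorem continuous_infLaplacian {N : ℕ} {φ : EuclideanSpace ℝ (Fin N) → ℝ} (hφ : ContDiff ℝ 2 φ) :
    Continuous (infLaplacian φ) := by
  have h := contDiff_gradient hφ
  rw [show infLaplacian φ = _ from funext fun x => infLaplacian_eq_inner hφ x]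
  exact h.continuous.inner ((h.continuous_fderiv one_ne_zero).clm_apply h.continuous)

/-- For a constant exponent, `div (|∇φ|^κ ∇φ) = |∇φ|^κ Δφ + κ |∇φ|^{κ-2} Δ_∞ φ`. -/
theorem divergence_norm_rpow_smul_gradient {N : ℕ} {φ : EuclideanSpace ℝ (Fin N) → ℝ}
    (hφ : ContDiff ℝ 2 φ) (κ : ℝ) {x : EuclideanSpace ℝ (Fin N)} (hx : ∇ φ x ≠ 0) :
    divergence (fun y => ‖∇ φ y‖ ^ κ • ∇ φ y) x =
      ‖∇ φ x‖ ^ κ * divergence (∇ φ) x + κ * ‖∇ φ x‖ ^ (κ - 2) * infLaplacian φ x := by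
  have hd := (contDiff_gradient hφ).differentiable one_ne_zero x
  have hn : 0 < ‖∇ φ x‖ := norm_pos_iff.2 hx
  have heq : (fun y => ‖∇ φ y‖ ^ κ) = fun y => (‖∇ φ y‖ ^ 2) ^ (κ / 2) := by
    ext y
    rw [← Real.rpow_natCast, ← Real.rpow_mul (norm_nonneg _)]
    congr 1; push_cast; ring
  have hη := (hd.hasFDerivAt.norm_sq).rpow_const (p := κ / 2) (Or.inl (by positivity))
  rw [← heq] at hη
  rw [divergence_smul hη.differentiableAt hd, hη.fderiv, infLaplacian_eq_inner hφ]
  congr 1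
  have : (‖∇ φ x‖ ^ 2) ^ (κ / 2 - 1) = ‖∇ φ x‖ ^ (κ - 2) := by
    rw [← Real.rpow_natCast, ← Real.rpow_mul (norm_nonneg _)]
    congr 1; push_cast; ring
  rw [this]
  simp
  ring

theorem contDiffOn_norm_rpow_smul_gradient {N : ℕ} {φ : EuclideanSpace ℝ (Fin N) → ℝ}
    (hφ : ContDiff ℝ 2 φ) {s : Set (EuclideanSpace ℝ (Fin N))}
    {q : EuclideanSpace ℝ (Fin N) → ℝ} (hq : ContDiffOn ℝ 1 q s) (h0 : ∀ x ∈ s, ∇ φ x ≠ 0) :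
    ContDiffOn ℝ 1 (fun y => ‖∇ φ y‖ ^ (q y - 2) • ∇ φ y) s := by
  have h := contDiff_gradient hφ
  intro x hx
  have hn : ContDiffWithinAt ℝ 1 (fun y => ‖∇ φ y‖) s x := h.contDiffWithinAt.norm ℝ (h0 x hx)
  exact (hn.rpow ((hq x hx).sub contDiffWithinAt_const) (norm_ne_zero_iff.2 (h0 x hx))).smul
    h.contDiffWithinAt

/-- If `Δ_∞ φ (x₀) > 0`, then `Δ_k φ > 0` near `x₀` for all large `k`. -/
theorem exists_le_divergence_of_infLaplacian_pos {N : ℕ} {φ : EuclideanSpace ℝ (Fin N) → ℝ}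
    (hφ : ContDiff ℝ 2 φ) {x₀ : EuclideanSpace ℝ (Fin N)} (hpos : 0 < infLaplacian φ x₀) :
    ∃ r > 0, (∀ y ∈ Metric.ball x₀ r, ∇ φ y ≠ 0) ∧ ∃ k₀ : ℕ, ∀ k : ℕ, k₀ ≤ k → ∃ c > 0,
      ∀ y ∈ Metric.ball x₀ r, c ≤ divergence (fun y => ‖∇ φ y‖ ^ ((k : ℝ) - 2) • ∇ φ y) y := by
  have hX0 : ∇ φ x₀ ≠ 0 := by
    intro h
    rw [infLaplacian_eq_inner hφ, h, inner_zero_left] at hpos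
    exact lt_irrefl _ hpos
  have h := contDiff_gradient hφ
  set I := infLaplacian φ x₀ with hI
  set m := ‖∇ φ x₀‖ / 2 with hm
  have hm0 : 0 < m := by have := norm_pos_iff.2 hX0; positivity
  have hdc : Continuous (divergence (∇ φ)) := continuous_trace.comp (h.continuous_fderiv one_ne_zero)
  set T : EuclideanSpace ℝ (Fin N) → ℝ := fun y => ‖∇ φ y‖ ^ 2 * divergence (∇ φ) y with hT
  have hTc : Continuous T := (h.continuous.norm.pow 2).mul hdc
  have e1 : ∀ᶠ y in 𝓝 x₀, I / 2 < infLaplacian φ y :=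
    (continuous_infLaplacian hφ).continuousAt.eventually (lt_mem_nhds (by linarith))
  have e2 : ∀ᶠ y in 𝓝 x₀, m < ‖∇ φ y‖ :=
    h.continuous.norm.continuousAt.eventually (lt_mem_nhds (by
      have := norm_pos_iff.2 hX0; rw [hm]; linarith))
  have e3 : ∀ᶠ y in 𝓝 x₀, T x₀ - 1 < T y :=
    hTc.continuousAt.eventually (lt_mem_nhds (by linarith))
  obtain ⟨r, hr, hball⟩ := Metric.eventually_nhds_iff_ball.1 (e1.and (e2.and e3))
  have hX : ∀ y ∈ Metric.ball x₀ r, ∇ φ y ≠ 0 := fun y hy h0 => by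
    have := (hball y hy).2.1
    rw [h0, norm_zero] at this
    linarith
  obtain ⟨k₁, hk₁⟩ := exists_nat_ge ((2 - T x₀) * (2 / I))
  refine ⟨r, hr, hX, k₁ + 4, fun k hk => ⟨m ^ ((k : ℝ) - 4), Real.rpow_pos_of_pos hm0 _,
    fun y hy => ?_⟩⟩
  rw [divergence_norm_rpow_smul_gradient hφ _ (hX y hy)]
  obtain ⟨h1, h2, h3⟩ := hball y hy
  have hk' : (k₁ : ℝ) + 4 ≤ k := by exact_mod_cast hk
  have hn : 0 < ‖∇ φ y‖ := norm_pos_iff.2 (hX y hy)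
  have e : ‖∇ φ y‖ ^ ((k : ℝ) - 2) = ‖∇ φ y‖ ^ ((k : ℝ) - 4) * ‖∇ φ y‖ ^ 2 := by
    rw [← Real.rpow_natCast, ← Real.rpow_add hn]; congr 1; push_cast; ring
  have e' : ‖∇ φ y‖ ^ ((k : ℝ) - 2 - 2) = ‖∇ φ y‖ ^ ((k : ℝ) - 4) := by congr 1; ring
  rw [e, e']
  have hp : m ^ ((k : ℝ) - 4) ≤ ‖∇ φ y‖ ^ ((k : ℝ) - 4) :=
    Real.rpow_le_rpow hm0.le h2.le (by linarith [Nat.cast_nonneg (α := ℝ) k₁])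
  have hk2 : 2 - T x₀ ≤ ((k : ℝ) - 2) * (I / 2) := by
    have : 2 - T x₀ ≤ k₁ * (I / 2) := by
      calc 2 - T x₀ = (2 - T x₀) * (2 / I) * (I / 2) := by field_simp
        _ ≤ _ := mul_le_mul_of_nonneg_right hk₁ (by linarith)
    nlinarith
  have hk3 : ((k : ℝ) - 2) * (I / 2) ≤ ((k : ℝ) - 2) * infLaplacian φ y :=
    mul_le_mul_of_nonneg_left h1.le (by linarith [Nat.cast_nonneg (α := ℝ) k₁])
  have hone : 1 ≤ T y + ((k : ℝ) - 2) * infLaplacian φ y := by linarith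
  have hp0 : 0 ≤ ‖∇ φ y‖ ^ ((k : ℝ) - 4) := Real.rpow_nonneg hn.le _
  calc m ^ ((k : ℝ) - 4) ≤ ‖∇ φ y‖ ^ ((k : ℝ) - 4) * 1 := by rw [mul_one]; exact hp
    _ ≤ ‖∇ φ y‖ ^ ((k : ℝ) - 4) * (T y + ((k : ℝ) - 2) * infLaplacian φ y) :=
        mul_le_mul_of_nonneg_left hone hp0
    _ = _ := by simp only [hT]; ring

/-- At a critical point of `φ` the field `|∇φ|^{q-2} ∇φ` has vanishing derivative, since `q > 2`. -/
theorem hasFDerivWithinAt_zero_of_gradient_eq_zero {N : ℕ} {φ : EuclideanSpace ℝ (Fin N) → ℝ}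
    (hφ : ContDiff ℝ 2 φ) {s : Set (EuclideanSpace ℝ (Fin N))}
    {q : EuclideanSpace ℝ (Fin N) → ℝ} {x₀ : EuclideanSpace ℝ (Fin N)}
    (hq : ContinuousWithinAt q s x₀) (hq2 : 2 < q x₀) (h0 : ∇ φ x₀ = 0) :
    HasFDerivWithinAt (fun y => ‖∇ φ y‖ ^ (q y - 2) • ∇ φ y)
      (0 : EuclideanSpace ℝ (Fin N) →L[ℝ] EuclideanSpace ℝ (Fin N)) s x₀ := by
  have h := contDiff_gradient hφ
  rw [hasFDerivWithinAt_iff_isLittleO]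
  have hO : (fun y => ∇ φ y) =O[𝓝[s] x₀] fun y => y - x₀ := by
    have := (h.differentiable one_ne_zero x₀).isBigO_sub
    simp only [h0, sub_zero] at this
    exact this.mono nhdsWithin_le_nhds
  have ho : (fun y => ‖∇ φ y‖ ^ (q y - 2)) =o[𝓝[s] x₀] fun _ => (1 : ℝ) := by
    rw [Asymptotics.isLittleO_one_iff]
    have h1 : Tendsto (fun y => (‖∇ φ y‖, q y - 2)) (𝓝[s] x₀) (𝓝 (0, q x₀ - 2)) := by
      refine Tendsto.prodMk_nhds ?_ (hq.sub_const 2)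
      have := (h.continuous.norm.tendsto x₀).mono_left (nhdsWithin_le_nhds (s := s))
      rwa [h0, norm_zero] at this
    have h2 := (Real.continuousAt_rpow_of_pos (0, q x₀ - 2) (by simpa using hq2)).tendsto.comp h1
    simp only [Function.comp_def] at h2
    rwa [Real.zero_rpow (by linarith)] at h2
  have := ho.smul_isBigO hO
  simp only [one_smul] at this
  refine this.congr' (Eventually.of_forall fun y => ?_) EventuallyEq.rfl
  simp [h0]

/-- If `Δ_{q(x)} φ (x₀) > 0`, with derivatives taken within `s`, then near `x₀` the divergence of
`|∇φ|^{q-2} ∇φ` is bounded, and bounded below by a positive constant, in the interior of `s`. -/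
theorem exists_divergence_bounds_of_varLaplacianWithin_pos {N : ℕ}
    {φ : EuclideanSpace ℝ (Fin N) → ℝ} (hφ : ContDiff ℝ 2 φ)
    {s : Set (EuclideanSpace ℝ (Fin N))} {q : EuclideanSpace ℝ (Fin N) → ℝ}
    {x₀ : EuclideanSpace ℝ (Fin N)} (hx₀ : x₀ ∈ s) (hs : UniqueDiffWithinAt ℝ s x₀)
    (hq : ContDiffOn ℝ 1 q s) (hq2 : 2 < q x₀) (hpos : 0 < varLaplacianWithin s q φ x₀) :
    ∃ r > 0, ∃ c > 0, ∃ C, (∀ y ∈ Metric.ball x₀ r, ∇ φ y ≠ 0) ∧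
      ∀ U, IsOpen U → U ⊆ s → U ⊆ Metric.ball x₀ r →
        ContDiffOn ℝ 1 (fun y => ‖∇ φ y‖ ^ (q y - 2) • ∇ φ y) U ∧
        ∀ y ∈ U, c ≤ divergence (fun y => ‖∇ φ y‖ ^ (q y - 2) • ∇ φ y) y ∧
          divergence (fun y => ‖∇ φ y‖ ^ (q y - 2) • ∇ φ y) y ≤ C := by
  set F : EuclideanSpace ℝ (Fin N) → EuclideanSpace ℝ (Fin N) :=
    fun y => ‖∇ φ y‖ ^ (q y - 2) • ∇ φ y with hF
  have h := contDiff_gradient hφ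
  have hX0 : ∇ φ x₀ ≠ 0 := by
    intro h0
    have := (hasFDerivWithinAt_zero_of_gradient_eq_zero hφ (hq x₀ hx₀).continuousWithinAt hq2
      h0).fderivWithin hs
    rw [varLaplacianWithin, this] at hpos
    simp at hpos
  have hFx : ContDiffWithinAt ℝ 1 F s x₀ := by
    have hn : ContDiffWithinAt ℝ 1 (fun y => ‖∇ φ y‖) s x₀ := h.contDiffWithinAt.norm ℝ hX0
    exact (hn.rpow ((hq x₀ hx₀).sub contDiffWithinAt_const) (norm_ne_zero_iff.2 hX0)).smul
      h.contDiffWithinAt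
  obtain ⟨u, hu, -, F', hF', hF'c⟩ := (contDiffWithinAt_succ_iff_hasFDerivWithinAt (n := 0)
    (by simp)).1 (by simpa using hFx)
  rw [insert_eq_of_mem hx₀] at hu
  have hxu : x₀ ∈ u := mem_of_mem_nhdsWithin hx₀ hu
  obtain ⟨ε, hε, hεu⟩ := Metric.mem_nhdsWithin_iff.1 hu
  have hval : F' x₀ = fderivWithin ℝ F s x₀ := by
    have h1 : HasFDerivWithinAt F (F' x₀) (s ∩ Metric.ball x₀ ε) x₀ :=
      (hF' x₀ hxu).mono (by rw [inter_comm]; exact hεu)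
    exact ((hasFDerivWithinAt_inter (Metric.ball_mem_nhds x₀ hε)).1 h1).fderivWithin hs |>.symm
  set τ : EuclideanSpace ℝ (Fin N) → ℝ := fun y =>
    LinearMap.trace ℝ (EuclideanSpace ℝ (Fin N)) (F' y).toLinearMap with hτ
  have hτ0 : 0 < τ x₀ := by simp only [hτ, hval]; exact hpos
  have hτc : ContinuousWithinAt τ u x₀ :=
    continuous_trace.continuousAt.comp_continuousWithinAt hF'c.continuousWithinAt
  have e1 : ∀ᶠ y in 𝓝[u] x₀, τ x₀ / 2 < τ y ∧ τ y < τ x₀ + 1 :=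
    hτc.eventually ((lt_mem_nhds (by linarith)).and (gt_mem_nhds (by linarith)))
  have e2 : ∀ᶠ y in 𝓝 x₀, ∇ φ y ≠ 0 := h.continuous.continuousAt.eventually_ne hX0
  obtain ⟨δ, hδ, hδu⟩ := Metric.mem_nhdsWithin_iff.1 e1
  obtain ⟨δ', hδ', hδX⟩ := Metric.eventually_nhds_iff_ball.1 e2
  set r := min ε (min δ δ') with hr
  have hrε : r ≤ ε := min_le_left _ _
  have hrδ : r ≤ δ := (min_le_right _ _).trans (min_le_left _ _)
  have hrδ' : r ≤ δ' := (min_le_right _ _).trans (min_le_right _ _)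
  have hX : ∀ y ∈ Metric.ball x₀ r, ∇ φ y ≠ 0 := fun y hy =>
    hδX y (Metric.ball_subset_ball hrδ' hy)
  refine ⟨r, lt_min hε (lt_min hδ hδ'), τ x₀ / 2, by linarith, τ x₀ + 1, hX,
    fun U hU hUs hUr => ⟨?_, fun y hy => ?_⟩⟩
  · exact contDiffOn_norm_rpow_smul_gradient hφ (hq.mono hUs) fun y hy => hX y (hUr hy)
  · have hyu : U ⊆ u := fun z hz => hεu ⟨Metric.ball_subset_ball hrε (hUr hz), hUs hz⟩
    have hd : HasFDerivAt F (F' y) y :=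
      (hF' y (hyu hy)).hasFDerivAt (mem_of_superset (hU.mem_nhds hy) hyu)
    have hb := hδu ⟨Metric.ball_subset_ball hrδ (hUr hy), hyu hy⟩
    have : divergence F y = τ y := by rw [divergence, hd.fderiv]
    rw [this]
    exact ⟨hb.1.le, hb.2.le⟩

/-! ### Local defining functions and normals -/

/-- `ρ` is a local defining function of `D` at the boundary point `x`: near `x` the set `D` is
`{ρ > 0}`, and `ρ` decreases with unit speed in the unit direction `e`. If `D` is locally the strict
subgraph of `γ`, one takes for `ρ(y)` the height `γ(y - ⟪e, y⟫ e) - ⟪e, y⟫` of the graph over `y`. -/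
structure IsDefiningFunction {N : ℕ} (D : Set (EuclideanSpace ℝ (Fin N)))
    (x e : EuclideanSpace ℝ (Fin N)) (ρ : EuclideanSpace ℝ (Fin N) → ℝ) : Prop where
  norm_eq : ‖e‖ = 1
  continuous : Continuous ρ
  add_smul : ∀ y t, ρ (y + t • e) = ρ y - t
  mem_iff : ∀ᶠ y in 𝓝 x, (y ∈ D ↔ 0 < ρ y)

theorem projection_add_smul {N : ℕ} {e : EuclideanSpace ℝ (Fin N)} (he : ‖e‖ = 1)
    (y : EuclideanSpace ℝ (Fin N)) (t : ℝ) :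
    y + t • e - ⟪e, y + t • e⟫ • e = y - ⟪e, y⟫ • e := by
  rw [inner_add_right, inner_smul_right, real_inner_self_eq_norm_sq, he]
  simp only [one_pow, mul_one, _root_.add_smul]
  abel

theorem isDefiningFunction_graph {N : ℕ} {D : Set (EuclideanSpace ℝ (Fin N))}
    {x e : EuclideanSpace ℝ (Fin N)} {γ : EuclideanSpace ℝ (Fin N) → ℝ} (he : ‖e‖ = 1)
    (hγ : Continuous γ) (h : ∀ᶠ y in 𝓝 x, (y ∈ D ↔ ⟪e, y⟫ < γ (y - ⟪e, y⟫ • e))) :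
    IsDefiningFunction D x e (fun y => γ (y - ⟪e, y⟫ • e) - ⟪e, y⟫) where
  norm_eq := he
  continuous := by fun_prop
  add_smul y t := by
    simp only [projection_add_smul he]
    rw [inner_add_right, inner_smul_right, real_inner_self_eq_norm_sq, he]
    ring
  mem_iff := by simpa only [sub_pos] using h

theorem HasLipschitzBoundary.exists_isDefiningFunction {N : ℕ}
    {D : Set (EuclideanSpace ℝ (Fin N))} (hD : HasLipschitzBoundary D)
    {x : EuclideanSpace ℝ (Fin N)} (hx : x ∈ frontier D) :
    ∃ e ρ, IsDefiningFunction D x e ρ ∧ ∃ K, LipschitzWith K ρ := by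
  obtain ⟨e, he, γ, ⟨K, hK⟩, hγ⟩ := hD x hx
  refine ⟨e, _, isDefiningFunction_graph he hK.continuous hγ, ?_⟩
  have h1 : LipschitzWith ‖innerSL ℝ e‖₊ (fun y => ⟪e, y⟫) := (innerSL ℝ e).lipschitz
  let A : EuclideanSpace ℝ (Fin N) →L[ℝ] EuclideanSpace ℝ (Fin N) :=
    ContinuousLinearMap.id ℝ _ - (innerSL ℝ e).smulRight e
  exact ⟨_, (hK.comp A.lipschitz).sub h1⟩

theorem HasSmoothBoundary.exists_isDefiningFunction {N : ℕ}
    {D : Set (EuclideanSpace ℝ (Fin N))} (hD : HasSmoothBoundary D)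
    {x : EuclideanSpace ℝ (Fin N)} (hx : x ∈ frontier D) :
    ∃ e ρ, IsDefiningFunction D x e ρ ∧ ContDiff ℝ ∞ ρ := by
  obtain ⟨e, he, γ, hγs, hγ⟩ := hD x hx
  refine ⟨e, _, isDefiningFunction_graph he hγs.continuous hγ, ?_⟩
  have h1 : ContDiff ℝ ∞ (fun y => ⟪e, y⟫) := (innerSL ℝ e).contDiff
  exact (hγs.comp (contDiff_id.sub (h1.smul contDiff_const))).sub h1

namespace IsDefiningFunction

variable {N : ℕ} {D : Set (EuclideanSpace ℝ (Fin N))} {x e : EuclideanSpace ℝ (Fin N)}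
  {ρ : EuclideanSpace ℝ (Fin N) → ℝ}

theorem eventually_notMem_closure (h : IsDefiningFunction D x e ρ) :
    ∀ᶠ y in 𝓝 x, ρ y < 0 → y ∉ closure D := by
  filter_upwards [eventually_eventually_nhds.2 h.mem_iff] with y hy hneg hcl
  have h1 : ∀ᶠ z in 𝓝 y, ρ z < 0 := h.continuous.continuousAt.eventually (gt_mem_nhds hneg)
  obtain ⟨z, hzD, hz, hz'⟩ := ((mem_closure_iff_frequently.1 hcl).and_eventually (hy.and h1)).exists
  exact absurd (hz.1 hzD) (by linarith)

theorem eventually_mem_frontier (h : IsDefiningFunction D x e ρ) :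
    ∀ᶠ y in 𝓝 x, ρ y = 0 → y ∈ frontier D := by
  filter_upwards [eventually_eventually_nhds.2 h.mem_iff] with y hy h0
  have hyD : y ∉ D := fun hm => by have := hy.self_of_nhds.1 hm; linarith
  refine ⟨?_, fun hi => hyD (interior_subset hi)⟩
  rw [mem_closure_iff_frequently]
  have hlim : Tendsto (fun t : ℝ => y + (-t) • e) (𝓝[>] 0) (𝓝 y) := by
    have : Tendsto (fun t : ℝ => y + (-t) • e) (𝓝 0) (𝓝 (y + (-(0 : ℝ)) • e)) :=
      Continuous.tendsto (by fun_prop) 0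
    simpa using this.mono_left nhdsWithin_le_nhds
  refine hlim.frequently (Eventually.frequently ?_)
  filter_upwards [hlim.eventually hy, self_mem_nhdsWithin] with t ht ht0
  rw [ht, h.add_smul, h0]
  have : (0 : ℝ) < t := ht0
  linarith

theorem eventually_mem_closure (h : IsDefiningFunction D x e ρ) :
    ∀ᶠ y in 𝓝 x, 0 ≤ ρ y → y ∈ closure D := by
  filter_upwards [h.eventually_mem_frontier, h.mem_iff] with y h1 h2 h0
  rcases h0.eq_or_lt with h0 | h0
  · exact frontier_subset_closure (h1 h0.symm)
  · exact subset_closure (h2.2 h0)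

theorem apply_eq_zero (h : IsDefiningFunction D x e ρ) (hx : x ∈ frontier D) : ρ x = 0 := by
  refine le_antisymm (not_lt.1 fun hpos => ?_) (not_lt.1 fun hneg => ?_)
  · refine hx.2 (mem_interior_iff_mem_nhds.2 ?_)
    filter_upwards [h.mem_iff, h.continuous.continuousAt.eventually (lt_mem_nhds hpos)] with y h1 h2
    exact h1.2 h2
  · exact h.eventually_notMem_closure.self_of_nhds hneg hx.1

theorem fderiv_apply_self (h : IsDefiningFunction D x e ρ) {y : EuclideanSpace ℝ (Fin N)}
    (hd : DifferentiableAt ℝ ρ y) : fderiv ℝ ρ y e = -1 := by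
  have h1 : HasDerivAt (fun t : ℝ => ρ (y + t • e)) (fderiv ℝ ρ y e) 0 :=
    (hd.hasFDerivAt.hasLineDerivAt e)
  have h2 : HasDerivAt (fun t : ℝ => ρ (y + t • e)) (-1) 0 := by
    simp only [h.add_smul]
    simpa using (hasDerivAt_id (0 : ℝ)).const_sub (ρ y)
  exact h1.unique h2

theorem measure_eq_zero (h : IsDefiningFunction D x e ρ) : volume {y | ρ y = 0} = 0 := by
  refine Measure.addHaar_eq_zero_of_disjoint_translates volume
    (fun n : ℕ => (1 / ((n : ℝ) + 1)) • e) ?_ ?_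
    (isClosed_eq h.continuous continuous_const).measurableSet
  · refine isBounded_iff_forall_norm_le.2 ⟨1, ?_⟩
    rintro _ ⟨n, rfl⟩
    simp only [norm_smul, h.norm_eq, mul_one, Real.norm_eq_abs]
    rw [abs_of_pos (by positivity), div_le_one (by positivity)]
    linarith [Nat.cast_nonneg (α := ℝ) n]
  · intro n m hnm
    refine Set.disjoint_left.2 ?_
    rintro y hy hy'
    simp only [singleton_add, mem_image, mem_ofPred_eq] at hy hy'
    obtain ⟨z, hz, rfl⟩ := hy
    obtain ⟨z', hz', he⟩ := hy'
    have h1 := h.add_smul z (1 / ((n : ℝ) + 1))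
    have h2 := h.add_smul z' (1 / ((m : ℝ) + 1))
    rw [add_comm z] at h1
    rw [add_comm z', he, h1, hz, hz'] at h2
    apply hnm
    have h3 : 1 / ((n : ℝ) + 1) = 1 / ((m : ℝ) + 1) := by linarith
    rw [one_div, one_div, inv_inj] at h3
    exact_mod_cast add_right_cancel h3

/-- Where a defining function is differentiable, the outward normal is minus its normalized
gradient. -/
theorem isOutwardUnitNormal (h : IsDefiningFunction D x e ρ) {y : EuclideanSpace ℝ (Fin N)}
    (hy : ∀ᶠ z in 𝓝 y, (z ∈ D ↔ 0 < ρ z)) (h0 : ρ y = 0) (hd : DifferentiableAt ℝ ρ y) :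
    0 < ‖∇ ρ y‖ ∧ IsOutwardUnitNormal D y (-(‖∇ ρ y‖⁻¹ • ∇ ρ y)) := by
  have hb : ∇ ρ y ≠ 0 := by
    intro hb
    have := h.fderiv_apply_self hd
    rw [← inner_gradient, hb, inner_zero_left] at this
    norm_num at this
  have hn : 0 < ‖∇ ρ y‖ := norm_pos_iff.2 hb
  refine ⟨hn, ?_, fun ε hε => ?_⟩
  · rw [norm_neg, norm_smul, norm_inv, norm_norm, inv_mul_cancel₀ hn.ne']
  have hy' : IsDefiningFunction D y e ρ := ⟨h.norm_eq, h.continuous, h.add_smul, hy⟩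
  have hlo := hd.hasFDerivAt.isLittleO.def (c := ε * ‖∇ ρ y‖) (by positivity)
  filter_upwards [hlo, hy, hy'.eventually_notMem_closure] with z hz hzD hzc
  have hin : fderiv ℝ ρ y (z - y) = -‖∇ ρ y‖ * ⟪z - y, -(‖∇ ρ y‖⁻¹ • ∇ ρ y)⟫ := by
    rw [← inner_gradient, inner_neg_right, inner_smul_right, real_inner_comm]
    field_simp
  rw [hin, h0, sub_zero, Real.norm_eq_abs] at hz
  have hz := abs_le.1 hz
  constructor
  · intro hlt
    rw [hzD]
    nlinarith [mul_lt_mul_of_pos_left hlt hn]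
  · intro hlt
    refine hzc ?_
    nlinarith [mul_lt_mul_of_pos_left hlt hn]

/-- A set that contains near `x` the points where a defining function, Lipschitz at `x`, has a given
strict sign contains an open convex cone with vertex `x`, so derivatives within it are unique. -/
theorem uniqueDiffWithinAt (h : IsDefiningFunction D x e ρ) {K : ℝ}
    (hK : ∀ᶠ y in 𝓝 x, |ρ y| ≤ K * ‖y - x‖) {s : Set (EuclideanSpace ℝ (Fin N))} {σ : ℝ}
    (hσ : σ = 1 ∨ σ = -1) (hs : ∀ᶠ y in 𝓝 x, 0 < σ * ρ y → y ∈ s) : UniqueDiffWithinAt ℝ s x := by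
  have hK0 : 0 ≤ |K| := abs_nonneg K
  set w : EuclideanSpace ℝ (Fin N) → EuclideanSpace ℝ (Fin N) := fun y => y - x - ⟪e, y - x⟫ • e
  set C : Set (EuclideanSpace ℝ (Fin N)) := {y | |K| * ‖w y‖ + σ * ⟪e, y - x⟫ < 0} with hC
  have hwc : Continuous w := by fun_prop
  have hCo : IsOpen C := isOpen_lt (by fun_prop) continuous_const
  have hlin : ∀ (a b : ℝ) (y z : EuclideanSpace ℝ (Fin N)), a + b = 1 →
      a • y + b • z - x = a • (y - x) + b • (z - x) := by
    intro a b y z hab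
    have : x = a • x + b • x := by rw [← _root_.add_smul, hab, one_smul]
    nth_rewrite 1 [this]
    simp only [smul_sub]; abel
  have hCc : Convex ℝ C := by
    intro y hy z hz a b ha hb hab
    simp only [hC, mem_ofPred_eq] at hy hz ⊢
    have e1 : w (a • y + b • z) = a • w y + b • w z := by
      simp only [w]
      rw [hlin a b y z hab, inner_add_right, inner_smul_right, inner_smul_right]
      module
    have e2 : ⟪e, a • y + b • z - x⟫ = a * ⟪e, y - x⟫ + b * ⟪e, z - x⟫ := by
      rw [hlin a b y z hab, inner_add_right, inner_smul_right, inner_smul_right]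
    have e3 : ‖w (a • y + b • z)‖ ≤ a * ‖w y‖ + b * ‖w z‖ := by
      rw [e1]
      refine (norm_add_le _ _).trans ?_
      rw [norm_smul, norm_smul, Real.norm_of_nonneg ha, Real.norm_of_nonneg hb]
    rw [e2]
    have := mul_le_mul_of_nonneg_left e3 hK0
    rcases ha.eq_or_lt with rfl | ha'
    · have : b = 1 := by linarith
      subst this; simp only [zero_mul, zero_add, one_mul] at *; linarith
    · nlinarith [mul_pos_of_neg_of_neg hy (neg_neg_of_pos ha'), mul_nonneg_of_nonpos_of_nonpos hz.le
        (neg_nonpos.2 hb)]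
  have hmem : ∀ t : ℝ, 0 < t → x + (-(t * σ)) • e ∈ C := by
    intro t ht
    have hee : ⟪e, e⟫ = 1 := by rw [real_inner_self_eq_norm_sq, h.norm_eq, one_pow]
    simp only [hC, mem_ofPred_eq, w, add_sub_cancel_left, inner_smul_right, hee, mul_one, sub_self,
      norm_zero, mul_zero, zero_add]
    rcases hσ with rfl | rfl <;> linarith
  -- points of the cone near `x` lie in `s`
  have hpr : Tendsto (fun y => x + w y) (𝓝 x) (𝓝 x) := by
    have : Tendsto (fun y => x + w y) (𝓝 x) (𝓝 (x + w x)) := Continuous.tendsto (by fun_prop) x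
    simpa [w] using this
  have hev : ∀ᶠ y in 𝓝 x, y ∈ C → y ∈ s := by
    filter_upwards [hs, hpr.eventually hK] with y hy1 hy2 hyC
    refine hy1 ?_
    simp only [hC, mem_ofPred_eq] at hyC
    have e1 : ρ y = ρ (x + w y) - ⟪e, y - x⟫ := by
      rw [← h.add_smul]; congr 1; simp only [w]; abel
    rw [add_sub_cancel_left] at hy2
    have h3 : |ρ (x + w y)| ≤ |K| * ‖w y‖ :=
      hy2.trans (mul_le_mul_of_nonneg_right (le_abs_self K) (norm_nonneg _))
    have h4 := abs_le.1 h3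
    rw [e1]
    rcases hσ with rfl | rfl <;> linarith
  obtain ⟨ε, hε, hball⟩ := Metric.eventually_nhds_iff_ball.1 hev
  have hsub : C ∩ Metric.ball x ε ⊆ s := fun y hy => hball y hy.2 hy.1
  have hlim : Tendsto (fun t : ℝ => x + (-(t * σ)) • e) (𝓝[>] 0) (𝓝 x) := by
    have : Tendsto (fun t : ℝ => x + (-(t * σ)) • e) (𝓝 0) (𝓝 (x + (-(0 * σ)) • e)) :=
      Continuous.tendsto (by fun_prop) 0
    simpa using this.mono_left nhdsWithin_le_nhds
  have hevC : ∀ᶠ t in 𝓝[>] (0 : ℝ), x + (-(t * σ)) • e ∈ C ∩ Metric.ball x ε := by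
    filter_upwards [self_mem_nhdsWithin, hlim.eventually (Metric.ball_mem_nhds x hε)] with t h1 h2
    exact ⟨hmem t h1, h2⟩
  refine UniqueDiffWithinAt.mono (uniqueDiffWithinAt_convex (hCc.inter (convex_ball x ε)) ?_ ?_) hsub
  · rw [(hCo.inter Metric.isOpen_ball).interior_eq]
    obtain ⟨t, ht⟩ := hevC.exists
    exact ⟨_, ht⟩
  · exact mem_closure_of_tendsto hlim hevC

end IsDefiningFunction

/-! ### Generalized normals of Lipschitz domains -/

/-- By compactness of the sphere, a strict sign against all generalized normals at `x` is a uniform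
sign against the normals at nearby boundary points. -/
theorem exists_inner_le_of_generalizedNormals {N : ℕ} {D : Set (EuclideanSpace ℝ (Fin N))}
    {x w : EuclideanSpace ℝ (Fin N)} (hw : ∀ ν ∈ generalizedNormals D x, ⟪w, ν⟫ < 0) :
    ∃ c > 0, ∃ r > 0, ∀ y ∈ frontier D, y ∈ Metric.ball x r → ∀ ν, IsOutwardUnitNormal D y ν →
      ⟪w, ν⟫ ≤ -c := by
  by_contra! hcon
  have hpos : ∀ n : ℕ, (0 : ℝ) < 1 / ((n : ℝ) + 1) := fun n => by positivity
  choose y hyD hyr ν hν hlt using fun n : ℕ => hcon _ (hpos n) _ (hpos n)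
  have hνs : ∀ n, ν n ∈ Metric.sphere (0 : EuclideanSpace ℝ (Fin N)) 1 := fun n => by
    rw [mem_sphere_zero_iff_norm]; exact (hν n).1
  obtain ⟨a, -, τ, hτ, hlim⟩ := (isCompact_sphere (0 : EuclideanSpace ℝ (Fin N)) 1).tendsto_subseq
    hνs
  have h0 : Tendsto (fun n : ℕ => 1 / ((n : ℝ) + 1)) atTop (𝓝 0) :=
    tendsto_one_div_add_atTop_nhds_zero_nat
  have hy : Tendsto y atTop (𝓝 x) := by
    rw [tendsto_iff_dist_tendsto_zero]
    exact squeeze_zero (fun _ => dist_nonneg) (fun n => (Metric.mem_ball.1 (hyr n)).le) h0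
  have ha : a ∈ generalizedNormals D x :=
    ⟨y ∘ τ, ν ∘ τ, fun j => ⟨hyD _, hν _⟩, hy.comp hτ.tendsto_atTop, hlim⟩
  have h1 : Tendsto (fun n => ⟪w, (ν ∘ τ) n⟫) atTop (𝓝 ⟪w, a⟫) := tendsto_const_nhds.inner hlim
  have h2 : Tendsto (fun n => -(1 / (((τ n : ℕ) : ℝ) + 1))) atTop (𝓝 (-0)) :=
    (h0.comp hτ.tendsto_atTop).neg
  have h3 := le_of_tendsto_of_tendsto' h2 h1 fun n => (hlt (τ n)).le
  have := hw a ha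
  linarith

/-- For a Lipschitz boundary, normals exist above almost every point, by Rademacher's theorem. Hence
a strict sign against the generalized normals becomes a lower bound, almost everywhere near `x`, for
the directional derivative of a defining function. -/
theorem IsDefiningFunction.exists_ae_le_fderiv {N : ℕ} {D : Set (EuclideanSpace ℝ (Fin N))}
    {x e : EuclideanSpace ℝ (Fin N)} {ρ : EuclideanSpace ℝ (Fin N) → ℝ}
    (h : IsDefiningFunction D x e ρ) (hx : x ∈ frontier D) {K : ℝ≥0} (hK : LipschitzWith K ρ)
    {w : EuclideanSpace ℝ (Fin N)} (hw : ∀ ν ∈ generalizedNormals D x, ⟪w, ν⟫ < 0) :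
    ∃ c > 0, ∃ r > 0, ∀ᵐ y, y ∈ Metric.ball x r → c ≤ fderiv ℝ ρ y w := by
  obtain ⟨c, hc, r, hr, hcr⟩ := exists_inner_le_of_generalizedNormals hw
  have h0 := h.apply_eq_zero hx
  obtain ⟨r', hr', hball⟩ := Metric.eventually_nhds_iff_ball.1
    ((eventually_eventually_nhds.2 h.mem_iff).and h.eventually_mem_frontier)
  set R := min r r' with hR
  have hR0 : 0 < R := lt_min hr hr'
  refine ⟨c, hc, R / (1 + K), by positivity, ?_⟩
  filter_upwards [hK.ae_differentiableAt (μ := volume)] with y hd hy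
  -- the boundary point above `y`
  set z := y + ρ y • e with hz
  have hz0 : ρ z = 0 := by rw [hz, h.add_smul, sub_self]
  have hρy : |ρ y| ≤ K * dist y x := by
    have := hK.dist_le_mul y x
    rwa [h0, Real.dist_0_eq_abs] at this
  have hzx : z ∈ Metric.ball x R := by
    rw [Metric.mem_ball, dist_eq_norm] at hy ⊢
    rw [dist_eq_norm] at hρy
    calc ‖z - x‖ = ‖(y - x) + ρ y • e‖ := by rw [hz]; congr 1; abel
      _ ≤ ‖y - x‖ + |ρ y| := by
          refine (norm_add_le _ _).trans ?_
          rw [norm_smul, h.norm_eq, mul_one, Real.norm_eq_abs]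
      _ ≤ (1 + K) * ‖y - x‖ := by linarith
      _ < (1 + K) * (R / (1 + K)) := by gcongr
      _ = R := by field_simp
  have hdz : HasFDerivAt ρ (fderiv ℝ ρ y) z := by
    have h1 : ρ = fun p => ρ (p + (-ρ y) • e) - ρ y := by
      ext p; rw [h.add_smul]; ring
    have h2 : HasFDerivAt ρ (fderiv ℝ ρ y) (z + (-ρ y) • e) := by
      rw [hz, add_assoc, ← _root_.add_smul, add_neg_cancel, zero_smul, add_zero]
      exact hd.hasFDerivAt
    exact (((hasFDerivAt_comp_add_right ((-ρ y) • e)).2 h2).sub_const (ρ y)).congr_of_eventuallyEq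
      (Eventually.of_forall fun p => congrFun h1 p)
  have hzr' := hball z (Metric.ball_subset_ball (min_le_right _ _) hzx)
  obtain ⟨hn, hν⟩ := h.isOutwardUnitNormal hzr'.1 hz0 hdz.differentiableAt
  have key := hcr z (hzr'.2 hz0) (Metric.ball_subset_ball (min_le_left _ _) hzx) _ hν
  have hn1 : 1 ≤ ‖∇ ρ z‖ := by
    have h1 := h.fderiv_apply_self hdz.differentiableAt
    rw [← inner_gradient] at h1
    have h2 := abs_real_inner_le_norm (∇ ρ z) e
    rw [h1, h.norm_eq] at h2
    simpa using h2
  rw [← hdz.fderiv, ← inner_gradient, real_inner_comm]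
  rw [inner_neg_right, inner_smul_right] at key
  have h3 : c ≤ ‖∇ ρ z‖⁻¹ * ⟪w, ∇ ρ z⟫ := by linarith
  rw [le_inv_mul_iff₀ hn] at h3
  nlinarith

theorem HasLipschitzBoundary.generalizedNormals_nonempty {N : ℕ}
    {D : Set (EuclideanSpace ℝ (Fin N))} (hD : HasLipschitzBoundary D)
    {x : EuclideanSpace ℝ (Fin N)} (hx : x ∈ frontier D) : (generalizedNormals D x).Nonempty := by
  by_contra hemp
  rw [not_nonempty_iff_eq_empty] at hemp
  obtain ⟨e, ρ, h, K, hK⟩ := hD.exists_isDefiningFunction hx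
  obtain ⟨c, hc, r, hr, hae⟩ := h.exists_ae_le_fderiv hx hK (w := 0) (by simp [hemp])
  have hz : volume (Metric.ball x r) = 0 := by
    refine measure_mono_null (fun y hy => ?_) hae
    simp only [mem_compl_iff, mem_ofPred_eq, map_zero, Classical.not_imp, not_le]
    exact ⟨hy, hc⟩
  exact (Metric.measure_ball_pos volume x hr).ne' hz

set_option maxHeartbeats 400000 in
/-- Mollifying a defining function gives smooth functions, uniformly close to it, that are still
increasing in the direction `w` if `w` has a strict sign against all generalized normals. -/
theorem IsDefiningFunction.exists_contDiff_approx {N : ℕ} {D : Set (EuclideanSpace ℝ (Fin N))}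
    {x e : EuclideanSpace ℝ (Fin N)} {ρ : EuclideanSpace ℝ (Fin N) → ℝ}
    (h : IsDefiningFunction D x e ρ) (hx : x ∈ frontier D) {K : ℝ≥0} (hK : LipschitzWith K ρ)
    {w : EuclideanSpace ℝ (Fin N)} (hw : ∀ ν ∈ generalizedNormals D x, ⟪w, ν⟫ < 0) :
    ∃ c > 0, ∃ r > 0, ∀ δ > 0, ∃ ρ' : EuclideanSpace ℝ (Fin N) → ℝ, ContDiff ℝ 1 ρ' ∧
      (∀ y, |ρ' y - ρ y| ≤ δ) ∧
      ∀ y ∈ Metric.ball x r, c ≤ fderiv ℝ ρ' y w ∧ ‖fderiv ℝ ρ' y‖ ≤ K := by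
  obtain ⟨c, hc, r, hr, hae⟩ := h.exists_ae_le_fderiv hx hK hw
  refine ⟨c, hc, r / 2, by positivity, fun δ hδ => ?_⟩
  set η := min (r / 2) (δ / (K + 1)) with hη
  have hη0 : 0 < η := lt_min (by positivity) (by positivity)
  let φ : ContDiffBump (0 : EuclideanSpace ℝ (Fin N)) := ⟨η / 2, η, by positivity, by linarith⟩
  set θ : EuclideanSpace ℝ (Fin N) → ℝ := φ.normed volume with hθ
  have hθc : Continuous θ := φ.continuous_normed
  have hθs : HasCompactSupport θ := φ.hasCompactSupport_normed
  have hθ0 : ∀ z, 0 ≤ θ z := φ.nonneg_normed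
  have hθi : Integrable θ := hθc.integrable_of_hasCompactSupport hθs
  have hθ1 : ∫ z, θ z = 1 := φ.integral_normed
  have hθz : ∀ z, θ z ≠ 0 → ‖z‖ < η := by
    intro z hz
    have : z ∈ Function.support θ := hz
    rw [hθ, φ.support_normed_eq, mem_ball_zero_iff] at this
    exact this
  set ρ' : EuclideanSpace ℝ (Fin N) → ℝ := fun y => ∫ z, θ z * ρ (y - z) with hρ'
  have hconv : ρ' = convolution θ ρ (ContinuousLinearMap.lsmul ℝ ℝ) volume := rfl
  have hint : ∀ y, Integrable (fun z => θ z * ρ (y - z)) := fun y =>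
    (hθc.mul (h.continuous.comp (continuous_const.sub continuous_id))).integrable_of_hasCompactSupport
      hθs.mul_right
  have hder : ∀ y, Integrable (fun z => θ z • fderiv ℝ ρ (y - z)) ∧
      HasFDerivAt ρ' (∫ z, θ z • fderiv ℝ ρ (y - z)) y := by
    intro y
    refine hasFDerivAt_integral_of_dominated_loc_of_lip (s := univ) (bound := fun z => θ z * K)
      univ_mem (Eventually.of_forall fun y => (hint y).aestronglyMeasurable) (hint y) ?_
      (Eventually.of_forall fun z => ?_) (hθi.mul_const _) ?_
    · exact hθc.aestronglyMeasurable.smul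
        ((measurable_fderiv ℝ ρ).comp (measurable_const.sub measurable_id)).aestronglyMeasurable
    · refine LipschitzOnWith.of_dist_le_mul fun p _ p' _ => ?_
      have h1 := hK.dist_le_mul (p - z) (p' - z)
      rw [dist_sub_right] at h1
      rw [Real.dist_eq, ← mul_sub, abs_mul, abs_of_nonneg (hθ0 z), Real.coe_nnabs,
        abs_of_nonneg (mul_nonneg (hθ0 z) K.coe_nonneg), mul_assoc]
      exact mul_le_mul_of_nonneg_left h1 (hθ0 z)
    · have := (Measure.measurePreserving_sub_left (volume : Measure (EuclideanSpace ℝ (Fin N))) y).quasiMeasurePreserving.ae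
        (hK.ae_differentiableAt (μ := volume))
      filter_upwards [this] with z hz
      have h1 : HasFDerivAt (fun p => ρ (p - z)) (fderiv ℝ ρ (y - z)) y :=
        (hasFDerivAt_comp_sub z).2 hz.hasFDerivAt
      exact h1.const_mul (θ z)
  refine ⟨ρ', ?_, fun y => ?_, fun y hy => ⟨?_, ?_⟩⟩
  · rw [hconv]
    exact hθs.contDiff_convolution_left _ (n := 1) φ.contDiff_normed
      (h.continuous.locallyIntegrable)
  · have := φ.dist_normed_convolution_le (μ := volume) (g := ρ) (x₀ := y) (ε := δ)
      h.continuous.aestronglyMeasurable fun z hz => ?_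
    · rwa [← hθ, ← hconv, Real.dist_eq] at this
    · have hz' : dist z y < η := hz
      have h2 : η ≤ δ / (K + 1) := min_le_right _ _
      calc dist (ρ z) (ρ y) ≤ K * dist z y := hK.dist_le_mul z y
        _ ≤ (K + 1) * (δ / (K + 1)) := by
            gcongr
            · linarith
            · linarith
        _ = δ := by field_simp
  · have h1 := hder y
    rw [h1.2.fderiv, ContinuousLinearMap.integral_apply h1.1]
    calc c = ∫ z, θ z * c := by rw [integral_mul_const, hθ1, one_mul]
      _ ≤ _ := by
        refine integral_mono_ae (hθi.mul_const c) (h1.1.apply_continuousLinearMap w) ?_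
        have := (Measure.measurePreserving_sub_left
          (volume : Measure (EuclideanSpace ℝ (Fin N))) y).quasiMeasurePreserving.ae hae
        filter_upwards [this] with z hz
        by_cases h0 : θ z = 0
        · simp [h0]
        · refine mul_le_mul_of_nonneg_left (hz ?_) (hθ0 z)
          have hzn := hθz z h0
          rw [Metric.mem_ball, dist_eq_norm] at hy ⊢
          have : η ≤ r / 2 := min_le_left _ _
          calc ‖y - z - x‖ = ‖(y - x) - z‖ := by congr 1; abel
            _ ≤ ‖y - x‖ + ‖z‖ := norm_sub_le _ _
            _ < r := by linarith
  · have h1 := hder y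
    rw [h1.2.fderiv]
    calc ‖∫ z, θ z • fderiv ℝ ρ (y - z)‖ ≤ ∫ z, θ z * K := by
          refine norm_integral_le_of_norm_le (hθi.mul_const _) (Eventually.of_forall fun z => ?_)
          rw [norm_smul, Real.norm_of_nonneg (hθ0 z)]
          exact mul_le_mul_of_nonneg_left (norm_fderiv_le_of_lipschitz ℝ hK) (hθ0 z)
      _ = K := by rw [integral_mul_const, hθ1, one_mul]

/-! ### Integrating by parts inside the domain and across an interface -/

namespace IsBumpTest

variable {N : ℕ} {Ω : Set (EuclideanSpace ℝ (Fin N))} {x₀ : EuclideanSpace ℝ (Fin N)} {r : ℝ}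
  {v : EuclideanSpace ℝ (Fin N) → ℝ} {V : EuclideanSpace ℝ (Fin N) → EuclideanSpace ℝ (Fin N)}

/-- Since `v` and `V` vanish off the ball of radius `r`, the cutoff function `ζ` only has to be
supported in `W` within a slightly larger ball. -/
theorem integral_mul_inner (h : IsBumpTest Ω x₀ r v V) (hΩ : IsOpen Ω) (hr : 0 < r) {R : ℝ}
    (hrR : r < R) {W : Set (EuclideanSpace ℝ (Fin N))} (hW : IsOpen W) (hWΩ : W ⊆ Ω)
    {F : EuclideanSpace ℝ (Fin N) → EuclideanSpace ℝ (Fin N)} (hF : ContDiffOn ℝ 1 F W)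
    {ζ : EuclideanSpace ℝ (Fin N) → ℝ} (hζ : ContDiff ℝ 1 ζ)
    (hsW : tsupport ζ ∩ Metric.closedBall x₀ R ⊆ W) :
    ∫ x in Ω, ζ x * ⟪F x, V x⟫ =
      -∫ x in Ω, v x * (ζ x * divergence F x + fderiv ℝ ζ x (F x)) := by
  let χ : ContDiffBump x₀ := ⟨r, R, hr, hrR⟩
  have hχc : ContDiff ℝ 1 χ := χ.contDiff
  have hts : tsupport (fun x => ζ x * χ x) ⊆ tsupport ζ ∩ Metric.closedBall x₀ R := by
    refine subset_inter (tsupport_mul_subset_left) ?_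
    exact (tsupport_mul_subset_right).trans (χ.tsupport_eq).subset
  have hcs : HasCompactSupport (fun x => ζ x * χ x) :=
    (isCompact_closedBall x₀ R).of_isClosed_subset (isClosed_tsupport _)
      (hts.trans inter_subset_right)
  have key := h.hasWeakGradient.integral_mul_inner hΩ (h.continuousOn.mono subset_closure) hW hWΩ hF
    (hζ.mul hχc) hcs (hts.trans hsW)
  have e1 : ∀ x ∈ Ω, ζ x * χ x * ⟪F x, V x⟫ = ζ x * ⟪F x, V x⟫ := by
    intro x hx
    by_cases hxr : x ∈ Metric.ball x₀ r
    · rw [χ.one_of_mem_closedBall (Metric.ball_subset_closedBall hxr), mul_one]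
    · rw [h.grad_eq_zero x hx hxr]; simp
  have e2 : ∀ x ∈ Ω, v x * (ζ x * χ x * divergence F x + fderiv ℝ (fun x => ζ x * χ x) x (F x)) =
      v x * (ζ x * divergence F x + fderiv ℝ ζ x (F x)) := by
    intro x hx
    by_cases hxr : x ∈ Metric.ball x₀ r
    · have : (fun x => ζ x * χ x) =ᶠ[𝓝 x] ζ := by
        filter_upwards [Metric.isOpen_ball.mem_nhds hxr] with y hy
        rw [χ.one_of_mem_closedBall (Metric.ball_subset_closedBall hy), mul_one]
      rw [this.fderiv_eq, χ.one_of_mem_closedBall (Metric.ball_subset_closedBall hxr), mul_one]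
    · rw [h.eq_zero x (subset_closure hx) hxr]; simp
  rw [setIntegral_congr_fun hΩ.measurableSet e1, setIntegral_congr_fun hΩ.measurableSet e2] at key
  exact key

theorem integrableOn_self (h : IsBumpTest Ω x₀ r v V) (hΩb : Bornology.IsBounded Ω) :
    IntegrableOn v Ω :=
  (h.continuousOn.integrableOn_compact hΩb.isCompact_closure).mono_set subset_closure

theorem integral_pos (h : IsBumpTest Ω x₀ r v V) (hΩ : IsOpen Ω) (hΩb : Bornology.IsBounded Ω)
    (hx₀ : x₀ ∈ closure Ω) : 0 < ∫ x in Ω, v x := by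
  rw [integral_pos_iff_support_of_nonneg h.nonneg (h.integrableOn_self hΩb)]
  have h1 : ∀ᶠ y in 𝓝[closure Ω] x₀, 0 < v y := (h.continuousOn x₀ hx₀).eventually (lt_mem_nhds h.pos)
  obtain ⟨ε, hε, hball⟩ := Metric.mem_nhdsWithin_iff.1 h1
  have hsub : Metric.ball x₀ ε ∩ Ω ⊆ Function.support v := fun y hy =>
    (hball ⟨hy.1, subset_closure hy.2⟩ : 0 < v y).ne'
  have hne : (Metric.ball x₀ ε ∩ Ω).Nonempty :=
    mem_closure_iff.1 hx₀ _ Metric.isOpen_ball (Metric.mem_ball_self hε)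
  refine lt_of_lt_of_le ((Metric.isOpen_ball.inter hΩ).measure_pos volume hne) ?_
  rw [Measure.restrict_apply' hΩ.measurableSet]
  exact measure_mono (subset_inter hsub inter_subset_right)

theorem integrableOn_mul (h : IsBumpTest Ω x₀ r v V) (hΩb : Bornology.IsBounded Ω)
    {S : Set (EuclideanSpace ℝ (Fin N))} (hS : IsOpen S) (hSΩ : S ⊆ Ω)
    {f : EuclideanSpace ℝ (Fin N) → ℝ} (hf : ContinuousOn f S) {C : ℝ} (hC : ∀ x ∈ S, |f x| ≤ C) :
    IntegrableOn (fun x => v x * f x) S := by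
  refine Integrable.mul_bdd (c := C) ((h.integrableOn_self hΩb).mono_set hSΩ)
    (hf.aestronglyMeasurable hS.measurableSet) ?_
  filter_upwards [ae_restrict_mem hS.measurableSet] with x hx using hC x hx

theorem integrableOn_inner (h : IsBumpTest Ω x₀ r v V)
    {S : Set (EuclideanSpace ℝ (Fin N))} (hS : IsOpen S) (hSΩ : S ⊆ Ω)
    {F : EuclideanSpace ℝ (Fin N) → EuclideanSpace ℝ (Fin N)} (hF : ContinuousOn F S) {C : ℝ}
    (hC : ∀ x ∈ S, ‖F x‖ ≤ C) : IntegrableOn (fun x => ⟪F x, V x⟫) S := by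
  have hVS := h.integrableOn.mono_set hSΩ
  refine (hVS.norm.const_mul C).mono'
    ((hF.aestronglyMeasurable hS.measurableSet).inner hVS.aestronglyMeasurable) ?_
  filter_upwards [ae_restrict_mem hS.measurableSet] with x hx
  exact (norm_inner_le_norm _ _).trans (mul_le_mul_of_nonneg_right (hC x hx) (norm_nonneg _))

theorem setIntegral_mul_eq (h : IsBumpTest Ω x₀ r v V) (hΩ : IsOpen Ω)
    (f : EuclideanSpace ℝ (Fin N) → ℝ) :
    ∫ x in Ω, v x * f x = ∫ x in Ω ∩ Metric.ball x₀ r, v x * f x := by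
  refine setIntegral_eq_of_subset_of_forall_sdiff_eq_zero hΩ.measurableSet inter_subset_left
    fun x hx => ?_
  rw [h.eq_zero x (subset_closure hx.1) fun hb => hx.2 ⟨hx.1, hb⟩, zero_mul]

theorem setIntegral_inner_eq (h : IsBumpTest Ω x₀ r v V) (hΩ : IsOpen Ω)
    (F : EuclideanSpace ℝ (Fin N) → EuclideanSpace ℝ (Fin N)) :
    ∫ x in Ω, ⟪F x, V x⟫ = ∫ x in Ω ∩ Metric.ball x₀ r, ⟪F x, V x⟫ := by
  refine setIntegral_eq_of_subset_of_forall_sdiff_eq_zero hΩ.measurableSet inter_subset_left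
    fun x hx => ?_
  rw [h.grad_eq_zero x hx.1 fun hb => hx.2 ⟨hx.1, hb⟩, inner_zero_right]

theorem integral_inner_eq_neg (h : IsBumpTest Ω x₀ r v V) (hΩ : IsOpen Ω)
    (hr : 0 < r) {R : ℝ} (hrR : r < R) {W : Set (EuclideanSpace ℝ (Fin N))} (hW : IsOpen W)
    (hWΩ : W ⊆ Ω) (hRW : Metric.closedBall x₀ R ⊆ W)
    {F : EuclideanSpace ℝ (Fin N) → EuclideanSpace ℝ (Fin N)} (hF : ContDiffOn ℝ 1 F W) :
    ∫ x in Ω, ⟪F x, V x⟫ = -∫ x in Ω, v x * divergence F x := by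
  have := h.integral_mul_inner hΩ hr hrR hW hWΩ hF (ζ := fun _ => 1) contDiff_const
    (inter_subset_right.trans hRW)
  simpa using this

theorem integral_inner_le (h : IsBumpTest Ω x₀ r v V) (hΩ : IsOpen Ω)
    (hΩb : Bornology.IsBounded Ω) (hr : 0 < r) {R : ℝ} (hrR : r < R)
    {W : Set (EuclideanSpace ℝ (Fin N))} (hW : IsOpen W) (hWΩ : W ⊆ Ω)
    (hRW : Metric.closedBall x₀ R ⊆ W)
    {F : EuclideanSpace ℝ (Fin N) → EuclideanSpace ℝ (Fin N)} (hF : ContDiffOn ℝ 1 F W)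
    {c : ℝ} (hc : ∀ x ∈ W, c ≤ divergence F x) :
    ∫ x in Ω, ⟪F x, V x⟫ ≤ -(c * ∫ x in Ω, v x) := by
  rw [h.integral_inner_eq_neg hΩ hr hrR hW hWΩ hRW hF, neg_le_neg_iff, ← integral_const_mul]
  have hrW : Metric.ball x₀ r ⊆ W := (Metric.ball_subset_closedBall.trans
    (Metric.closedBall_subset_closedBall hrR.le)).trans hRW
  simp only [mul_comm c]
  rw [h.setIntegral_mul_eq hΩ, h.setIntegral_mul_eq hΩ]
  have hSo : IsOpen (Ω ∩ Metric.ball x₀ r) := hΩ.inter Metric.isOpen_ball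
  have hdc := continuousOn_divergence hW hF
  obtain ⟨C, hC⟩ := (isCompact_closedBall x₀ R).exists_bound_of_continuousOn (hdc.mono hRW)
  refine setIntegral_mono_on
    (h.integrableOn_mul hΩb hSo inter_subset_left continuousOn_const (C := |c|) fun _ _ => le_rfl)
    (h.integrableOn_mul hΩb hSo inter_subset_left
      (hdc.mono (inter_subset_right.trans hrW)) (C := C) fun x hx => hC x ?_)
    hSo.measurableSet fun x hx => mul_le_mul_of_nonneg_left (hc x (hrW hx.2)) (h.nonneg x)
  exact Metric.closedBall_subset_closedBall hrR.le (Metric.ball_subset_closedBall hx.2)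

set_option maxHeartbeats 800000 in
/-- The fields `A` on `{ρ > 0}` and `B` on `{ρ < 0}` form one field with a jump across `{ρ = 0}`. If
the jump `A - B` points into `{ρ > 0}`, in the sense that smooth approximations of `ρ` do not
decrease along it, then the jump contributes nonpositively, so the divergence of the piecewise field
is at least the piecewise divergence. The jump is cut off by functions of `ρ' / ε` that vanish where
`ρ ≥ 0`; only one side of the interface is cut off, because `A` is smooth across it. -/
theorem integral_inner_le_of_jump (h : IsBumpTest Ω x₀ r v V) (hΩ : IsOpen Ω)
    (hΩb : Bornology.IsBounded Ω) (hr : 0 < r) {R R' : ℝ} (hrR : r < R) (hRR' : R < R')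
    (hRΩ : Metric.ball x₀ R' ⊆ Ω) {ρ : EuclideanSpace ℝ (Fin N) → ℝ} (hρc : Continuous ρ)
    (hρ0 : volume {y | ρ y = 0} = 0)
    {A B H : EuclideanSpace ℝ (Fin N) → EuclideanSpace ℝ (Fin N)}
    (hA : ContDiffOn ℝ 1 A (Metric.ball x₀ R'))
    (hB : ContDiffOn ℝ 1 B (Metric.ball x₀ R' ∩ {y | ρ y < 0})) {c C C' : ℝ}
    (hAc : ∀ x ∈ Metric.ball x₀ R', c ≤ divergence A x)
    (hBc : ∀ x ∈ Metric.ball x₀ R' ∩ {y | ρ y < 0}, c ≤ divergence B x ∧ divergence B x ≤ C)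
    (hBb : ∀ x ∈ Metric.ball x₀ R' ∩ {y | ρ y < 0}, ‖B x‖ ≤ C')
    (hjump : ∀ δ > 0, ∃ ρ' : EuclideanSpace ℝ (Fin N) → ℝ, ContDiff ℝ 1 ρ' ∧
      (∀ y, |ρ' y - ρ y| ≤ δ) ∧
      ∀ y ∈ Metric.ball x₀ R' ∩ {y | ρ y < 0}, 0 ≤ fderiv ℝ ρ' y (A y - B y))
    (hHA : ∀ x ∈ Metric.ball x₀ r, 0 < ρ x → H x = A x)
    (hHB : ∀ x ∈ Metric.ball x₀ r, ρ x < 0 → H x = B x) :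
    ∫ x in Ω, ⟪H x, V x⟫ ≤ -(c * ∫ x in Ω, v x) := by
  set U : Set (EuclideanSpace ℝ (Fin N)) := Metric.ball x₀ R' ∩ {y | ρ y < 0} with hU
  set T : Set (EuclideanSpace ℝ (Fin N)) := Ω ∩ Metric.ball x₀ r with hT
  set S : Set (EuclideanSpace ℝ (Fin N)) := T ∩ {y | ρ y < 0} with hS
  have hneg : IsOpen {y | ρ y < 0} := isOpen_lt hρc continuous_const
  have hUo : IsOpen U := Metric.isOpen_ball.inter hneg
  have hTo : IsOpen T := hΩ.inter Metric.isOpen_ball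
  have hSo : IsOpen S := hTo.inter hneg
  have hTΩ : T ⊆ Ω := inter_subset_left
  have hSΩ : S ⊆ Ω := inter_subset_left.trans hTΩ
  have hrR' : Metric.ball x₀ r ⊆ Metric.ball x₀ R' := Metric.ball_subset_ball (hrR.trans hRR').le
  have hSU : S ⊆ U := fun x hx => ⟨hrR' hx.1.2, hx.2⟩
  have hcR : Metric.closedBall x₀ R ⊆ Metric.ball x₀ R' := Metric.closedBall_subset_ball hRR'
  have hTR : T ⊆ Metric.closedBall x₀ R := inter_subset_right.trans
    (Metric.ball_subset_closedBall.trans (Metric.closedBall_subset_closedBall hrR.le))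
  have hSR : S ⊆ Metric.closedBall x₀ R := inter_subset_left.trans hTR
  have hAd := continuousOn_divergence Metric.isOpen_ball hA
  have hBd := continuousOn_divergence hUo hB
  obtain ⟨C₁, hC₁⟩ := (isCompact_closedBall x₀ R).exists_bound_of_continuousOn (hAd.mono hcR)
  obtain ⟨C₂, hC₂⟩ := (isCompact_closedBall x₀ R).exists_bound_of_continuousOn
    (hA.continuousOn.mono hcR)
  have hAU : ContDiffOn ℝ 1 A U := hA.mono inter_subset_left
  have hBA : ContDiffOn ℝ 1 (fun x => B x - A x) U := hB.sub hAU
  have hdiv : ∀ x ∈ U, divergence (fun x => B x - A x) x = divergence B x - divergence A x := by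
    intro x hx
    have hB' := (hB.contDiffAt (hUo.mem_nhds hx)).differentiableAt one_ne_zero
    have hA' := (hAU.contDiffAt (hUo.mem_nhds hx)).differentiableAt one_ne_zero
    unfold divergence
    rw [show fderiv ℝ (fun x => B x - A x) x = _ from fderiv_fun_sub hB' hA']
    simp
  have hdivS : ∀ x ∈ S, |divergence (fun x => B x - A x) x| ≤ |c| + |C| + C₁ := by
    intro x hx
    rw [hdiv x (hSU hx)]
    have h1 := hC₁ x (hSR hx)
    have h2 := hBc x (hSU hx)
    rw [Real.norm_eq_abs] at h1
    have h3 : |divergence B x| ≤ |c| + |C| := by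
      rw [abs_le]
      constructor
      · linarith [neg_abs_le c, abs_nonneg C]
      · linarith [le_abs_self C, abs_nonneg c]
    exact (abs_sub _ _).trans (by linarith)
  have hBAb : ∀ x ∈ S, ‖B x - A x‖ ≤ C' + C₂ := fun x hx =>
    (norm_sub_le _ _).trans (add_le_add (hBb x (hSU hx)) (hC₂ x (hSR hx)))
  have hdivSc : ContinuousOn (divergence fun x => B x - A x) S :=
    (continuousOn_divergence hUo hBA).mono hSU
  have iBA : IntegrableOn (fun x => ⟪B x - A x, V x⟫) S :=
    h.integrableOn_inner hSo hSΩ (hBA.continuousOn.mono hSU) hBAb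
  have iA : IntegrableOn (fun x => ⟪A x, V x⟫) T :=
    h.integrableOn_inner hTo hTΩ (hA.continuousOn.mono (hTR.trans hcR)) fun x hx => hC₂ x (hTR hx)
  have ivBA : IntegrableOn (fun x => v x * divergence (fun x => B x - A x) x) S :=
    h.integrableOn_mul hΩb hSo hSΩ hdivSc hdivS
  have ivA : IntegrableOn (fun x => v x * divergence A x) T :=
    h.integrableOn_mul hΩb hTo hTΩ (hAd.mono (hTR.trans hcR)) fun x hx => hC₁ x (hTR hx)
  -- the contribution of the jump
  have hmain : ∫ x in S, ⟪B x - A x, V x⟫ ≤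
      -∫ x in S, v x * divergence (fun x => B x - A x) x := by
    set st : ℝ → ℝ := fun s => Real.smoothTransition (s - 1) with hst
    have hstc : ContDiff ℝ 1 st := Real.smoothTransition.contDiff.comp (contDiff_id.sub contDiff_const)
    have hst0 : ∀ s ≤ 1, st s = 0 := fun s hs =>
      Real.smoothTransition.zero_of_nonpos (by linarith)
    have hst1 : ∀ s, 2 ≤ s → st s = 1 := fun s hs =>
      Real.smoothTransition.one_of_one_le (by linarith)
    have hstm : Monotone st := fun a b hab => Real.smoothTransition.monotone (by linarith)
    have hst01 : ∀ s, 0 ≤ st s ∧ st s ≤ 1 := fun s =>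
      ⟨Real.smoothTransition.nonneg _, Real.smoothTransition.le_one _⟩
    set ε : ℕ → ℝ := fun n => 1 / ((n : ℝ) + 1) with hε
    have hε0 : ∀ n, 0 < ε n := fun n => by positivity
    have hεlim : Tendsto ε atTop (𝓝 0) := tendsto_one_div_add_atTop_nhds_zero_nat
    choose ρ' hρ'c hρ'a hρ'j using fun n => hjump (ε n / 2) (half_pos (hε0 n))
    set ζ : ℕ → EuclideanSpace ℝ (Fin N) → ℝ := fun n y => st (-ρ' n y / ε n) with hζ
    have hζc : ∀ n, ContDiff ℝ 1 (ζ n) := fun n =>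
      hstc.comp ((hρ'c n).neg.div_const _)
    have hζ0 : ∀ n y, 0 ≤ ρ y → ζ n y = 0 := by
      intro n y hy
      refine hst0 _ ?_
      rw [div_le_one (hε0 n)]
      have := abs_le.1 (hρ'a n y)
      linarith [hε0 n]
    have hζt : ∀ n, tsupport (ζ n) ⊆ {y | ρ y ≤ -(ε n / 2)} := by
      intro n
      refine closure_minimal (fun y hy => ?_) (isClosed_le hρc continuous_const)
      by_contra hlt
      rw [mem_ofPred_eq, not_le] at hlt
      refine hy (hst0 _ ?_)
      rw [div_le_one (hε0 n)]
      have := abs_le.1 (hρ'a n y)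
      linarith
    have hζd : ∀ n, ∀ y ∈ U, 0 ≤ fderiv ℝ (ζ n) y (B y - A y) := by
      intro n y hy
      have h1 : HasFDerivAt (fun y => -ρ' n y / ε n) ((ε n)⁻¹ • -fderiv ℝ (ρ' n) y) y := by
        simp only [div_eq_inv_mul]
        exact (((hρ'c n).differentiable one_ne_zero y).hasFDerivAt.neg).const_mul _
      have h2 : HasDerivAt st (deriv st (-ρ' n y / ε n)) (-ρ' n y / ε n) :=
        (hstc.differentiable one_ne_zero _).hasDerivAt
      have h5 : HasFDerivAt (ζ n) (deriv st (-ρ' n y / ε n) • ((ε n)⁻¹ • -fderiv ℝ (ρ' n) y)) y :=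
        HasDerivAt.comp_hasFDerivAt (h₂ := st) y h2 h1
      rw [h5.fderiv]
      have h3 := hρ'j n y hy
      have h4 : A y - B y = -(B y - A y) := by abel
      rw [h4, map_neg] at h3
      simp only [FunLike.coe_smul, FunLike.coe_neg, Pi.smul_apply, Pi.neg_apply, smul_eq_mul]
      exact mul_nonneg (hstm.deriv_nonneg) (mul_nonneg (inv_nonneg.2 (hε0 n).le) h3)
    have hsub : ∀ (f : EuclideanSpace ℝ (Fin N) → ℝ), (∀ x ∈ Ω, x ∉ S → f x = 0) →
        ∫ x in Ω, f x = ∫ x in S, f x := fun f hf =>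
      setIntegral_eq_of_subset_of_forall_sdiff_eq_zero hΩ.measurableSet hSΩ
        fun x hx => hf x hx.1 hx.2
    have hstep : ∀ n, ∫ x in S, ζ n x * ⟪B x - A x, V x⟫ ≤
        -∫ x in S, ζ n x * (v x * divergence (fun x => B x - A x) x) := by
      intro n
      have key := h.integral_mul_inner hΩ hr hrR hUo (inter_subset_left.trans hRΩ) hBA (hζc n)
        (fun y hy => ⟨hcR hy.2, lt_of_le_of_lt (hζt n hy.1) (neg_neg_of_pos (half_pos (hε0 n)))⟩)
      have hdζ0 : ∀ x, 0 ≤ ρ x → fderiv ℝ (ζ n) x = 0 := by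
        intro x hx
        by_contra hne
        have := hζt n (support_fderiv_subset ℝ hne)
        rw [mem_ofPred_eq] at this
        linarith [hε0 n]
      rw [hsub _ fun x hx hxS => ?_, hsub _ fun x hx hxS => ?_] at key
      · rw [key, neg_le_neg_iff]
        have hfc : ContinuousOn (fun x => fderiv ℝ (ζ n) x (B x - A x)) S :=
          ((hζc n).continuous_fderiv one_ne_zero).continuousOn.clm_apply
            (hBA.continuousOn.mono hSU)
        obtain ⟨C₃, hC₃⟩ := (isCompact_closedBall x₀ R).exists_bound_of_continuousOn
          ((hζc n).continuous_fderiv one_ne_zero).continuousOn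
        have i1 : IntegrableOn (fun x => ζ n x * (v x * divergence (fun x => B x - A x) x)) S :=
          Integrable.bdd_mul (c := 1) ivBA (hζc n).continuous.aestronglyMeasurable (Eventually.of_forall fun x => by
            rw [Real.norm_of_nonneg (hst01 _).1]; exact (hst01 _).2)
        have i2 : IntegrableOn (fun x => v x * fderiv ℝ (ζ n) x (B x - A x)) S := by
          refine h.integrableOn_mul hΩb hSo hSΩ hfc (C := C₃ * (C' + C₂)) fun x hx => ?_
          refine ((fderiv ℝ (ζ n) x).le_opNorm (B x - A x)).trans ?_
          exact mul_le_mul (hC₃ x (hSR hx)) (hBAb x hx) (norm_nonneg _)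
            ((norm_nonneg _).trans (hC₃ x (hSR hx)))
        have e : ∀ x, v x * (ζ n x * divergence (fun x => B x - A x) x +
            fderiv ℝ (ζ n) x (B x - A x)) = ζ n x * (v x * divergence (fun x => B x - A x) x) +
            v x * fderiv ℝ (ζ n) x (B x - A x) := fun x => by ring
        simp only [e]
        rw [integral_add i1 i2]
        have := setIntegral_nonneg (μ := volume) hSo.measurableSet fun x hx =>
          mul_nonneg (h.nonneg x) (hζd n x (hSU hx))
        linarith
      · by_cases hρx : 0 ≤ ρ x
        · rw [hζ0 n x hρx, hdζ0 x hρx]; simp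
        · rw [h.eq_zero x (subset_closure hx) fun hb => hxS ⟨⟨hx, hb⟩, not_le.1 hρx⟩, zero_mul]
      · by_cases hρx : 0 ≤ ρ x
        · rw [hζ0 n x hρx, zero_mul]
        · rw [h.grad_eq_zero x hx fun hb => hxS ⟨⟨hx, hb⟩, not_le.1 hρx⟩]; simp
    have hlim : ∀ f : EuclideanSpace ℝ (Fin N) → ℝ, IntegrableOn f S →
        Tendsto (fun n => ∫ x in S, ζ n x * f x) atTop (𝓝 (∫ x in S, f x)) := by
      intro f hf
      refine tendsto_integral_of_dominated_convergence (fun x => ‖f x‖)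
        (fun n => (hζc n).continuous.aestronglyMeasurable.mul hf.aestronglyMeasurable) hf.norm
        (fun n => Eventually.of_forall fun x => ?_) ?_
      · rw [norm_mul, Real.norm_of_nonneg (hst01 _).1]
        exact mul_le_of_le_one_left (norm_nonneg _) (hst01 _).2
      · filter_upwards [ae_restrict_mem hSo.measurableSet] with x hx
        have hx0 : ρ x < 0 := hx.2
        refine tendsto_const_nhds.congr' ?_
        have : ∀ᶠ n in atTop, ε n < -ρ x / 3 := hεlim.eventually (gt_mem_nhds (by linarith))
        filter_upwards [this] with n hn
        have h1 := abs_le.1 (hρ'a n x)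
        have : ζ n x = 1 := by
          refine hst1 _ ?_
          rw [le_div_iff₀ (hε0 n)]
          linarith
        rw [this, one_mul]
    exact le_of_tendsto_of_tendsto' (hlim _ iBA) (hlim _ ivBA).neg hstep
  -- assembling both sides
  have hTS : ∀ᵐ x ∂(volume.restrict T), ⟪H x, V x⟫ =
      ⟪A x, V x⟫ + S.indicator (fun x => ⟪B x - A x, V x⟫) x := by
    have h0 : ∀ᵐ x ∂(volume.restrict T), ρ x ≠ 0 := ae_restrict_of_ae (by
      rw [ae_iff]; simpa using hρ0)
    filter_upwards [ae_restrict_mem hTo.measurableSet, h0] with x hx hx0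
    rcases lt_or_gt_of_ne hx0 with hneg | hpos
    · rw [indicator_of_mem (show x ∈ S from ⟨hx, hneg⟩), hHB x hx.2 hneg, inner_sub_left]; ring
    · rw [indicator_of_notMem (fun hxS : x ∈ S => not_lt.2 hpos.le hxS.2), hHA x hx.2 hpos, add_zero]
  have hST : S ⊆ T := inter_subset_left
  have iBA' : IntegrableOn (S.indicator fun x => ⟪B x - A x, V x⟫) T :=
    ((integrable_indicator_iff hSo.measurableSet).2 iBA).integrableOn
  have ivBA' : IntegrableOn (S.indicator fun x => v x * divergence (fun x => B x - A x) x) T :=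
    ((integrable_indicator_iff hSo.measurableSet).2 ivBA).integrableOn
  have hind : ∀ f : EuclideanSpace ℝ (Fin N) → ℝ,
      ∫ x in T, S.indicator f x = ∫ x in S, f x := fun f => by
    rw [setIntegral_indicator hSo.measurableSet, inter_eq_right.2 hST]
  have hAeq := h.integral_inner_eq_neg hΩ hr hrR Metric.isOpen_ball hRΩ hcR hA
  rw [h.setIntegral_inner_eq hΩ, h.setIntegral_mul_eq hΩ] at hAeq
  have hv : ∫ x in Ω, v x = ∫ x in T, v x := by
    have := h.setIntegral_mul_eq hΩ (fun _ => 1)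
    simpa using this
  rw [h.setIntegral_inner_eq hΩ, integral_congr_ae hTS, integral_add iA iBA', hind, hAeq, hv,
    ← integral_const_mul]
  have hfin : ∫ x in T, c * v x ≤ ∫ x in T, (v x * divergence A x +
      S.indicator (fun x => v x * divergence (fun x => B x - A x) x) x) := by
    refine setIntegral_mono_on (((h.integrableOn_self hΩb).mono_set hTΩ).const_mul c)
      (ivA.add ivBA') hTo.measurableSet fun x hx => ?_
    by_cases hxS : x ∈ S
    · rw [indicator_of_mem hxS, hdiv x (hSU hxS)]
      nlinarith [h.nonneg x, (hBc x (hSU hxS)).1]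
    · rw [indicator_of_notMem hxS, add_zero, mul_comm]
      exact mul_le_mul_of_nonneg_left (hAc x (hrR' hx.2)) (h.nonneg x)
  rw [integral_add ivA ivBA', hind] at hfin
  linarith

end IsBumpTest

/-! ### The boundary as a graph and its surface measure -/

section Graph

variable {N : ℕ} {e : EuclideanSpace ℝ (Fin N)} {ρ : EuclideanSpace ℝ (Fin N) → ℝ}

/-- The zero level set of a function `ρ` that decreases with unit speed in the direction `e`,
parametrized as a graph over the hyperplane orthogonal to `e`. -/
noncomputable def boundaryGraph (e : EuclideanSpace ℝ (Fin N)) (ρ : EuclideanSpace ℝ (Fin N) → ℝ)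
    (z : (ℝ ∙ e)ᗮ) : EuclideanSpace ℝ (Fin N) :=
  z + ρ z • e

theorem continuous_boundaryGraph (hρ : Continuous ρ) : Continuous (boundaryGraph e ρ) := by
  unfold boundaryGraph
  fun_prop

theorem inner_coe_orthogonal (z : (ℝ ∙ e)ᗮ) : ⟪e, (z : EuclideanSpace ℝ (Fin N))⟫ = 0 :=
  Submodule.mem_orthogonal_singleton_iff_inner_right.1 z.2

/-- The projection onto the hyperplane decreases distances. -/
theorem norm_sub_le_norm_boundaryGraph_sub (he : ‖e‖ = 1) (z z₀ : (ℝ ∙ e)ᗮ) (s t : ℝ) :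
    ‖z - z₀‖ ≤ ‖(z + s • e : EuclideanSpace ℝ (Fin N)) - (z₀ + t • e)‖ := by
  have h1 : (z + s • e : EuclideanSpace ℝ (Fin N)) - (z₀ + t • e)
      = ((z - z₀ : (ℝ ∙ e)ᗮ) : EuclideanSpace ℝ (Fin N)) + (s - t) • e := by
    push_cast; module
  have h2 : ‖(z + s • e : EuclideanSpace ℝ (Fin N)) - (z₀ + t • e)‖ ^ 2
      = ‖z - z₀‖ ^ 2 + (s - t) ^ 2 := by
    rw [h1, norm_add_sq_real, inner_smul_right, real_inner_comm, inner_coe_orthogonal, norm_smul, he]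
    simp
  refine le_of_sq_le_sq ?_ (norm_nonneg _)
  rw [h2]; nlinarith [sq_nonneg (s - t)]

theorem measurePreserving_add_smul (he : ‖e‖ = 1) :
    MeasurePreserving (fun q : (ℝ ∙ e)ᗮ × ℝ => (q.1 + q.2 • e : EuclideanSpace ℝ (Fin N)))
      (volume.prod volume) volume := by
  have h1 := ((ℝ ∙ e).measurePreserving_measurableEquivProd (0 : EuclideanSpace ℝ (Fin N))).symm
  rw [InnerProductSpace.euclideanHausdorffMeasure_eq_volume] at h1
  have h2 : MeasurePreserving (LinearIsometryEquiv.toSpanUnitSingleton (𝕜 := ℝ) e he) volume volume :=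
    (LinearIsometryEquiv.toSpanUnitSingleton (𝕜 := ℝ) e he).measurePreserving
  have h3 : MeasurePreserving (Prod.map (LinearIsometryEquiv.toSpanUnitSingleton (𝕜 := ℝ) e he)
      (id : (ℝ ∙ e)ᗮ → (ℝ ∙ e)ᗮ)) (volume.prod volume) (volume.prod volume) :=
    h2.prod (MeasurePreserving.id _)
  have h4 := (h1.comp h3).comp (Measure.measurePreserving_swap (μ := (volume : Measure (ℝ ∙ e)ᗮ))
    (ν := (volume : Measure ℝ)))
  have h5 : (fun q : (ℝ ∙ e)ᗮ × ℝ => (q.1 + q.2 • e : EuclideanSpace ℝ (Fin N)))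
      = (((ℝ ∙ e).measurableEquivProd (0 : EuclideanSpace ℝ (Fin N))).symm ∘
        Prod.map (LinearIsometryEquiv.toSpanUnitSingleton (𝕜 := ℝ) e he) id) ∘ Prod.swap := by
    funext q
    simp [add_comm]
  rw [h5]
  exact h4

/-- Cavalieri's principle for the translates of a graph. -/
theorem measurePreserving_boundaryGraph_sub (he : ‖e‖ = 1) (hρ : Continuous ρ) :
    MeasurePreserving (fun q : (ℝ ∙ e)ᗮ × ℝ => boundaryGraph e ρ q.1 - q.2 • e)
      (volume.prod volume) volume := by
  have h1 : MeasurePreserving (fun q : (ℝ ∙ e)ᗮ × ℝ => (q.1, ρ q.1 - q.2))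
      (volume.prod volume) (volume.prod volume) :=
    MeasurePreserving.skew_product (g := fun (z : (ℝ ∙ e)ᗮ) (s : ℝ) => ρ z - s)
      (MeasurePreserving.id _) (by unfold Function.uncurry; fun_prop)
      (ae_of_all _ fun z => (Measure.measurePreserving_sub_left volume (ρ z)).map_eq)
  convert (measurePreserving_add_smul he).comp h1 using 1
  ext1 q
  simp only [boundaryGraph, Function.comp, sub_smul]
  abel

theorem boundaryGraph_sub_smul (h : ∀ y t, ρ (y + t • e) = ρ y - t) (z : (ℝ ∙ e)ᗮ) (s : ℝ) :
    ρ (boundaryGraph e ρ z - s • e) = s := by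
  rw [sub_eq_add_neg, ← neg_smul, h, boundaryGraph, h]; ring

theorem exists_boundaryGraph_eq (he : ‖e‖ = 1) (h : ∀ y t, ρ (y + t • e) = ρ y - t)
    {y : EuclideanSpace ℝ (Fin N)} (hy : ρ y = 0) :
    ∃ z : (ℝ ∙ e)ᗮ, (z : EuclideanSpace ℝ (Fin N)) = y - ⟪e, y⟫ • e ∧ boundaryGraph e ρ z = y := by
  refine ⟨⟨y - ⟪e, y⟫ • e, ?_⟩, rfl, ?_⟩
  · rw [Submodule.mem_orthogonal_singleton_iff_inner_right, inner_sub_right, inner_smul_right,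
      real_inner_self_eq_norm_sq, he]
    ring
  · simp only [boundaryGraph]
    rw [sub_eq_add_neg, ← neg_smul, h, hy]
    module

theorem injective_boundaryGraph (he : ‖e‖ = 1) : Function.Injective (boundaryGraph e ρ) := by
  intro z z' hz
  have := norm_sub_le_norm_boundaryGraph_sub he z z' (ρ z) (ρ z')
  rw [show (z + ρ z • e : EuclideanSpace ℝ (Fin N)) = z' + ρ z' • e from hz, sub_self, norm_zero,
    norm_le_zero_iff, sub_eq_zero] at this
  exact this

theorem finrank_orthogonal_singleton (he : ‖e‖ = 1) : Module.finrank ℝ (ℝ ∙ e)ᗮ = N - 1 := by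
  have h := (ℝ ∙ e).finrank_add_finrank_orthogonal
  rw [finrank_euclideanSpace_fin, finrank_span_singleton (by
    intro h0; rw [h0, norm_zero] at he; norm_num at he)] at h
  omega

/-- The differential of the graph parametrization, when `A` is the differential of `ρ`. -/
noncomputable def graphTangent (e : EuclideanSpace ℝ (Fin N))
    (A : EuclideanSpace ℝ (Fin N) →L[ℝ] ℝ) : (ℝ ∙ e)ᗮ →L[ℝ] EuclideanSpace ℝ (Fin N) :=
  (ℝ ∙ e)ᗮ.subtypeL + (A.comp (ℝ ∙ e)ᗮ.subtypeL).smulRight e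

theorem inner_graphTangent (he : ‖e‖ = 1) (A : EuclideanSpace ℝ (Fin N) →L[ℝ] ℝ)
    (w w' : (ℝ ∙ e)ᗮ) : ⟪graphTangent e A w, graphTangent e A w'⟫ = ⟪w, w'⟫ + A w * A w' := by
  have h1 : ∀ w : (ℝ ∙ e)ᗮ, graphTangent e A w = w + A w • e := fun w => rfl
  have h2 : ⟪(w : EuclideanSpace ℝ (Fin N)), e⟫ = 0 := by
    rw [real_inner_comm]; exact inner_coe_orthogonal w
  have h3 : ⟪e, e⟫ = 1 := by rw [real_inner_self_eq_norm_sq, he, one_pow]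
  rw [h1, h1, Submodule.coe_inner]
  simp only [inner_add_left, inner_add_right, real_inner_smul_left, real_inner_smul_right,
    inner_coe_orthogonal, h2, h3]
  ring

theorem norm_le_norm_graphTangent (he : ‖e‖ = 1) (A : EuclideanSpace ℝ (Fin N) →L[ℝ] ℝ)
    (w : (ℝ ∙ e)ᗮ) : ‖w‖ ≤ ‖graphTangent e A w‖ := by
  refine le_of_sq_le_sq ?_ (norm_nonneg _)
  rw [← real_inner_self_eq_norm_sq, ← real_inner_self_eq_norm_sq, inner_graphTangent he]
  nlinarith [mul_self_nonneg (A w)]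

/-- The area element of a graph is the norm of the gradient of its defining function: the Gram
operator of the tangent map is a transvection. -/
theorem normDet_graphTangent (he : ‖e‖ = 1) (b : EuclideanSpace ℝ (Fin N)) (hb : ⟪b, e⟫ = -1) :
    (graphTangent e (innerSL ℝ b)).toLinearMap.normDet = ‖b‖ := by
  set b' : (ℝ ∙ e)ᗮ := ⟨b + e, by
    rw [Submodule.mem_orthogonal_singleton_iff_inner_right, inner_add_right, real_inner_comm, hb,
      real_inner_self_eq_norm_sq, he]; norm_num⟩ with hb'
  have hin : ∀ w : (ℝ ∙ e)ᗮ, ⟪b, (w : EuclideanSpace ℝ (Fin N))⟫ = ⟪b', w⟫ := by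
    intro w
    rw [Submodule.coe_inner, hb', inner_add_left, inner_coe_orthogonal, add_zero]
  have h1 := (graphTangent e (innerSL ℝ b)).normDet_sq
  have h2 : ((graphTangent e (innerSL ℝ b)).adjoint ∘L graphTangent e (innerSL ℝ b)).toLinearMap
      = LinearMap.transvection ((innerSL ℝ b').toLinearMap) b' := by
    refine LinearMap.ext fun w => ext_inner_right ℝ fun w' => ?_
    have : ((graphTangent e (innerSL ℝ b)).adjoint ∘L graphTangent e (innerSL ℝ b)) w
      = (graphTangent e (innerSL ℝ b)).adjoint (graphTangent e (innerSL ℝ b) w) := rfl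
    rw [ContinuousLinearMap.coe_coe, this, ContinuousLinearMap.adjoint_inner_left,
      inner_graphTangent he, LinearMap.transvection.apply, inner_add_left, inner_smul_left]
    simp [hin]
  have h3 : ‖b'‖ ^ 2 + 1 = ‖b‖ ^ 2 := by
    have : ‖b'‖ ^ 2 = ‖b + e‖ ^ 2 := rfl
    rw [this, norm_add_sq_real, hb, he]; ring
  have h4 : (graphTangent e (innerSL ℝ b)).toLinearMap.normDet ^ 2 = ‖b‖ ^ 2 := by
    refine (show _ = _ from h1).trans ?_
    rw [ContinuousLinearMap.det, h2, LinearMap.transvection.det]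
    simp only [ContinuousLinearMap.coe_coe, innerSL_apply_apply, real_inner_self_eq_norm_sq]
    linarith
  exact (pow_left_inj₀ (LinearMap.normDet_nonneg _) (norm_nonneg _) two_ne_zero).1 h4

end Graph

section Graph

variable {N : ℕ} {e : EuclideanSpace ℝ (Fin N)} {ρ : EuclideanSpace ℝ (Fin N) → ℝ}

theorem LipschitzOnWith.euclideanHausdorffMeasure_image_le {X Y : Type*} [EMetricSpace X]
    [EMetricSpace Y] [MeasurableSpace X] [BorelSpace X] [MeasurableSpace Y] [BorelSpace Y] {K : ℝ≥0}
    {f : X → Y} {s : Set X} (h : LipschitzOnWith K f s) (n : ℕ) :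
    μHE[n] (f '' s) ≤ (K : ℝ≥0∞) ^ n * μHE[n] s := by
  simp only [Measure.euclideanHausdorffMeasure_def, Measure.smul_apply, Measure.nnreal_smul_coe_apply]
  have h1 := h.hausdorffMeasure_image_le (d := n) (Nat.cast_nonneg n)
  rw [ENNReal.rpow_natCast] at h1
  calc _ ≤ _ := mul_le_mul_right h1 _
    _ = _ := mul_left_comm _ _ _

/-- Near `x₀` the graph parametrization is, up to a factor close to `1`, isometric to its
differential. -/
theorem exists_boundaryGraph_approx (he : ‖e‖ = 1) (hadd : ∀ y t, ρ (y + t • e) = ρ y - t)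
    (hρ : ContDiff ℝ 1 ρ) (x₀ : EuclideanSpace ℝ (Fin N)) {δ : ℝ} (hδ : 0 < δ) (hδ1 : δ ≤ 1 / 2) :
    ∃ r > 0, ∀ z z' : (ℝ ∙ e)ᗮ, boundaryGraph e ρ z ∈ Metric.ball x₀ r →
      boundaryGraph e ρ z' ∈ Metric.ball x₀ r →
      ‖boundaryGraph e ρ z - boundaryGraph e ρ z'‖
        ≤ (1 + 2 * δ) * ‖graphTangent e (fderiv ℝ ρ x₀) (z - z')‖ ∧
      ‖graphTangent e (fderiv ℝ ρ x₀) (z - z')‖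
        ≤ (1 + 2 * δ) * ‖boundaryGraph e ρ z - boundaryGraph e ρ z'‖ := by
  have hstrict := (hρ.contDiffAt (x := x₀)).hasStrictFDerivAt one_ne_zero
  have hlo := hstrict.isLittleO.def hδ
  rw [Metric.eventually_nhds_iff_ball] at hlo
  obtain ⟨r, hr, htlo⟩ := hlo
  rw [← ball_prod_same] at htlo
  refine ⟨r, hr, ?_⟩
  set τ := ⟪e, x₀⟫ with hτ
  set z₀ : (ℝ ∙ e)ᗮ := ⟨x₀ - τ • e, by
    rw [Submodule.mem_orthogonal_singleton_iff_inner_right, inner_sub_right, inner_smul_right,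
      real_inner_self_eq_norm_sq, he]
    simp [hτ]⟩ with hz₀
  have hx₀ : (z₀ : EuclideanSpace ℝ (Fin N)) + τ • e = x₀ := by simp [hz₀]
  have hmem : ∀ z : (ℝ ∙ e)ᗮ, boundaryGraph e ρ z ∈ Metric.ball x₀ r →
      (z + τ • e : EuclideanSpace ℝ (Fin N)) ∈ Metric.ball x₀ r := by
    intro z hz
    rw [Metric.mem_ball, dist_eq_norm] at hz ⊢
    have h1 := norm_sub_le_norm_boundaryGraph_sub he z z₀ (ρ z) τ
    rw [hx₀] at h1
    have h2 : (z + τ • e : EuclideanSpace ℝ (Fin N)) - x₀ = (z - z₀ : (ℝ ∙ e)ᗮ) := by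
      rw [← hx₀]; push_cast; abel
    rw [h2]
    exact lt_of_le_of_lt h1 hz
  intro z z' hz hz'
  have h1 := htlo (_, _) ⟨hmem z hz, hmem z' hz'⟩
  simp only [hadd] at h1
  set A := fderiv ℝ ρ x₀
  have h2 : (z + τ • e : EuclideanSpace ℝ (Fin N)) - (z' + τ • e) = (z - z' : (ℝ ∙ e)ᗮ) := by
    push_cast; abel
  rw [h2] at h1
  have h3 : boundaryGraph e ρ z - boundaryGraph e ρ z' = graphTangent e A (z - z')
      + (ρ z - τ - (ρ z' - τ) - A (z - z' : (ℝ ∙ e)ᗮ)) • e := by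
    have : graphTangent e A (z - z') = (z - z' : (ℝ ∙ e)ᗮ) + A (z - z' : (ℝ ∙ e)ᗮ) • e := rfl
    rw [this]
    simp only [boundaryGraph]
    push_cast
    module
  have h4 : ‖(ρ z - τ - (ρ z' - τ) - A (z - z' : (ℝ ∙ e)ᗮ)) • e‖
      ≤ δ * ‖graphTangent e A (z - z')‖ := by
    rw [norm_smul, he, mul_one]
    exact h1.trans (mul_le_mul_of_nonneg_left (norm_le_norm_graphTangent he A (z - z')) hδ.le)
  constructor
  · rw [h3]
    refine (norm_add_le _ _).trans ?_
    nlinarith [norm_nonneg (graphTangent e A (z - z'))]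
  · have h5 : graphTangent e A (z - z') = (boundaryGraph e ρ z - boundaryGraph e ρ z')
      - (ρ z - τ - (ρ z' - τ) - A (z - z' : (ℝ ∙ e)ᗮ)) • e := by rw [h3]; abel
    have h6 : ‖graphTangent e A (z - z')‖ ≤ ‖boundaryGraph e ρ z - boundaryGraph e ρ z'‖
      + δ * ‖graphTangent e A (z - z')‖ := by
      conv_lhs => rw [h5]
      exact (norm_sub_le _ _).trans (by linarith)
    set a := ‖graphTangent e A (z - z')‖
    set b := ‖boundaryGraph e ρ z - boundaryGraph e ρ z'‖
    have ha : 0 ≤ a := norm_nonneg _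
    -- `(1 - δ) a ≤ b` and `(1 + 2 δ) (1 - δ) ≥ 1` for `δ ≤ 1 / 2`
    nlinarith [mul_nonneg hδ.le ha, mul_nonneg (mul_nonneg hδ.le ha) (sub_nonneg.2 hδ1)]

/-- Near a point, the surface measure of a `C¹` graph is comparable, with constants close to `1`, to
the Lebesgue measure of the parameters times the norm of the gradient at that point. -/
theorem exists_surfaceMeasure_bounds (he : ‖e‖ = 1) (hadd : ∀ y t, ρ (y + t • e) = ρ y - t)
    (hρ : ContDiff ℝ 1 ρ) (x₀ : EuclideanSpace ℝ (Fin N)) {η : ℝ} (hη : 0 < η) :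
    ∃ r > 0, ∀ S ⊆ Metric.ball x₀ r ∩ {y | ρ y = 0},
      μHE[N - 1] S ≤ ENNReal.ofReal (1 + η) *
        (ENNReal.ofReal ‖∇ ρ x₀‖ * volume (boundaryGraph e ρ ⁻¹' S)) ∧
      ENNReal.ofReal ‖∇ ρ x₀‖ * volume (boundaryGraph e ρ ⁻¹' S)
        ≤ ENNReal.ofReal (1 + η) * μHE[N - 1] S := by
  obtain ⟨δ, hδ0, hδ1, hδη⟩ : ∃ δ : ℝ, 0 < δ ∧ δ ≤ 1 / 2 ∧ (1 + 2 * δ) ^ (N - 1) ≤ 1 + η := by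
    have h1 : Tendsto (fun δ : ℝ => (1 + 2 * δ) ^ (N - 1)) (𝓝[>] 0) (𝓝 ((1 + 2 * 0) ^ (N - 1))) :=
      (Continuous.tendsto (by fun_prop) 0).mono_left nhdsWithin_le_nhds
    have h2 : ((1 : ℝ) + 2 * 0) ^ (N - 1) < 1 + η := by simpa using hη
    have h3 : ∀ᶠ δ : ℝ in 𝓝[>] 0, δ ≤ 1 / 2 :=
      (eventually_le_nhds (by norm_num)).filter_mono nhdsWithin_le_nhds
    obtain ⟨δ, h⟩ := ((h1.eventually (gt_mem_nhds h2)).and (h3.and self_mem_nhdsWithin)).exists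
    exact ⟨δ, h.2.2, h.2.1, h.1.le⟩
  obtain ⟨r, hr, happ⟩ := exists_boundaryGraph_approx he hadd hρ x₀ hδ0 hδ1
  refine ⟨r, hr, fun S hS => ?_⟩
  set Φ := boundaryGraph e ρ with hΦ
  set L := graphTangent e (fderiv ℝ ρ x₀) with hL
  set A := Φ ⁻¹' S with hA
  set K : ℝ≥0 := ⟨1 + 2 * δ, by positivity⟩ with hK
  have hKle : (K : ℝ≥0∞) ^ (N - 1) ≤ ENNReal.ofReal (1 + η) := by
    rw [← ENNReal.ofReal_coe_nnreal, ← ENNReal.ofReal_pow K.coe_nonneg]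
    exact ENNReal.ofReal_le_ofReal hδη
  have hΦA : Φ '' A = S := by
    refine image_preimage_eq_of_subset fun y hy => ?_
    obtain ⟨z, -, hz⟩ := exists_boundaryGraph_eq he hadd (hS hy).2
    exact ⟨z, hz⟩
  have hΦi : Function.Injective Φ := injective_boundaryGraph he
  have hLi : Function.Injective L := by
    refine (injective_iff_map_eq_zero L).2 fun w hw => ?_
    have := norm_le_norm_graphTangent he (fderiv ℝ ρ x₀) w
    rw [← hL, hw, norm_zero] at this
    exact norm_le_zero_iff.1 this
  have hAb : ∀ z ∈ A, Φ z ∈ Metric.ball x₀ r := fun z hz => (hS hz).1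
  have hvol : μHE[N - 1] (L '' A) = ENNReal.ofReal ‖∇ ρ x₀‖ * volume A := by
    have h1 := L.toLinearMap.euclideanHausdorffMeasure_image_eq_normDet_mul_volume A
    rw [finrank_orthogonal_singleton he] at h1
    have h2 : fderiv ℝ ρ x₀ = innerSL ℝ (∇ ρ x₀) := by
      ext w
      rw [innerSL_apply_apply, inner_gradient]
    have h3 : L.toLinearMap.normDet = ‖∇ ρ x₀‖ := by
      rw [hL, h2]
      refine normDet_graphTangent he _ ?_
      rw [inner_gradient]
      have h4 : HasDerivAt (fun t : ℝ => ρ (x₀ + t • e)) (fderiv ℝ ρ x₀ e) 0 :=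
        ((hρ.differentiable one_ne_zero).differentiableAt.hasFDerivAt.hasLineDerivAt e)
      have h5 : HasDerivAt (fun t : ℝ => ρ (x₀ + t • e)) (-1) 0 := by
        simp only [hadd]
        simpa using (hasDerivAt_id (0 : ℝ)).const_sub (ρ x₀)
      exact h4.unique h5
    rw [h3] at h1
    exact h1
  rw [← hvol]
  constructor
  · have hlip : LipschitzOnWith K (Φ ∘ Function.invFun L) (L '' A) := by
      refine LipschitzOnWith.of_dist_le_mul ?_
      rintro _ ⟨z, hz, rfl⟩ _ ⟨z', hz', rfl⟩
      simp only [Function.comp, Function.leftInverse_invFun hLi _]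
      rw [dist_eq_norm, dist_eq_norm, ← map_sub]
      exact (happ z z' (hAb z hz) (hAb z' hz')).1
    have h1 := LipschitzOnWith.euclideanHausdorffMeasure_image_le hlip (N - 1)
    have h2 : (Φ ∘ Function.invFun L) '' (L '' A) = S := by
      rw [← hΦA, image_image]
      simp only [Function.comp, Function.leftInverse_invFun hLi _]
    rw [h2] at h1
    exact h1.trans (mul_le_mul_left hKle _)
  · have hlip : LipschitzOnWith K (L ∘ Function.invFun Φ) S := by
      rw [← hΦA]
      refine LipschitzOnWith.of_dist_le_mul ?_
      rintro _ ⟨z, hz, rfl⟩ _ ⟨z', hz', rfl⟩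
      simp only [Function.comp, Function.leftInverse_invFun hΦi _]
      rw [dist_eq_norm, dist_eq_norm, ← map_sub]
      exact (happ z z' (hAb z hz) (hAb z' hz')).2
    have h1 := LipschitzOnWith.euclideanHausdorffMeasure_image_le hlip (N - 1)
    have h2 : (L ∘ Function.invFun Φ) '' S = L '' A := by
      rw [← hΦA, image_image]
      simp only [Function.comp, Function.leftInverse_invFun hΦi _]
    rw [h2] at h1
    exact h1.trans (mul_le_mul_left hKle _)

end Graph

section Graph

variable {N : ℕ} {e : EuclideanSpace ℝ (Fin N)} {ρ : EuclideanSpace ℝ (Fin N) → ℝ}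

theorem norm_le_norm_add_smul (he : ‖e‖ = 1) (z : (ℝ ∙ e)ᗮ) (s : ℝ) :
    ‖z‖ ≤ ‖(z + s • e : EuclideanSpace ℝ (Fin N))‖ := by
  simpa using norm_sub_le_norm_boundaryGraph_sub he z 0 s 0

/-- The form for integrals of `exists_surfaceMeasure_bounds`. -/
theorem exists_surfaceIntegral_bounds (he : ‖e‖ = 1) (hadd : ∀ y t, ρ (y + t • e) = ρ y - t)
    (hρ : ContDiff ℝ 1 ρ) (x₀ : EuclideanSpace ℝ (Fin N)) {η : ℝ} (hη : 0 < η) :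
    ∃ r > 0, ∀ (f : EuclideanSpace ℝ (Fin N) → ℝ) (C : ℝ), Measurable f → (∀ y, 0 ≤ f y) →
      (∀ y, f y ≤ C) → (∀ y ∉ Metric.ball x₀ r, f y = 0) →
      IntegrableOn f (Metric.ball x₀ r ∩ {y | ρ y = 0}) μHE[N - 1] ∧
      ∫ y in Metric.ball x₀ r ∩ {y | ρ y = 0}, f y ∂μHE[N - 1]
        ≤ (1 + η) * (‖∇ ρ x₀‖ * ∫ z, f (boundaryGraph e ρ z)) ∧
      ‖∇ ρ x₀‖ * ∫ z, f (boundaryGraph e ρ z)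
        ≤ (1 + η) * ∫ y in Metric.ball x₀ r ∩ {y | ρ y = 0}, f y ∂μHE[N - 1] := by
  obtain ⟨r, hr, hbd⟩ := exists_surfaceMeasure_bounds he hadd hρ x₀ hη
  refine ⟨r, hr, fun f C hfm hf0 hfC hfs => ?_⟩
  set B : Set (EuclideanSpace ℝ (Fin N)) := Metric.ball x₀ r ∩ {y | ρ y = 0} with hB
  have hBm : MeasurableSet B :=
    measurableSet_ball.inter (isClosed_eq hρ.continuous continuous_const).measurableSet
  have hΦm : Measurable (boundaryGraph e ρ) := (continuous_boundaryGraph hρ.continuous).measurable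
  set ν : Measure (EuclideanSpace ℝ (Fin N)) :=
    (Measure.map (boundaryGraph e ρ) volume).restrict B with hν
  set μ : Measure (EuclideanSpace ℝ (Fin N)) := (μHE[N - 1]).restrict B with hμ
  set a := ENNReal.ofReal ‖∇ ρ x₀‖ with ha
  set b := ENNReal.ofReal (1 + η) with hb
  have hνS : ∀ S, MeasurableSet S → ν S = volume (boundaryGraph e ρ ⁻¹' (S ∩ B)) := by
    intro S hS
    rw [hν, Measure.restrict_apply hS, Measure.map_apply hΦm (hS.inter hBm)]
  have h1 : μ ≤ (b * a) • ν := by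
    refine Measure.le_iff.2 fun S hS => ?_
    rw [hμ, Measure.restrict_apply hS, Measure.smul_apply, hνS S hS, smul_eq_mul, mul_assoc]
    exact (hbd _ inter_subset_right).1
  have h2 : a • ν ≤ b • μ := by
    refine Measure.le_iff.2 fun S hS => ?_
    rw [Measure.smul_apply, Measure.smul_apply, hνS S hS, hμ, Measure.restrict_apply hS,
      smul_eq_mul, smul_eq_mul]
    exact (hbd _ inter_subset_right).2
  have hνfin : IsFiniteMeasure ν := by
    refine ⟨?_⟩
    rw [hνS _ MeasurableSet.univ]
    refine lt_of_le_of_lt (measure_mono (t := Metric.closedBall 0 (‖x₀‖ + r)) fun z hz => ?_)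
      measure_closedBall_lt_top
    have hz' : ‖boundaryGraph e ρ z - x₀‖ < r := by
      have := hz.2.1
      rwa [Metric.mem_ball, dist_eq_norm] at this
    rw [mem_closedBall_zero_iff]
    have h3 : ‖z‖ ≤ ‖boundaryGraph e ρ z‖ := norm_le_norm_add_smul he z _
    have h4 := norm_sub_norm_le (boundaryGraph e ρ z) x₀
    linarith
  have hfν : Integrable f ν :=
    Integrable.of_bound hfm.aestronglyMeasurable C (Eventually.of_forall fun y => by
      rw [Real.norm_of_nonneg (hf0 y)]; exact hfC y)
  have hba : b * a ≠ ⊤ := ENNReal.mul_ne_top ENNReal.ofReal_ne_top ENNReal.ofReal_ne_top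
  have hfμ : Integrable f μ := Integrable.of_measure_le_smul hba h1 hfν
  have hae : ∀ m : Measure (EuclideanSpace ℝ (Fin N)), 0 ≤ᵐ[m] f :=
    fun m => Eventually.of_forall hf0
  have hJ : ∫ y, f y ∂ν = ∫ z, f (boundaryGraph e ρ z) := by
    rw [hν, ← integral_indicator hBm, integral_map hΦm.aemeasurable
      (hfm.indicator hBm).aestronglyMeasurable]
    refine integral_congr_ae (Eventually.of_forall fun z => ?_)
    by_cases hz : boundaryGraph e ρ z ∈ B
    · simp only [indicator_of_mem hz]
    · simp only [indicator_of_notMem hz]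
      refine (hfs _ fun hzb => hz ⟨hzb, ?_⟩).symm
      have := boundaryGraph_sub_smul hadd z 0
      simpa using this
  refine ⟨hfμ, ?_, ?_⟩
  · have h3 := integral_mono_measure h1 (hae _) (hfν.smul_measure hba)
    rw [integral_smul_measure, hJ, ENNReal.toReal_mul, ENNReal.toReal_ofReal (by positivity),
      ENNReal.toReal_ofReal (norm_nonneg _), smul_eq_mul, mul_assoc] at h3
    exact h3
  · have h3 := integral_mono_measure h2 (hae _) (hfμ.smul_measure ENNReal.ofReal_ne_top)
    rw [integral_smul_measure, integral_smul_measure, hJ, ENNReal.toReal_ofReal (norm_nonneg _),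
      ENNReal.toReal_ofReal (by positivity)] at h3
    exact h3

/-- Integrals over the translates of a graph converge to the integral over the graph. -/
theorem tendsto_integral_boundaryGraph_sub (he : ‖e‖ = 1) (hρ : Continuous ρ)
    {x₀ : EuclideanSpace ℝ (Fin N)} {r C : ℝ} {f : EuclideanSpace ℝ (Fin N) → ℝ}
    (hfm : Measurable f) (hfC : ∀ y, |f y| ≤ C) (hfs : ∀ y ∉ Metric.ball x₀ r, f y = 0)
    (hlim : ∀ z, Tendsto (fun s : ℝ => f (boundaryGraph e ρ z - s • e)) (𝓝[>] 0)
      (𝓝 (f (boundaryGraph e ρ z)))) :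
    Tendsto (fun s : ℝ => ∫ z, f (boundaryGraph e ρ z - s • e)) (𝓝[>] 0)
      (𝓝 (∫ z, f (boundaryGraph e ρ z))) := by
  have hΦ : Measurable (boundaryGraph e ρ) := (continuous_boundaryGraph hρ).measurable
  refine tendsto_integral_filter_of_dominated_convergence
    ((Metric.closedBall (0 : (ℝ ∙ e)ᗮ) (‖x₀‖ + r)).indicator fun _ => C)
    (Eventually.of_forall fun s => (hfm.comp (hΦ.sub_const _)).aestronglyMeasurable)
    (Eventually.of_forall fun s => Eventually.of_forall fun z => ?_) ?_
    (Eventually.of_forall hlim)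
  · have hC : 0 ≤ C := (abs_nonneg _).trans (hfC 0)
    by_cases hz : boundaryGraph e ρ z - s • e ∈ Metric.ball x₀ r
    · rw [indicator_of_mem]
      · exact hfC _
      · rw [mem_closedBall_zero_iff]
        have h1 := norm_le_norm_add_smul he z (ρ z - s)
        have h2 : (z + (ρ z - s) • e : EuclideanSpace ℝ (Fin N)) = boundaryGraph e ρ z - s • e := by
          simp only [boundaryGraph]; module
        rw [h2] at h1
        rw [Metric.mem_ball, dist_eq_norm] at hz
        have := norm_sub_norm_le (boundaryGraph e ρ z - s • e) x₀
        linarith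
    · rw [hfs _ hz, norm_zero]
      exact indicator_nonneg (fun _ _ => hC) _
  · exact (integrable_indicator_iff measurableSet_closedBall).2
      (integrableOn_const measure_closedBall_lt_top.ne)

/-- A kernel of mass one in the variable `ρ`, concentrated where `0 < ρ < a`, averages the integrals
over the translates of the graph. -/
theorem abs_integral_kernel_sub_le (he : ‖e‖ = 1) (hρ : Continuous ρ)
    (hadd : ∀ y t, ρ (y + t • e) = ρ y - t) {f : EuclideanSpace ℝ (Fin N) → ℝ} (hf : Integrable f)
    {k : ℝ → ℝ} (hkc : Continuous k) (hk0 : ∀ s, 0 ≤ k s) {a M : ℝ} (hkM : ∀ s, k s ≤ M)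
    (hks : ∀ s, k s ≠ 0 → s ∈ Ioo 0 a) (hk1 : ∫ s, k s = 1) {J δ : ℝ}
    (hJ : ∀ s ∈ Ioo 0 a, |(∫ z, f (boundaryGraph e ρ z - s • e)) - J| ≤ δ) :
    |(∫ y, f y * k (ρ y)) - J| ≤ δ := by
  have hmp := measurePreserving_boundaryGraph_sub he hρ
  have hfk : Integrable (fun y => f y * k (ρ y)) :=
    Integrable.mul_bdd (c := M) hf (hkc.comp hρ).aestronglyMeasurable
      (Eventually.of_forall fun y => by rw [Real.norm_of_nonneg (hk0 _)]; exact hkM _)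
  have hki : Integrable k := by
    by_contra hn
    rw [integral_undef hn] at hk1
    norm_num at hk1
  have h1 : Integrable (fun q : (ℝ ∙ e)ᗮ × ℝ => f (boundaryGraph e ρ q.1 - q.2 • e) * k q.2)
      (volume.prod volume) := by
    have := (hmp.integrable_comp hfk.aestronglyMeasurable).2 hfk
    refine this.congr (Eventually.of_forall fun q => ?_)
    simp only [Function.comp, boundaryGraph_sub_smul hadd]
  have h2 : ∫ y, f y * k (ρ y) = ∫ s, (∫ z, f (boundaryGraph e ρ z - s • e)) * k s := by
    rw [← hmp.map_eq, integral_map hmp.measurable.aemeasurable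
      (by rw [hmp.map_eq]; exact hfk.aestronglyMeasurable)]
    simp only [boundaryGraph_sub_smul hadd]
    rw [integral_prod_symm _ h1]
    simp only [integral_mul_const]
  have h3 : Integrable (fun s => (∫ z, f (boundaryGraph e ρ z - s • e)) * k s) := by
    have := h1.integral_prod_right
    simpa only [integral_mul_const] using this
  have h4 : (∫ y, f y * k (ρ y)) - J
      = ∫ s, ((∫ z, f (boundaryGraph e ρ z - s • e)) * k s - J * k s) := by
    rw [integral_sub h3 (hki.const_mul J), integral_const_mul, hk1, mul_one, h2]
  rw [h4, ← Real.norm_eq_abs]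
  refine (norm_integral_le_of_norm_le (hki.const_mul δ) (Eventually.of_forall fun s => ?_)).trans
    (by rw [integral_const_mul, hk1, mul_one])
  by_cases hs : k s = 0
  · simp [hs]
  · rw [← sub_mul, norm_mul, Real.norm_of_nonneg (hk0 s)]
    exact mul_le_mul_of_nonneg_right (hJ s (hks s hs)) (hk0 s)

end Graph

/-! ### Integrating by parts up to the boundary -/

/-- A smooth cutoff of the half line `s > 0` at scale `a`, whose derivative is a kernel of mass one
on `(0, 3a)`. -/
theorem exists_cutoff {a : ℝ} (ha : 0 < a) : ∃ θ : ℝ → ℝ, ContDiff ℝ 1 θ ∧ (∀ s, 0 ≤ θ s) ∧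
    (∀ s, θ s ≤ 1) ∧ (∀ s < a, θ s = 0) ∧ (∀ s, 2 * a ≤ s → θ s = 1) ∧ (∀ s, 0 ≤ deriv θ s) ∧
    (∀ s, deriv θ s ≠ 0 → s ∈ Ioo 0 (3 * a)) ∧ ∫ s, deriv θ s = 1 := by
  set θ : ℝ → ℝ := fun s => Real.smoothTransition (s / a - 1) with hθ
  have hc : ContDiff ℝ 1 θ :=
    Real.smoothTransition.contDiff.comp ((contDiff_id.div_const a).sub contDiff_const)
  have h0 : ∀ s ≤ a, θ s = 0 := fun s hs => Real.smoothTransition.zero_of_nonpos (by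
    have := (div_le_one ha).2 hs
    linarith)
  have h1 : ∀ s, 2 * a ≤ s → θ s = 1 := fun s hs => Real.smoothTransition.one_of_one_le (by
    have := (le_div_iff₀ ha).2 hs
    linarith)
  have hm : Monotone θ := fun s t hst => Real.smoothTransition.monotone (by
    have := div_le_div_of_nonneg_right hst ha.le
    linarith)
  have hs : ∀ s, deriv θ s ≠ 0 → s ∈ Ioo 0 (3 * a) := by
    intro s hs
    by_contra hn
    rw [mem_Ioo, not_and_or, not_lt, not_lt] at hn
    refine hs ?_
    rcases hn with hn | hn
    · have : θ =ᶠ[𝓝 s] fun _ => 0 := by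
        filter_upwards [Iic_mem_nhds (show s < a by linarith)] with t ht using h0 t ht
      rw [this.deriv_eq, deriv_const]
    · have : θ =ᶠ[𝓝 s] fun _ => 1 := by
        filter_upwards [Ici_mem_nhds (show 2 * a < s by linarith)] with t ht using h1 t ht
      rw [this.deriv_eq, deriv_const]
  refine ⟨θ, hc, fun s => Real.smoothTransition.nonneg _, fun s => Real.smoothTransition.le_one _,
    fun s hs => h0 s hs.le, h1, fun s => hm.deriv_nonneg, hs, ?_⟩
  have h3 : ∫ s in (0 : ℝ)..(3 * a), deriv θ s = ∫ s, deriv θ s :=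
    intervalIntegral.integral_eq_integral_of_support_subset
      fun s h => Ioo_subset_Ioc_self (hs s h)
  rw [← h3, intervalIntegral.integral_deriv_eq_sub' θ rfl
    (fun x _ => hc.differentiable one_ne_zero x) (hc.continuous_deriv le_rfl).continuousOn,
    h1 _ (by linarith), h0 _ ha.le, sub_zero]

namespace IsBumpTest

variable {N : ℕ} {Ω : Set (EuclideanSpace ℝ (Fin N))} {x₀ : EuclideanSpace ℝ (Fin N)} {r : ℝ}
  {v : EuclideanSpace ℝ (Fin N) → ℝ} {V : EuclideanSpace ℝ (Fin N) → EuclideanSpace ℝ (Fin N)}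

theorem measurable_indicator (h : IsBumpTest Ω x₀ r v V) : Measurable ((closure Ω).indicator v) := by
  classical
  rw [← piecewise_eq_indicator]
  exact h.continuousOn.measurable_piecewise continuousOn_const isClosed_closure.measurableSet

theorem indicator_eq_zero (h : IsBumpTest Ω x₀ r v V) :
    ∀ y ∉ Metric.ball x₀ r, (closure Ω).indicator v y = 0 := by
  intro y hy
  by_cases hc : y ∈ closure Ω
  · rw [indicator_of_mem hc, h.eq_zero y hc hy]
  · exact indicator_of_notMem hc v

theorem exists_indicator_le (h : IsBumpTest Ω x₀ r v V) (hΩb : Bornology.IsBounded Ω) :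
    ∃ C, ∀ y, |(closure Ω).indicator v y| ≤ C := by
  obtain ⟨C, hC⟩ := hΩb.isCompact_closure.exists_bound_of_continuousOn h.continuousOn
  refine ⟨max C 0, fun y => ?_⟩
  by_cases hc : y ∈ closure Ω
  · rw [indicator_of_mem hc]
    exact (hC y hc).trans (le_max_left _ _)
  · rw [indicator_of_notMem hc, abs_zero]
    exact le_max_right _ _

theorem integrable_indicator (h : IsBumpTest Ω x₀ r v V) (hΩb : Bornology.IsBounded Ω) :
    Integrable ((closure Ω).indicator v) :=
  (integrable_indicator_iff isClosed_closure.measurableSet).2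
    (h.continuousOn.integrableOn_compact hΩb.isCompact_closure)

/-- If the flux of `F` through the level sets of `ρ` is at most `s` near `x₀`, the boundary term in
the integration by parts of `⟪F, V⟫` is at most `s` times the integral of `v` over the boundary
graph. -/
theorem integral_inner_le_of_flux (h : IsBumpTest Ω x₀ r v V) (hΩ : IsOpen Ω)
    (hΩb : Bornology.IsBounded Ω) (hr : 0 < r) {R : ℝ} (hrR : r < R)
    {e : EuclideanSpace ℝ (Fin N)} {ρ : EuclideanSpace ℝ (Fin N) → ℝ} (he : ‖e‖ = 1)
    (hadd : ∀ y t, ρ (y + t • e) = ρ y - t) (hρ : ContDiff ℝ 1 ρ)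
    (hmem : ∀ y ∈ Metric.ball x₀ R, (y ∈ Ω ↔ 0 < ρ y))
    (hcl : ∀ y ∈ Metric.ball x₀ R, (y ∈ closure Ω ↔ 0 ≤ ρ y))
    {F : EuclideanSpace ℝ (Fin N) → EuclideanSpace ℝ (Fin N)}
    (hF : ContDiffOn ℝ 1 F (Ω ∩ Metric.ball x₀ R)) {c C C' s : ℝ}
    (hFc : ∀ y ∈ Ω ∩ Metric.ball x₀ R, c ≤ divergence F y ∧ divergence F y ≤ C)
    (hFb : ∀ y ∈ Ω ∩ Metric.ball x₀ R, ‖F y‖ ≤ C')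
    (hflux : ∀ y ∈ Ω ∩ Metric.ball x₀ R, -fderiv ℝ ρ y (F y) ≤ s) :
    ∫ x in Ω, ⟪F x, V x⟫ ≤
      -(c * ∫ x in Ω, v x) + s * ∫ z, (closure Ω).indicator v (boundaryGraph e ρ z) := by
  set f := (closure Ω).indicator v with hf
  set J := ∫ z, f (boundaryGraph e ρ z) with hJ
  set W : Set (EuclideanSpace ℝ (Fin N)) := Ω ∩ Metric.ball x₀ R with hW
  set T : Set (EuclideanSpace ℝ (Fin N)) := Ω ∩ Metric.ball x₀ r with hT
  have hWo : IsOpen W := hΩ.inter Metric.isOpen_ball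
  have hTo : IsOpen T := hΩ.inter Metric.isOpen_ball
  have hTΩ : T ⊆ Ω := inter_subset_left
  have hTW : T ⊆ W := inter_subset_inter_right _ (Metric.ball_subset_ball hrR.le)
  have hrb : Metric.closedBall x₀ r ⊆ Metric.ball x₀ R := Metric.closedBall_subset_ball hrR
  obtain ⟨R₁, hrR₁, hR₁R⟩ := exists_between hrR
  have hR₁b : Metric.closedBall x₀ R₁ ⊆ Metric.ball x₀ R := Metric.closedBall_subset_ball hR₁R
  obtain ⟨Cf, hCf⟩ := h.exists_indicator_le hΩb
  have hfi := h.integrable_indicator hΩb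
  have hdc := continuousOn_divergence hWo hF
  have iF : IntegrableOn (fun x => ⟪F x, V x⟫) T :=
    h.integrableOn_inner hTo hTΩ (hF.continuousOn.mono hTW) fun x hx => hFb x (hTW hx)
  have iv : IntegrableOn v T := (h.integrableOn_self hΩb).mono_set hTΩ
  -- continuity of the integrals over translates of the graph
  have hlimJ : Tendsto (fun t : ℝ => ∫ z, f (boundaryGraph e ρ z - t • e)) (𝓝[>] 0) (𝓝 J) := by
    refine tendsto_integral_boundaryGraph_sub he hρ.continuous h.measurable_indicator hCf
      h.indicator_eq_zero fun z => ?_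
    set y := boundaryGraph e ρ z with hy
    have hρy : ρ y = 0 := by
      have := boundaryGraph_sub_smul hadd z 0
      simpa using this
    have hline : Tendsto (fun t : ℝ => y - t • e) (𝓝[>] 0) (𝓝 y) := by
      have : Tendsto (fun t : ℝ => y - t • e) (𝓝 0) (𝓝 (y - (0 : ℝ) • e)) :=
        Continuous.tendsto (by fun_prop) 0
      simpa using this.mono_left nhdsWithin_le_nhds
    by_cases hyr : y ∈ Metric.closedBall x₀ r
    · have hyR := hrb hyr
      have hycl : y ∈ closure Ω := (hcl y hyR).2 hρy.ge
      have hev : ∀ᶠ t in 𝓝[>] (0 : ℝ), y - t • e ∈ closure Ω := by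
        filter_upwards [hline.eventually (Metric.isOpen_ball.mem_nhds hyR), self_mem_nhdsWithin]
          with t ht ht0
        rw [hcl _ ht, hy, boundaryGraph_sub_smul hadd]
        exact le_of_lt ht0
      have h1 : Tendsto (fun t : ℝ => v (y - t • e)) (𝓝[>] 0) (𝓝 (v y)) :=
        (h.continuousOn y hycl).tendsto.comp (tendsto_nhdsWithin_iff.2 ⟨hline, hev⟩)
      rw [hf, indicator_of_mem hycl]
      refine h1.congr' ?_
      filter_upwards [hev] with t ht
      rw [indicator_of_mem ht]
    · have hopen : (Metric.closedBall x₀ r)ᶜ ∈ 𝓝 y :=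
        Metric.isClosed_closedBall.isOpen_compl.mem_nhds hyr
      have h0 : ∀ w ∈ (Metric.closedBall x₀ r)ᶜ, f w = 0 := fun w hw =>
        h.indicator_eq_zero w fun hb => hw (Metric.ball_subset_closedBall hb)
      rw [h0 y hyr]
      refine tendsto_const_nhds.congr' ?_
      filter_upwards [hline.eventually hopen] with t ht
      exact (h0 _ ht).symm
  set ε : ℕ → ℝ := fun n => 1 / ((n : ℝ) + 1) with hε
  have hε0 : ∀ n, 0 < ε n := fun n => by positivity
  have hεlim : Tendsto ε atTop (𝓝 0) := tendsto_one_div_add_atTop_nhds_zero_nat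
  choose θ hθc hθ0 hθ1 hθz hθo hθd hθs hθi using fun n => exists_cutoff (hε0 n)
  have hkc : ∀ n, Continuous (deriv (θ n)) := fun n => (hθc n).continuous_deriv le_rfl
  have hkM : ∀ n, ∃ M, ∀ t, deriv (θ n) t ≤ M := by
    intro n
    obtain ⟨M, hM⟩ := (isCompact_Icc (a := (0 : ℝ)) (b := 3 * ε n)).exists_bound_of_continuousOn
      (hkc n).continuousOn
    refine ⟨max M 0, fun t => ?_⟩
    by_cases ht : deriv (θ n) t = 0
    · rw [ht]; exact le_max_right _ _
    · exact ((le_abs_self _).trans (hM t (Ioo_subset_Icc_self (hθs n t ht)))).trans (le_max_left _ _)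
  have hlimK : Tendsto (fun n => ∫ y, f y * deriv (θ n) (ρ y)) atTop (𝓝 J) := by
    rw [Metric.tendsto_atTop']
    intro δ hδ
    have h1 := Metric.tendsto_nhds.1 hlimJ (δ / 2) (half_pos hδ)
    obtain ⟨a, ha, hball⟩ := mem_nhdsGT_iff_exists_Ioo_subset.1 h1
    have h2 : ∀ᶠ n in atTop, ε n < a / 3 := hεlim.eventually (gt_mem_nhds (by
      have : (0 : ℝ) < a := ha
      linarith))
    obtain ⟨n₀, hn₀⟩ := eventually_atTop.1 h2
    refine ⟨n₀, fun n hn => ?_⟩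
    obtain ⟨M, hM⟩ := hkM n
    rw [Real.dist_eq]
    refine lt_of_le_of_lt (abs_integral_kernel_sub_le he hρ.continuous hadd hfi (hkc n) (hθd n) hM
      (hθs n) (hθi n) (J := J) (δ := δ / 2) fun t ht => ?_) (half_lt_self hδ)
    have h3 : t ∈ Ioo 0 a := ⟨ht.1, by have := hn₀ n hn.le; linarith [ht.2]⟩
    have h4 : dist (∫ z, f (boundaryGraph e ρ z - t • e)) J < δ / 2 := hball h3
    rw [Real.dist_eq] at h4
    exact h4.le
  -- the integration by parts with a cutoff near the boundary
  set ζ : ℕ → EuclideanSpace ℝ (Fin N) → ℝ := fun n y => θ n (ρ y) with hζ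
  have hζc : ∀ n, ContDiff ℝ 1 (ζ n) := fun n => (hθc n).comp hρ
  have hζt : ∀ n, tsupport (ζ n) ⊆ {y | ε n ≤ ρ y} := by
    intro n
    refine closure_minimal (fun y hy => ?_) (isClosed_le continuous_const hρ.continuous)
    by_contra hlt
    rw [mem_ofPred_eq, not_le] at hlt
    exact hy (hθz n _ hlt)
  have hζd : ∀ n y, fderiv ℝ (ζ n) y (F y) = deriv (θ n) (ρ y) * fderiv ℝ ρ y (F y) := by
    intro n y
    have h1 : HasFDerivAt ρ (fderiv ℝ ρ y) y := (hρ.differentiable one_ne_zero y).hasFDerivAt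
    have h2 : HasDerivAt (θ n) (deriv (θ n) (ρ y)) (ρ y) :=
      ((hθc n).differentiable one_ne_zero _).hasDerivAt
    have h3 : HasFDerivAt (ζ n) (deriv (θ n) (ρ y) • fderiv ℝ ρ y) y :=
      HasDerivAt.comp_hasFDerivAt (h₂ := θ n) y h2 h1
    rw [h3.fderiv]
    simp only [FunLike.coe_smul, Pi.smul_apply, smul_eq_mul]
  have hsubT : ∀ (u : EuclideanSpace ℝ (Fin N) → ℝ), (∀ x ∈ Ω, x ∉ Metric.ball x₀ r → u x = 0) →
      ∫ x in Ω, u x = ∫ x in T, u x := fun u hu =>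
    setIntegral_eq_of_subset_of_forall_sdiff_eq_zero hΩ.measurableSet hTΩ
      fun x hx => hu x hx.1 fun hb => hx.2 ⟨hx.1, hb⟩
  have hker : ∀ n, ∫ x in T, v x * deriv (θ n) (ρ x) = ∫ y, f y * deriv (θ n) (ρ y) := by
    intro n
    rw [← setIntegral_univ (f := fun y => f y * deriv (θ n) (ρ y)),
      setIntegral_eq_of_subset_of_forall_sdiff_eq_zero MeasurableSet.univ (subset_univ T)]
    · refine setIntegral_congr_fun hTo.measurableSet fun x hx => ?_
      simp only [hf, indicator_of_mem (subset_closure (hTΩ hx))]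
    · rintro x ⟨-, hx⟩
      by_cases hxr : x ∈ Metric.ball x₀ r
      · have hxR := hrb (Metric.ball_subset_closedBall hxr)
        have : deriv (θ n) (ρ x) = 0 := by
          by_contra hne
          exact hx ⟨(hmem x hxR).2 (hθs n _ hne).1, hxr⟩
        rw [this, mul_zero]
      · rw [hf, h.indicator_eq_zero x hxr, zero_mul]
  have hstep : ∀ n, ∫ x in T, ζ n x * ⟪F x, V x⟫ ≤
      -(c * ∫ x in T, ζ n x * v x) + s * ∫ y, f y * deriv (θ n) (ρ y) := by
    intro n
    obtain ⟨M, hM⟩ := hkM n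
    have key := h.integral_mul_inner hΩ hr hrR₁ hWo inter_subset_left hF (hζc n)
      (fun y hy => ⟨(hmem y (hR₁b hy.2)).2 (lt_of_lt_of_le (hε0 n) (hζt n hy.1)), hR₁b hy.2⟩)
    rw [hsubT _ fun x hx hxr => by rw [h.grad_eq_zero x hx hxr, inner_zero_right, mul_zero],
      hsubT _ fun x hx hxr => by rw [h.eq_zero x (subset_closure hx) hxr, zero_mul]] at key
    rw [key, ← hker, ← integral_neg, ← integral_const_mul, ← integral_const_mul, ← integral_neg]
    have i1 : IntegrableOn (fun x => ζ n x * v x) T :=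
      Integrable.bdd_mul (c := 1) iv (hζc n).continuous.aestronglyMeasurable
        (Eventually.of_forall fun x => by rw [Real.norm_of_nonneg (hθ0 n _)]; exact hθ1 n _)
    have i2 : IntegrableOn (fun x => v x * deriv (θ n) (ρ x)) T :=
      Integrable.mul_bdd (c := M) iv ((hkc n).comp hρ.continuous).aestronglyMeasurable
        (Eventually.of_forall fun x => by rw [Real.norm_of_nonneg (hθd n _)]; exact hM _)
    have i1' : IntegrableOn (fun x => -(c * (ζ n x * v x))) T := (i1.const_mul c).neg
    rw [← integral_add i1' (i2.const_mul s)]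
    obtain ⟨C₃, hC₃⟩ := (isCompact_closedBall x₀ r).exists_bound_of_continuousOn
      ((hζc n).continuous_fderiv one_ne_zero).continuousOn
    have i3 : IntegrableOn
        (fun x => v x * (ζ n x * divergence F x + fderiv ℝ (ζ n) x (F x))) T := by
      refine h.integrableOn_mul hΩb hTo hTΩ (C := (|c| + |C|) + C₃ * C') ?_ fun x hx => ?_
      · exact ((hζc n).continuous.continuousOn.mul (hdc.mono hTW)).add
          (((hζc n).continuous_fderiv one_ne_zero).continuousOn.clm_apply
            (hF.continuousOn.mono hTW))
      · have h1 := hFc x (hTW hx)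
        have h2 : |divergence F x| ≤ |c| + |C| := by
          rw [abs_le]
          constructor
          · linarith [neg_abs_le c, abs_nonneg C]
          · linarith [le_abs_self C, abs_nonneg c]
        have hC₃x := hC₃ x (Metric.ball_subset_closedBall hx.2)
        refine (abs_add_le _ _).trans (add_le_add ?_ ?_)
        · rw [abs_mul, abs_of_nonneg (hθ0 n _)]
          exact (mul_le_of_le_one_left (abs_nonneg _) (hθ1 n _)).trans h2
        · refine ((fderiv ℝ (ζ n) x).le_opNorm (F x)).trans ?_
          exact mul_le_mul hC₃x (hFb x (hTW hx)) (norm_nonneg _) ((norm_nonneg _).trans hC₃x)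
    refine setIntegral_mono_on i3.neg (i1'.add (i2.const_mul s))
      hTo.measurableSet fun x hx => ?_
    simp only [hζd]
    have h1 := mul_nonneg (h.nonneg x) (mul_nonneg (hθ0 n (ρ x))
      (sub_nonneg.2 (hFc x (hTW hx)).1))
    have h2 := mul_nonneg (h.nonneg x) (mul_nonneg (hθd n (ρ x))
      (sub_nonneg.2 (hflux x (hTW hx))))
    simp only [hζ]
    nlinarith
  have hlim : ∀ u : EuclideanSpace ℝ (Fin N) → ℝ, IntegrableOn u T →
      Tendsto (fun n => ∫ x in T, ζ n x * u x) atTop (𝓝 (∫ x in T, u x)) := by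
    intro u hu
    refine tendsto_integral_of_dominated_convergence (fun x => ‖u x‖)
      (fun n => (hζc n).continuous.aestronglyMeasurable.mul hu.aestronglyMeasurable) hu.norm
      (fun n => Eventually.of_forall fun x => ?_) ?_
    · rw [norm_mul, Real.norm_of_nonneg (hθ0 n _)]
      exact mul_le_of_le_one_left (norm_nonneg _) (hθ1 n _)
    · filter_upwards [ae_restrict_mem hTo.measurableSet] with x hx
      have hx0 : 0 < ρ x := (hmem x (hTW hx).2).1 hx.1
      refine tendsto_const_nhds.congr' ?_
      filter_upwards [hεlim.eventually (gt_mem_nhds (half_pos hx0))] with n hn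
      simp only [hζ, hθo n (ρ x) (by linarith), one_mul]
  have hvT : ∫ x in Ω, v x = ∫ x in T, v x :=
    hsubT v fun x hx hxr => h.eq_zero x (subset_closure hx) hxr
  rw [h.setIntegral_inner_eq hΩ, hvT]
  exact le_of_tendsto_of_tendsto' (hlim _ iF)
    (((hlim _ iv).const_mul c).neg.add (hlimK.const_mul s)) hstep

end IsBumpTest

/-- The integration by parts at a boundary point where the normal flux of `F` is less than `g`: the
boundary term is controlled by that of the weak formulation. -/
theorem IsDefiningFunction.exists_integral_inner_le {N : ℕ} {Ω : Set (EuclideanSpace ℝ (Fin N))}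
    {x₀ e : EuclideanSpace ℝ (Fin N)} {ρ : EuclideanSpace ℝ (Fin N) → ℝ}
    (hdef : IsDefiningFunction Ω x₀ e ρ) (hρ : ContDiff ℝ 1 ρ) (hΩ : IsOpen Ω)
    (hΩb : Bornology.IsBounded Ω) {g : EuclideanSpace ℝ (Fin N) → ℝ}
    (hg : ContinuousOn g (closure Ω)) {s s' : ℝ} (hss' : s < s') :
    ∃ r₀ > 0, ∀ (r R : ℝ) (v : EuclideanSpace ℝ (Fin N) → ℝ)
      (V F : EuclideanSpace ℝ (Fin N) → EuclideanSpace ℝ (Fin N)) (c C C' : ℝ),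
      IsBumpTest Ω x₀ r v V → 0 < r → r < R → R ≤ r₀ →
      ContDiffOn ℝ 1 F (Ω ∩ Metric.ball x₀ R) →
      (∀ y ∈ Ω ∩ Metric.ball x₀ R, c ≤ divergence F y ∧ divergence F y ≤ C) →
      (∀ y ∈ Ω ∩ Metric.ball x₀ R, ‖F y‖ ≤ C') →
      (∀ y ∈ Ω ∩ Metric.ball x₀ R, -fderiv ℝ ρ y (F y) ≤ s * ‖∇ ρ x₀‖) →
      (∀ y ∈ frontier Ω ∩ Metric.ball x₀ R, s' ≤ g y) →
      ∫ x in Ω, ⟪F x, V x⟫ ≤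
        -(c * ∫ x in Ω, v x) + ∫ x in frontier Ω, g x * v x ∂μHE[N - 1] := by
  have hη : 0 < (s' - s) / (|s| + 1) := div_pos (sub_pos.2 hss') (by positivity)
  set η := (s' - s) / (|s| + 1) with hη_def
  obtain ⟨r₁, hr₁, hsurf⟩ := exists_surfaceIntegral_bounds hdef.norm_eq hdef.add_smul hρ x₀ hη
  obtain ⟨r₂, hr₂, hnear⟩ := Metric.eventually_nhds_iff_ball.1 (hdef.mem_iff.and
    (hdef.eventually_notMem_closure.and (hdef.eventually_mem_frontier.and
      hdef.eventually_mem_closure)))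
  refine ⟨min r₁ r₂, lt_min hr₁ hr₂, fun r R v V F c C C' h hr hrR hR hF hFc hFb hflux hgs => ?_⟩
  have hRr₂ : Metric.ball x₀ R ⊆ Metric.ball x₀ r₂ :=
    Metric.ball_subset_ball (hR.trans (min_le_right _ _))
  have hrr₁ : Metric.ball x₀ r ⊆ Metric.ball x₀ r₁ :=
    Metric.ball_subset_ball (hrR.le.trans (hR.trans (min_le_left _ _)))
  have hrR' : Metric.ball x₀ r ⊆ Metric.ball x₀ R := Metric.ball_subset_ball hrR.le
  have hmem : ∀ y ∈ Metric.ball x₀ R, (y ∈ Ω ↔ 0 < ρ y) := fun y hy => (hnear y (hRr₂ hy)).1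
  have hcl : ∀ y ∈ Metric.ball x₀ R, (y ∈ closure Ω ↔ 0 ≤ ρ y) := fun y hy =>
    ⟨fun hc => not_lt.1 fun hneg => (hnear y (hRr₂ hy)).2.1 hneg hc, (hnear y (hRr₂ hy)).2.2.2⟩
  have hfr : ∀ y ∈ Metric.ball x₀ R, (y ∈ frontier Ω ↔ ρ y = 0) := fun y hy =>
    ⟨fun hf => le_antisymm (not_lt.1 fun hpos => hf.2 (by
      rw [hΩ.interior_eq]; exact (hmem y hy).2 hpos)) ((hcl y hy).1 hf.1),
      (hnear y (hRr₂ hy)).2.2.1⟩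
  have hmain := h.integral_inner_le_of_flux hΩ hΩb hr hrR hdef.norm_eq hdef.add_smul hρ hmem hcl hF
    hFc hFb hflux
  set f := (closure Ω).indicator v with hf
  set J := ∫ z, f (boundaryGraph e ρ z) with hJ
  obtain ⟨Cf, hCf⟩ := h.exists_indicator_le hΩb
  have hf0 : ∀ y, 0 ≤ f y := fun y => indicator_nonneg (fun y _ => h.nonneg y) y
  obtain ⟨hfi, hI1, hI2⟩ := hsurf f Cf h.measurable_indicator hf0
    (fun y => (le_abs_self _).trans (hCf y)) (fun y hy => h.indicator_eq_zero y fun hb => hy (hrr₁ hb))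
  set B : Set (EuclideanSpace ℝ (Fin N)) := Metric.ball x₀ r₁ ∩ {y | ρ y = 0} with hB
  set B' : Set (EuclideanSpace ℝ (Fin N)) := frontier Ω ∩ Metric.ball x₀ r with hB'
  have hB'm : MeasurableSet B' := isClosed_frontier.measurableSet.inter measurableSet_ball
  have hBm : MeasurableSet B :=
    measurableSet_ball.inter (isClosed_eq hρ.continuous continuous_const).measurableSet
  have hB'B : B' ⊆ B := fun y hy => ⟨hrr₁ hy.2, (hfr y (hrR' hy.2)).1 hy.1⟩
  have hIB : ∫ y in B, f y ∂μHE[N - 1] = ∫ y in B', f y ∂μHE[N - 1] := by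
    refine setIntegral_eq_of_subset_of_forall_sdiff_eq_zero hBm hB'B fun y hy => ?_
    by_cases hyr : y ∈ Metric.ball x₀ r
    · exact absurd ⟨(hfr y (hrR' hyr)).2 hy.1.2, hyr⟩ hy.2
    · exact h.indicator_eq_zero y hyr
  set I := ∫ y in B, f y ∂μHE[N - 1] with hI
  have hI0 : 0 ≤ I := setIntegral_nonneg hBm fun y _ => hf0 y
  have hgI : s' * I ≤ ∫ x in frontier Ω, g x * v x ∂μHE[N - 1] := by
    have h1 : ∫ x in frontier Ω, g x * v x ∂μHE[N - 1] = ∫ x in B', g x * v x ∂μHE[N - 1] := by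
      refine setIntegral_eq_of_subset_of_forall_sdiff_eq_zero isClosed_frontier.measurableSet
        inter_subset_left fun y hy => ?_
      rw [h.eq_zero y (frontier_subset_closure hy.1) fun hb => hy.2 ⟨hy.1, hb⟩, mul_zero]
    rw [h1, hIB, ← integral_const_mul]
    have hfB' : IntegrableOn f B' μHE[N - 1] := hfi.mono_set hB'B
    have hvf : ∀ y ∈ B', v y = f y := fun y hy => by
      rw [hf, indicator_of_mem (frontier_subset_closure hy.1)]
    obtain ⟨Cg, hCg⟩ := hΩb.isCompact_closure.exists_bound_of_continuousOn hg
    have hgf : IntegrableOn (fun y => g y * f y) B' μHE[N - 1] := by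
      refine Integrable.bdd_mul (c := Cg) hfB'
        ((hg.mono fun y hy => frontier_subset_closure hy.1).aestronglyMeasurable hB'm) ?_
      filter_upwards [ae_restrict_mem hB'm] with y hy
      exact hCg y (frontier_subset_closure hy.1)
    rw [setIntegral_congr_fun hB'm fun y hy =>
      show g y * v y = g y * f y by rw [hvf y hy]]
    refine setIntegral_mono_on (hfB'.const_mul s') hgf hB'm fun y hy => ?_
    exact mul_le_mul_of_nonneg_right (hgs y ⟨hy.1, hrR' hy.2⟩) (hf0 y)
  have hηs : η * (|s| + 1) = s' - s := by rw [hη_def]; field_simp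
  have hcomp : s * ‖∇ ρ x₀‖ * J ≤ s' * I := by
    rw [mul_assoc]
    set K := ‖∇ ρ x₀‖ * J
    rcases le_total 0 s with hs | hs
    · rw [abs_of_nonneg hs] at hηs
      have h1 := mul_le_mul_of_nonneg_left hI2 hs
      have h2 : s * (1 + η) ≤ s' := by nlinarith
      nlinarith [mul_le_mul_of_nonneg_right h2 hI0]
    · rw [abs_of_nonpos hs] at hηs
      have hK : I ≤ (1 + η) * K := hI1
      have h3 : s ≤ s' * (1 + η) := by
        rcases le_total 0 s' with h' | h'
        · nlinarith
        · nlinarith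
      have h1 : (1 + η) * (s * K) ≤ s * I := by nlinarith
      have h2 : s * I ≤ (1 + η) * (s' * I) := by nlinarith [mul_le_mul_of_nonneg_right h3 hI0]
      exact le_of_mul_le_mul_left (h1.trans h2) (by positivity)
  linarith

/-! ### Passing to the limit in the weak formulation -/

/-- Arbitrarily small bump-like test functions at `x₀` for which the field `|∇φ|^{q_k - 2} ∇φ`, for
infinitely many `k`, satisfies the weak Neumann problem as an inequality. This is what touching the
limit of the weak solutions strictly from below by `φ` at `x₀` gives. -/
def HasBumpTests {N : ℕ} (Ω : Set (EuclideanSpace ℝ (Fin N)))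
    (q : ℕ → EuclideanSpace ℝ (Fin N) → ℝ) (g φ : EuclideanSpace ℝ (Fin N) → ℝ)
    (x₀ : EuclideanSpace ℝ (Fin N)) : Prop :=
  ∀ r > 0, ∃ᶠ k in atTop, ∃ v V, IsBumpTest Ω x₀ r v V ∧
    ∫ x in frontier Ω, g x * v x ∂μHE[N - 1] ≤
      ∫ x in Ω, ⟪‖∇ φ x‖ ^ (q k x - 2) • ∇ φ x, V x⟫

theorem gradient_add_const {N : ℕ} (φ : EuclideanSpace ℝ (Fin N) → ℝ) (c : ℝ) :
    ∇ (fun x => φ x + c) = ∇ φ := by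
  funext x
  simp only [gradient, fderiv_add_const]

theorem hasBumpTests_of_tendstoUniformlyOn {N : ℕ} {Ω : Set (EuclideanSpace ℝ (Fin N))}
    (hΩ : IsOpen Ω) (hΩb : Bornology.IsBounded Ω) {q u : ℕ → EuclideanSpace ℝ (Fin N) → ℝ}
    {g uinf φ : EuclideanSpace ℝ (Fin N) → ℝ}
    (hu : ∀ᶠ k in atTop, IsWeakSolution Ω (q k) g (u k))
    (hqm : ∀ᶠ k in atTop, AEMeasurable (q k) (volume.restrict Ω))
    (hq : ∀ᶠ k : ℕ in atTop, ∀ x ∈ Ω, 2 ≤ q k x ∧ q k x ≤ k) {σ : ℕ → ℕ} (hσ : StrictMono σ)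
    (hlim : TendstoUniformlyOn (fun j => u (σ j)) uinf atTop (closure Ω))
    (hφ : ContDiff ℝ 1 φ) {x₀ : EuclideanSpace ℝ (Fin N)} (hx₀ : x₀ ∈ closure Ω)
    (hmin : ∀ y ∈ closure Ω, y ≠ x₀ → uinf x₀ - φ x₀ < uinf y - φ y) :
    HasBumpTests Ω q g φ x₀ := by
  intro r hr
  have hσt := hσ.tendsto_atTop
  refine hσt.frequently (Eventually.frequently ?_)
  have hcont : ContinuousOn uinf (closure Ω) :=
    hlim.continuousOn ((hσt.eventually hu).mono fun j hj => hj.1).frequently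
  set K := closure Ω \ Metric.ball x₀ r with hK
  have hKc : IsCompact K := hΩb.isCompact_closure.diff Metric.isOpen_ball
  obtain ⟨m, hm0, hm⟩ : ∃ m > 0, ∀ y ∈ K, m ≤ (uinf y - φ y) - (uinf x₀ - φ x₀) := by
    rcases K.eq_empty_or_nonempty with hemp | hne
    · exact ⟨1, one_pos, by simp [hemp]⟩
    · obtain ⟨y, hy, hymin⟩ := hKc.exists_isMinOn hne (f := fun y => uinf y - φ y)
        ((hcont.mono sdiff_subset).sub hφ.continuous.continuousOn)
      refine ⟨_, sub_pos.2 (hmin y hy.1 ?_), fun z hz => sub_le_sub_right (hymin hz) _⟩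
      rintro rfl
      exact hy.2 (Metric.mem_ball_self hr)
  filter_upwards [hσt.eventually hu, hσt.eventually hqm, hσt.eventually hq,
    Metric.tendstoUniformlyOn_iff.1 hlim (m / 4) (by positivity)] with j hj1 hj2 hj3 hj4
  have hclose : ∀ x ∈ closure Ω, |uinf x - u (σ j) x| < m / 4 := fun x hx => by
    have := hj4 x hx
    rwa [Real.dist_eq] at this
  obtain ⟨v, V, hv, -, hle⟩ := hj1.exists_isBumpTest hΩ hΩb hj2 hj3
    (φ := fun x => φ x + ((uinf x₀ - φ x₀) + m / 2)) (hφ.add contDiff_const) (x₀ := x₀) (r := r)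
    (by have := abs_lt.1 (hclose x₀ hx₀); linarith)
    (fun x hx hxr => by
      have h1 := abs_lt.1 (hclose x hx)
      have h2 := hm x ⟨hx, hxr⟩
      linarith)
  refine ⟨v, V, hv, ?_⟩
  simpa only [gradient_add_const, real_inner_smul_left] using hle

/-- The set where the exponent is finite has unique derivatives: it contains a ball, or a one-sided
neighborhood of a piece of `∂D` or `∂Ω`. -/
theorem uniqueDiffOn_closure_sdiff {N : ℕ} {Ω D : Set (EuclideanSpace ℝ (Fin N))} (hΩ : IsOpen Ω)
    (hΩs : HasSmoothBoundary Ω) (hDo : IsOpen D) (hDΩ : closure D ⊆ Ω)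
    (hDl : HasLipschitzBoundary D) : UniqueDiffOn ℝ (closure Ω \ D) := by
  rintro x ⟨hxΩ, hxD⟩
  by_cases hx : x ∈ Ω
  · by_cases hxc : x ∈ closure D
    · obtain ⟨e, ρ, hdef, K, hK⟩ :=
        hDl.exists_isDefiningFunction (x := x) ⟨hxc, by rwa [hDo.interior_eq]⟩
      refine hdef.uniqueDiffWithinAt (K := K) (σ := -1) (Eventually.of_forall fun y => ?_)
        (Or.inr rfl) ?_
      · have := hK.dist_le_mul y x
        rwa [Real.dist_eq, hdef.apply_eq_zero ⟨hxc, by rwa [hDo.interior_eq]⟩, sub_zero,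
          dist_eq_norm] at this
      · filter_upwards [hdef.mem_iff, hΩ.mem_nhds hx] with y hy1 hy2 hneg
        exact ⟨subset_closure hy2, fun h => by have := hy1.1 h; linarith⟩
    · exact uniqueDiffWithinAt_of_mem_nhds (mem_of_superset
        ((hΩ.sdiff isClosed_closure).mem_nhds ⟨hx, hxc⟩)
        (sdiff_subset_sdiff subset_closure subset_closure))
  · have hxf : x ∈ frontier Ω := ⟨hxΩ, by rwa [hΩ.interior_eq]⟩
    obtain ⟨e, ρ, hdef, hρ⟩ := hΩs.exists_isDefiningFunction hxf
    have hρd : DifferentiableAt ℝ ρ x := hρ.differentiable (by simp) x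
    obtain ⟨K, hK⟩ := hρd.isBigO_sub.bound
    refine hdef.uniqueDiffWithinAt (K := K) (σ := 1) ?_ (Or.inl rfl) ?_
    · filter_upwards [hK] with y hy
      rwa [hdef.apply_eq_zero hxf, sub_zero, Real.norm_eq_abs] at hy
    · filter_upwards [hdef.mem_iff, isClosed_closure.isOpen_compl.mem_nhds
        (show x ∈ (closure D)ᶜ from fun h => hx (hDΩ h))] with y hy1 hy2 hpos
      rw [one_mul] at hpos
      exact ⟨subset_closure (hy1.2 hpos), fun h => hy2 (subset_closure h)⟩

section Cases

variable {N : ℕ} {Ω D : Set (EuclideanSpace ℝ (Fin N))} {q : ℕ → EuclideanSpace ℝ (Fin N) → ℝ}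
  {q₀ g φ : EuclideanSpace ℝ (Fin N) → ℝ} {x₀ : EuclideanSpace ℝ (Fin N)}

theorem IsBumpTest.integral_frontier_eq_zero {r : ℝ} {v : EuclideanSpace ℝ (Fin N) → ℝ}
    {V : EuclideanSpace ℝ (Fin N) → EuclideanSpace ℝ (Fin N)} (h : IsBumpTest Ω x₀ r v V)
    (hΩ : IsOpen Ω) (hr : Metric.ball x₀ r ⊆ Ω) :
    ∫ x in frontier Ω, g x * v x ∂μHE[N - 1] = 0 := by
  refine setIntegral_eq_zero_of_forall_eq_zero fun x hx => ?_
  rw [h.eq_zero x (frontier_subset_closure hx) fun hb => ?_, mul_zero]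
  exact hx.2 (by rw [hΩ.interior_eq]; exact hr hb)

/-- Near an interior point the fields tested cannot have a positive divergence. -/
theorem HasBumpTests.not_eventually_divergence_pos (hT : HasBumpTests Ω q g φ x₀) (hΩ : IsOpen Ω)
    (hΩb : Bornology.IsBounded Ω) {W : Set (EuclideanSpace ℝ (Fin N))} (hW : IsOpen W)
    (hWΩ : W ⊆ Ω) (hx₀ : x₀ ∈ W) :
    ¬ ∀ᶠ k in atTop, ∃ c > 0, ∃ F : EuclideanSpace ℝ (Fin N) → EuclideanSpace ℝ (Fin N),
      ContDiffOn ℝ 1 F W ∧ (∀ x ∈ W, c ≤ divergence F x) ∧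
      ∀ x ∈ W, ‖∇ φ x‖ ^ (q k x - 2) • ∇ φ x = F x := by
  intro hF
  obtain ⟨R, hR, hRW⟩ := Metric.nhds_basis_closedBall.mem_iff.1 (hW.mem_nhds hx₀)
  have hr : 0 < R / 2 := half_pos hR
  obtain ⟨k, ⟨v, V, h, hle⟩, c, hc, F, hFc, hFd, hFe⟩ := ((hT (R / 2) hr).and_eventually hF).exists
  have hrW : Metric.ball x₀ (R / 2) ⊆ W := (Metric.ball_subset_closedBall.trans
    (Metric.closedBall_subset_closedBall (half_lt_self hR).le)).trans hRW
  have h1 := h.integral_inner_le hΩ hΩb hr (half_lt_self hR) hW hWΩ hRW hFc hFd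
  have h2 := h.integral_pos hΩ hΩb (subset_closure (hWΩ hx₀))
  rw [h.integral_frontier_eq_zero hΩ (hrW.trans hWΩ), h.setIntegral_inner_eq hΩ,
    setIntegral_congr_fun (hΩ.inter Metric.isOpen_ball).measurableSet
      (fun x hx => show _ = ⟪F x, V x⟫ by rw [hFe x (hrW hx.2)]), ← h.setIntegral_inner_eq hΩ] at hle
  have := mul_pos hc h2
  linarith

theorem HasBumpTests.infLaplacian_nonpos (hT : HasBumpTests Ω q g φ x₀) (hΩ : IsOpen Ω)
    (hΩb : Bornology.IsBounded Ω) (hφ : ContDiff ℝ 2 φ) (hDo : IsOpen D) (hDΩ : D ⊆ Ω)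
    (hqD : ∀ (k : ℕ), ∀ x ∈ D, q k x = k) (hx₀ : x₀ ∈ D) : infLaplacian φ x₀ ≤ 0 := by
  by_contra! hpos
  obtain ⟨r, hr, hne, k₀, hk₀⟩ := exists_le_divergence_of_infLaplacian_pos hφ hpos
  refine hT.not_eventually_divergence_pos hΩ hΩb (hDo.inter Metric.isOpen_ball)
    (inter_subset_left.trans hDΩ) ⟨hx₀, Metric.mem_ball_self hr⟩ ?_
  filter_upwards [eventually_ge_atTop k₀] with k hk
  obtain ⟨c, hc, hdiv⟩ := hk₀ k hk
  exact ⟨c, hc, _, contDiffOn_norm_rpow_smul_gradient hφ (q := fun _ => (k : ℝ)) contDiffOn_const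
    fun x hx => hne x hx.2, fun x hx => hdiv x hx.2, fun x hx => by rw [hqD k x hx.1]⟩

theorem HasBumpTests.varLaplacianWithin_nonpos (hT : HasBumpTests Ω q g φ x₀) (hΩ : IsOpen Ω)
    (hΩb : Bornology.IsBounded Ω) (hφ : ContDiff ℝ 2 φ) (hs : UniqueDiffOn ℝ (closure Ω \ D))
    (hq₀ : ContDiffOn ℝ 1 q₀ (closure Ω \ D))
    (hq : ∀ᶠ k in atTop, ∀ x ∈ Ω \ closure D, q k x = q₀ x) (hx₀ : x₀ ∈ Ω \ closure D)
    (hq2 : 2 < q₀ x₀) : varLaplacianWithin (closure Ω \ D) q₀ φ x₀ ≤ 0 := by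
  by_contra! hpos
  have hUo : IsOpen (Ω \ closure D) := hΩ.sdiff isClosed_closure
  have hUs : Ω \ closure D ⊆ closure Ω \ D := sdiff_subset_sdiff subset_closure subset_closure
  obtain ⟨r, hr, c, hc, C, -, hU⟩ := exists_divergence_bounds_of_varLaplacianWithin_pos hφ
    (hUs hx₀) (hs x₀ (hUs hx₀)) hq₀ hq2 hpos
  have hWo : IsOpen ((Ω \ closure D) ∩ Metric.ball x₀ r) := hUo.inter Metric.isOpen_ball
  obtain ⟨hFc, hFd⟩ := hU _ hWo (inter_subset_left.trans hUs) inter_subset_right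
  refine hT.not_eventually_divergence_pos hΩ hΩb hWo
    (inter_subset_left.trans sdiff_subset) ⟨hx₀, Metric.mem_ball_self hr⟩ ?_
  filter_upwards [hq] with k hk
  exact ⟨c, hc, _, hFc, fun x hx => (hFd x hx).1, fun x hx => by rw [hk x hx.1]⟩

theorem continuousWithinAt_norm_rpow_smul_gradient (hφ : ContDiff ℝ 2 φ)
    {s : Set (EuclideanSpace ℝ (Fin N))} (hq : ContinuousWithinAt q₀ s x₀) (hq2 : 2 < q₀ x₀) :
    ContinuousWithinAt (fun y => ‖∇ φ y‖ ^ (q₀ y - 2) • ∇ φ y) s x₀ := by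
  have h := (contDiff_gradient hφ).continuous.continuousWithinAt (s := s) (x := x₀)
  exact (h.norm.rpow (hq.sub continuousWithinAt_const) (Or.inr (sub_pos.2 hq2))).smul h

/-- The boundary case: if the flux of `|∇φ|^{q₀ - 2} ∇φ` at a boundary point is less than `g`, its
divergence is not positive there. -/
theorem HasBumpTests.varLaplacianWithin_nonpos_of_flux_lt (hT : HasBumpTests Ω q g φ x₀)
    (hΩ : IsOpen Ω) (hΩb : Bornology.IsBounded Ω) (hφ : ContDiff ℝ 2 φ) (hDΩ : closure D ⊆ Ω)
    (hs : UniqueDiffOn ℝ (closure Ω \ D)) (hg : ContinuousOn g (closure Ω)) (hq₀ : ContDiffOn ℝ 1 q₀ (closure Ω \ D))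
    (hq : ∀ᶠ k in atTop, ∀ x ∈ Ω \ closure D, q k x = q₀ x) (hx₀ : x₀ ∈ frontier Ω)
    (hq2 : 2 < q₀ x₀) {e : EuclideanSpace ℝ (Fin N)} {ρ : EuclideanSpace ℝ (Fin N) → ℝ}
    (hdef : IsDefiningFunction Ω x₀ e ρ) (hρ : ContDiff ℝ 1 ρ) (hβ : 0 < ‖∇ ρ x₀‖)
    (hflux : ‖∇ φ x₀‖ ^ (q₀ x₀ - 2) * ⟪∇ φ x₀, -(‖∇ ρ x₀‖⁻¹ • ∇ ρ x₀)⟫ < g x₀) :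
    varLaplacianWithin (closure Ω \ D) q₀ φ x₀ ≤ 0 := by
  by_contra! hpos
  set s := closure Ω \ D
  set F : EuclideanSpace ℝ (Fin N) → EuclideanSpace ℝ (Fin N) :=
    fun y => ‖∇ φ y‖ ^ (q₀ y - 2) • ∇ φ y with hF
  have hx₀Ω : x₀ ∉ Ω := fun h => hx₀.2 (by rwa [hΩ.interior_eq])
  have hx₀D : x₀ ∉ closure D := fun h => hx₀Ω (hDΩ h)
  have hx₀s : x₀ ∈ s := ⟨hx₀.1, fun h => hx₀D (subset_closure h)⟩
  have hDc : ∀ᶠ y in 𝓝 x₀, y ∉ closure D := isClosed_closure.isOpen_compl.mem_nhds hx₀D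
  have hFcont : ContinuousWithinAt F s x₀ :=
    continuousWithinAt_norm_rpow_smul_gradient hφ (hq₀.continuousOn x₀ hx₀s) hq2
  obtain ⟨r₁, hr₁, c, hc, C, -, hU⟩ :=
    exists_divergence_bounds_of_varLaplacianWithin_pos hφ hx₀s (hs x₀ hx₀s) hq₀ hq2 hpos
  obtain ⟨s₁, hs₁, hs₁g⟩ := exists_between hflux
  obtain ⟨s', hs₁s', hs'g⟩ := exists_between hs₁g
  have hfl : -fderiv ℝ ρ x₀ (F x₀) < s₁ * ‖∇ ρ x₀‖ := by
    rw [inner_neg_right, real_inner_smul_right] at hs₁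
    rw [← inner_gradient, hF, real_inner_smul_right, real_inner_comm]
    have h1 := mul_lt_mul_of_pos_right hs₁ hβ
    refine lt_of_eq_of_lt ?_ h1
    field_simp
  have hflc : ContinuousWithinAt (fun y => -fderiv ℝ ρ y (F y)) s x₀ :=
    ((hρ.continuous_fderiv one_ne_zero).continuousWithinAt.clm_apply hFcont).neg
  obtain ⟨r₀, hr₀, hmain⟩ := hdef.exists_integral_inner_le hρ hΩ hΩb hg hs₁s'
  have hev : ∀ᶠ y in 𝓝[s] x₀, -fderiv ℝ ρ y (F y) < s₁ * ‖∇ ρ x₀‖ ∧ ‖F y‖ < ‖F x₀‖ + 1 :=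
    (hflc.tendsto.eventually (gt_mem_nhds hfl)).and
      (hFcont.norm.tendsto.eventually (gt_mem_nhds (lt_add_one _)))
  obtain ⟨r₂, hr₂, hball₂⟩ := Metric.mem_nhdsWithin_iff.1 hev
  obtain ⟨r₃, hr₃, hball₃⟩ := Metric.mem_nhdsWithin_iff.1
    ((hg x₀ hx₀.1).tendsto.eventually (lt_mem_nhds hs'g))
  obtain ⟨r₄, hr₄, hball₄⟩ := Metric.eventually_nhds_iff_ball.1 hDc
  set R := min (min r₀ r₁) (min r₂ (min r₃ r₄)) with hR
  have hR0 : 0 < R := lt_min (lt_min hr₀ hr₁) (lt_min hr₂ (lt_min hr₃ hr₄))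
  have hRr₀ : R ≤ r₀ := (min_le_left _ _).trans (min_le_left _ _)
  have hRr₁ : R ≤ r₁ := (min_le_left _ _).trans (min_le_right _ _)
  have hRr₂ : R ≤ r₂ := (min_le_right _ _).trans (min_le_left _ _)
  have hRr₃ : R ≤ r₃ := ((min_le_right _ _).trans (min_le_right _ _)).trans (min_le_left _ _)
  have hRr₄ : R ≤ r₄ := ((min_le_right _ _).trans (min_le_right _ _)).trans (min_le_right _ _)
  have hWD : ∀ y ∈ Ω ∩ Metric.ball x₀ R, y ∈ Ω \ closure D := fun y hy =>
    ⟨hy.1, hball₄ y (Metric.ball_subset_ball hRr₄ hy.2)⟩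
  have hWs : Ω ∩ Metric.ball x₀ R ⊆ s := fun y hy =>
    ⟨subset_closure hy.1, fun h => (hWD y hy).2 (subset_closure h)⟩
  obtain ⟨hFc, hFd⟩ := hU _ (hΩ.inter Metric.isOpen_ball) hWs
    (inter_subset_right.trans (Metric.ball_subset_ball hRr₁))
  have hr : 0 < R / 2 := half_pos hR0
  have hrR : R / 2 < R := half_lt_self hR0
  obtain ⟨k, ⟨v, V, h, hle⟩, hk⟩ := ((hT (R / 2) hr).and_eventually hq).exists
  have h1 := hmain (R / 2) R v V F c C (‖F x₀‖ + 1) h hr hrR hRr₀ hFc hFd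
    (fun y hy => (hball₂ ⟨Metric.ball_subset_ball hRr₂ hy.2, hWs hy⟩).2.le)
    (fun y hy => (hball₂ ⟨Metric.ball_subset_ball hRr₂ hy.2, hWs hy⟩).1.le)
    (fun y hy => le_of_lt (hball₃ ⟨Metric.ball_subset_ball hRr₃ hy.2, hy.1.1⟩))
  have h2 := h.integral_pos hΩ hΩb hx₀.1
  rw [h.setIntegral_inner_eq hΩ, setIntegral_congr_fun (hΩ.inter Metric.isOpen_ball).measurableSet
      (fun x hx => show _ = ⟪F x, V x⟫ by
        rw [hk x (hWD x ⟨hx.1, Metric.ball_subset_ball hrR.le hx.2⟩)]),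
    ← h.setIntegral_inner_eq hΩ] at hle
  have := mul_pos hc h2
  linarith

end Cases

/-! ### The interface -/

section Interface

variable {N : ℕ} {Ω D : Set (EuclideanSpace ℝ (Fin N))} {q : ℕ → EuclideanSpace ℝ (Fin N) → ℝ}
  {q₀ g φ : EuclideanSpace ℝ (Fin N) → ℝ} {x₀ : EuclideanSpace ℝ (Fin N)}

/-- The interface case: if both equations are violated at `x₀ ∈ ∂D`, the transmission condition
cannot be violated as well. The fields on the two sides of `∂D` differ by
`(|∇φ|^{k - 2} - |∇φ|^{p - 2}) ∇φ`, and violation of the transmission condition says exactly that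
this jump points into `D`. -/
theorem HasBumpTests.exists_transmission_nonneg (hT : HasBumpTests Ω q g φ x₀)
    (hΩ : IsOpen Ω) (hΩb : Bornology.IsBounded Ω) (hφ : ContDiff ℝ 2 φ) (hDo : IsOpen D)
    (hDΩ : closure D ⊆ Ω) (hDl : HasLipschitzBoundary D)
    (hs : UniqueDiffOn ℝ (closure Ω \ D))
    (hq₀ : ContDiffOn ℝ 1 q₀ (closure Ω \ D)) (hqD : ∀ (k : ℕ), ∀ x ∈ D, q k x = k)
    (hq : ∀ᶠ k : ℕ in atTop, ∀ x ∈ Ω \ closure D, q k x = q₀ x ∧ q₀ x ≤ k) (hx₀ : x₀ ∈ frontier D)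
    (hq2 : 2 < q₀ x₀) (hinf : 0 < infLaplacian φ x₀)
    (hvar : 0 < varLaplacianWithin (closure Ω \ D) q₀ φ x₀) :
    ∃ ν ∈ generalizedNormals D x₀, 0 ≤ Real.sign (‖∇ φ x₀‖ - 1) * Real.sign ⟪∇ φ x₀, ν⟫ := by
  by_contra! hsgn
  set s := closure Ω \ D
  have hx₀Ω : x₀ ∈ Ω := hDΩ hx₀.1
  have hx₀s : x₀ ∈ s := ⟨subset_closure hx₀Ω, fun h => hx₀.2 (by rwa [hDo.interior_eq])⟩
  set X := ∇ φ x₀ with hX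
  have hXc : Continuous (∇ φ) := (contDiff_gradient hφ).continuous
  obtain ⟨e, ρ, hdef, K, hK⟩ := hDl.exists_isDefiningFunction hx₀
  -- the sign `ι` of `|∇φ| - 1`, for which `ι ∇φ` points into `D`
  obtain ⟨ι, hι, hιX, hιw⟩ : ∃ ι : ℝ, ι * ι = 1 ∧ 0 < ι * (‖X‖ - 1) ∧
      ∀ ν ∈ generalizedNormals D x₀, ⟪ι • X, ν⟫ < 0 := by
    obtain ⟨ν₀, hν₀⟩ := hDl.generalizedNormals_nonempty hx₀
    have hne : ‖X‖ - 1 ≠ 0 := fun h0 => by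
      have := hsgn ν₀ hν₀
      rw [h0, Real.sign_zero, zero_mul] at this
      exact lt_irrefl _ this
    refine ⟨Real.sign (‖X‖ - 1), ?_, Real.sign_mul_pos_of_ne_zero _ hne, fun ν hν => ?_⟩
    · rcases Real.sign_apply_eq_of_ne_zero _ hne with h | h <;> rw [h] <;> norm_num
    · rw [real_inner_smul_left]
      have h1 := hsgn ν hν
      have h2 : ⟪X, ν⟫ ≠ 0 := fun h0 => by
        rw [h0, Real.sign_zero, mul_zero] at h1
        exact lt_irrefl _ h1
      rcases Real.sign_apply_eq_of_ne_zero _ hne with h | h <;> rw [h] at h1 ⊢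
      · have : 0 < ⟪X, ν⟫ := by
          by_contra hn
          rw [Real.sign_of_neg (lt_of_le_of_ne (not_lt.1 hn) h2)] at h1
          norm_num at h1
        linarith
      · have : ⟪X, ν⟫ < 0 := by
          by_contra hn
          rw [Real.sign_of_pos (lt_of_le_of_ne (not_lt.1 hn) h2.symm)] at h1
          norm_num at h1
        linarith
  obtain ⟨c₁, hc₁, r₁, hr₁, happ⟩ := hdef.exists_contDiff_approx hx₀ hK hιw
  obtain ⟨r₂, hr₂, hne₂, k₀, hk₀⟩ := exists_le_divergence_of_infLaplacian_pos hφ hinf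
  obtain ⟨r₃, hr₃, c₃, hc₃, C₃, hne₃, hU⟩ :=
    exists_divergence_bounds_of_varLaplacianWithin_pos hφ hx₀s (hs x₀ hx₀s) hq₀ hq2 hvar
  set B : EuclideanSpace ℝ (Fin N) → EuclideanSpace ℝ (Fin N) :=
    fun y => ‖∇ φ y‖ ^ (q₀ y - 2) • ∇ φ y with hB
  have hBcont : ContinuousWithinAt B s x₀ :=
    continuousWithinAt_norm_rpow_smul_gradient hφ (hq₀.continuousOn x₀ hx₀s) hq2
  obtain ⟨r₄, hr₄, hball₄⟩ := Metric.mem_nhdsWithin_iff.1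
    (hBcont.norm.tendsto.eventually (gt_mem_nhds (lt_add_one _)))
  -- near `x₀`, the field `ι ∇φ` still points into `D` and `|∇φ| - 1` keeps its sign
  have hev : ∀ᶠ y in 𝓝 x₀, y ∈ Ω ∧ (y ∈ D ↔ 0 < ρ y) ∧ (ρ y < 0 → y ∉ closure D) ∧
      0 < ι * (‖∇ φ y‖ - 1) ∧ K * ‖∇ φ y - X‖ < c₁ := by
    have h1 : Continuous fun y => ι * (‖∇ φ y‖ - 1) := by fun_prop
    have h2 : Continuous fun y => (K : ℝ) * ‖∇ φ y - X‖ := by fun_prop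
    refine (hΩ.eventually_mem hx₀Ω).and (hdef.mem_iff.and (hdef.eventually_notMem_closure.and
      ((h1.continuousAt.eventually (lt_mem_nhds hιX)).and
        (h2.continuousAt.eventually (gt_mem_nhds ?_)))))
    simpa [hX] using hc₁
  obtain ⟨r₅, hr₅, hball₅⟩ := Metric.eventually_nhds_iff_ball.1 hev
  set R' := min (min r₁ r₂) (min r₃ (min r₄ r₅)) with hR'
  have hR'0 : 0 < R' := lt_min (lt_min hr₁ hr₂) (lt_min hr₃ (lt_min hr₄ hr₅))
  have hb₁ : Metric.ball x₀ R' ⊆ Metric.ball x₀ r₁ :=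
    Metric.ball_subset_ball ((min_le_left _ _).trans (min_le_left _ _))
  have hb₂ : Metric.ball x₀ R' ⊆ Metric.ball x₀ r₂ :=
    Metric.ball_subset_ball ((min_le_left _ _).trans (min_le_right _ _))
  have hb₃ : Metric.ball x₀ R' ⊆ Metric.ball x₀ r₃ :=
    Metric.ball_subset_ball ((min_le_right _ _).trans (min_le_left _ _))
  have hb₄ : Metric.ball x₀ R' ⊆ Metric.ball x₀ r₄ := Metric.ball_subset_ball
    (((min_le_right _ _).trans (min_le_right _ _)).trans (min_le_left _ _))
  have hb₅ : Metric.ball x₀ R' ⊆ Metric.ball x₀ r₅ := Metric.ball_subset_ball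
    (((min_le_right _ _).trans (min_le_right _ _)).trans (min_le_right _ _))
  have hRΩ : Metric.ball x₀ R' ⊆ Ω := fun y hy => (hball₅ y (hb₅ hy)).1
  set U : Set (EuclideanSpace ℝ (Fin N)) := Metric.ball x₀ R' ∩ {y | ρ y < 0} with hUdef
  have hUo : IsOpen U := Metric.isOpen_ball.inter (isOpen_lt hdef.continuous continuous_const)
  have hUD : U ⊆ Ω \ closure D := fun y hy => ⟨hRΩ hy.1, (hball₅ y (hb₅ hy.1)).2.2.1 hy.2⟩
  have hUs : U ⊆ s := hUD.trans (sdiff_subset_sdiff subset_closure subset_closure)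
  obtain ⟨hBc, hBd⟩ := hU U hUo hUs (inter_subset_left.trans hb₃)
  have hr : 0 < R' / 3 := by positivity
  obtain ⟨k, ⟨v, V, h, hle⟩, hk, hkk₀⟩ :=
    ((hT (R' / 3) hr).and_eventually (hq.and (eventually_ge_atTop k₀))).exists
  obtain ⟨c₂, hc₂, hAd⟩ := hk₀ k hkk₀
  set A : EuclideanSpace ℝ (Fin N) → EuclideanSpace ℝ (Fin N) :=
    fun y => ‖∇ φ y‖ ^ ((k : ℝ) - 2) • ∇ φ y with hA
  have hrR' : Metric.ball x₀ (R' / 3) ⊆ Metric.ball x₀ R' :=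
    Metric.ball_subset_ball (by linarith)
  have key := h.integral_inner_le_of_jump hΩ hΩb hr (R := R' / 2) (R' := R') (by linarith)
    (by linarith) hRΩ hdef.continuous hdef.measure_eq_zero (A := A) (B := B)
    (H := fun x => ‖∇ φ x‖ ^ (q k x - 2) • ∇ φ x) (c := min c₂ c₃) (C := C₃) (C' := ‖B x₀‖ + 1)
    (contDiffOn_norm_rpow_smul_gradient hφ (q := fun _ => (k : ℝ)) contDiffOn_const
      fun x hx => hne₂ x (hb₂ hx)) hBc
    (fun x hx => (min_le_left _ _).trans (hAd x (hb₂ hx)))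
    (fun x hx => ⟨(min_le_right _ _).trans (hBd x hx).1, (hBd x hx).2⟩)
    (fun x hx => le_of_lt (hball₄ ⟨hb₄ hx.1, hUs hx⟩)) ?_ ?_ ?_
  · have h2 := h.integral_pos hΩ hΩb (subset_closure hx₀Ω)
    rw [h.integral_frontier_eq_zero hΩ (hrR'.trans hRΩ)] at hle
    have := mul_pos (lt_min hc₂ hc₃) h2
    linarith
  · intro δ hδ
    obtain ⟨ρ', hρ'c, hρ'a, hρ'd⟩ := happ δ hδ
    refine ⟨ρ', hρ'c, hρ'a, fun y hy => ?_⟩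
    obtain ⟨-, -, -, hy1, hy2⟩ := hball₅ y (hb₅ hy.1)
    obtain ⟨hd1, hd2⟩ := hρ'd y (hb₁ hy.1)
    set a := ‖∇ φ y‖ with ha
    have ha0 : 0 < a := norm_pos_iff.2 (hne₃ y (hb₃ hy.1))
    -- the jump is a nonnegative multiple of `ι ∇φ`
    have hjump : A y - B y = (ι * (a ^ ((k : ℝ) - 2) - a ^ (q₀ y - 2))) • (ι • ∇ φ y) := by
      simp only [hA, hB, ← ha]
      rw [smul_smul, mul_right_comm, hι, one_mul, sub_smul]
    have hexp : q₀ y - 2 ≤ (k : ℝ) - 2 := by linarith [(hk y (hUD hy)).2]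
    have hθ : 0 ≤ ι * (a ^ ((k : ℝ) - 2) - a ^ (q₀ y - 2)) := by
      rcases mul_self_eq_one_iff.1 hι with rfl | rfl
      · have : a ^ (q₀ y - 2) ≤ a ^ ((k : ℝ) - 2) :=
          Real.rpow_le_rpow_of_exponent_le (by linarith) hexp
        linarith
      · have : a ^ ((k : ℝ) - 2) ≤ a ^ (q₀ y - 2) :=
          Real.rpow_le_rpow_of_exponent_ge ha0 (by linarith) hexp
        linarith
    rw [hjump, map_smul, smul_eq_mul]
    refine mul_nonneg hθ ?_
    have h1 : fderiv ℝ ρ' y (ι • ∇ φ y) = fderiv ℝ ρ' y (ι • X) +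
        fderiv ℝ ρ' y (ι • (∇ φ y - X)) := by
      rw [← map_add]; congr 1; module
    have hιn : ‖ι‖ = 1 := by
      rcases mul_self_eq_one_iff.1 hι with rfl | rfl <;> simp
    have h2 : |fderiv ℝ ρ' y (ι • (∇ φ y - X))| ≤ K * ‖∇ φ y - X‖ := by
      refine ((fderiv ℝ ρ' y).le_opNorm _).trans ?_
      rw [norm_smul, hιn, one_mul]
      exact mul_le_mul_of_nonneg_right hd2 (norm_nonneg _)
    rw [h1]
    have := neg_abs_le (fderiv ℝ ρ' y (ι • (∇ φ y - X)))
    linarith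
  · intro x hx hρx
    simp only [hA, hqD k x ((hball₅ x (hb₅ (hrR' hx))).2.1.2 hρx)]
  · intro x hx hρx
    simp only [hB, (hk x (hUD ⟨hrR' hx, hρx⟩)).1]

end Interface

/-! ### The truncated exponents -/

section Exponent

variable {N : ℕ} {Ω D : Set (EuclideanSpace ℝ (Fin N))} {p : EuclideanSpace ℝ (Fin N) → ℝ≥0∞}

theorem truncExponent_of_eq_top {x : EuclideanSpace ℝ (Fin N)} (hx : p x = ⊤) (k : ℕ) :
    truncExponent p k x = k := by
  simp [truncExponent, hx]

theorem truncExponent_le (k : ℕ) (x : EuclideanSpace ℝ (Fin N)) : truncExponent p k x ≤ k := by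
  have := ENNReal.toReal_mono (ENNReal.natCast_ne_top k) (min_le_right (p x) (k : ℝ≥0∞))
  simpa [truncExponent] using this

theorem two_le_truncExponent {k : ℕ} (hk : 2 ≤ k) {x : EuclideanSpace ℝ (Fin N)} (hx : 2 ≤ p x) :
    2 ≤ truncExponent p k x := by
  have h1 : (2 : ℝ≥0∞) ≤ min (p x) (k : ℝ≥0∞) := le_min hx (by exact_mod_cast hk)
  have h2 := ENNReal.toReal_mono (ne_top_of_le_ne_top (ENNReal.natCast_ne_top k)
    (min_le_right (p x) (k : ℝ≥0∞))) h1
  simpa [truncExponent] using h2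

theorem truncExponent_of_lt {k : ℕ} (hk : (⨆ x ∈ closure Ω \ closure D, p x) < (k : ℝ≥0∞))
    {x : EuclideanSpace ℝ (Fin N)} (hx : x ∈ Ω \ closure D) :
    truncExponent p k x = (p x).toReal ∧ (p x).toReal ≤ k := by
  have h1 : p x ≤ k := (le_iSup₂ (f := fun x (_ : x ∈ closure Ω \ closure D) => p x) x
    ⟨subset_closure hx.1, hx.2⟩).trans hk.le
  have h2 : truncExponent p k x = (p x).toReal := by rw [truncExponent, min_eq_left h1]
  exact ⟨h2, h2 ▸ truncExponent_le k x⟩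

theorem aemeasurable_truncExponent (hΩ : IsOpen Ω) (hDo : IsOpen D) (hDΩ : D ⊆ Ω)
    (hpD : ∀ x ∈ D, p x = ⊤) (hpfin : ∀ x ∈ closure Ω \ D, p x ≠ ⊤)
    (hp : ContinuousOn (fun x => (p x).toReal) (closure Ω \ D)) (k : ℕ) :
    AEMeasurable (truncExponent p k) (volume.restrict Ω) := by
  rw [← union_sdiff_cancel hDΩ, aemeasurable_union_iff]
  constructor
  · refine aemeasurable_const.congr (f := fun _ => (k : ℝ)) ?_
    filter_upwards [ae_restrict_mem hDo.measurableSet] with x hx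
    exact (truncExponent_of_eq_top (hpD x hx) k).symm
  · have hm : MeasurableSet (Ω \ D) := hΩ.measurableSet.diff hDo.measurableSet
    have hc : ContinuousOn (fun x => min (p x).toReal (k : ℝ)) (Ω \ D) :=
      continuous_min.comp_continuousOn
        ((hp.mono (sdiff_subset_sdiff_left subset_closure)).prodMk continuousOn_const)
    refine (hc.aemeasurable hm).congr ?_
    filter_upwards [ae_restrict_mem hm] with x hx
    rw [truncExponent, ENNReal.toReal_min (hpfin x ⟨subset_closure hx.1, hx.2⟩)
      (ENNReal.natCast_ne_top k), ENNReal.toReal_natCast]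

end Exponent

/-! ### Viscosity super- and subsolutions -/

section Viscosity

variable {N : ℕ} {Ω D : Set (EuclideanSpace ℝ (Fin N))} {p : EuclideanSpace ℝ (Fin N) → ℝ≥0∞}
  {g : EuclideanSpace ℝ (Fin N) → ℝ} {u : ℕ → EuclideanSpace ℝ (Fin N) → ℝ} {σ : ℕ → ℕ}
  {uinf : EuclideanSpace ℝ (Fin N) → ℝ}

theorem isViscositySupersolution_of_tendstoUniformlyOn (hN : 2 ≤ N) (hΩo : IsOpen Ω)
    (hΩb : Bornology.IsBounded Ω) (hΩs : HasSmoothBoundary Ω) (hDo : IsOpen D)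
    (hDΩ : closure D ⊆ Ω) (hDl : HasLipschitzBoundary D) (hpD : ∀ x ∈ D, p x = ⊤)
    (hpfin : ∀ x ∈ closure Ω \ D, p x ≠ ⊤)
    (hpC1 : ContDiffOn ℝ 1 (fun x => (p x).toReal) (closure Ω \ D))
    (hpplus : (⨆ x ∈ closure Ω \ closure D, p x) < ⊤)
    (hpminus : (N : ℝ≥0∞) < ⨅ x ∈ closure Ω, p x) (hg : ContinuousOn g (closure Ω))
    (hu : ∀ k : ℕ, (⨆ x ∈ closure Ω \ closure D, p x) < (k : ℝ≥0∞) →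
      IsWeakSolution Ω (truncExponent p k) g (u k)) (hσ : StrictMono σ)
    (hlim : TendstoUniformlyOn (fun j => u (σ j)) uinf atTop (closure Ω)) :
    IsViscositySupersolution Ω D p g uinf := by
  have hDΩ' : D ⊆ Ω := subset_closure.trans hDΩ
  have hs : UniqueDiffOn ℝ (closure Ω \ D) := uniqueDiffOn_closure_sdiff hΩo hΩs hDo hDΩ hDl
  have hplus : ∀ᶠ k : ℕ in atTop, (⨆ x ∈ closure Ω \ closure D, p x) < (k : ℝ≥0∞) :=
    ENNReal.tendsto_nat_nhds_top.eventually (lt_mem_nhds hpplus)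
  have hsol : ∀ᶠ k in atTop, IsWeakSolution Ω (truncExponent p k) g (u k) := hplus.mono hu
  have hNp : ∀ x ∈ closure Ω, (N : ℝ≥0∞) < p x := fun x hx => lt_of_lt_of_le hpminus (iInf₂_le x hx)
  have h2N : (2 : ℝ≥0∞) ≤ N := by exact_mod_cast hN
  have hq2 : ∀ x ∈ closure Ω \ D, 2 < (p x).toReal := fun x hx => by
    have := ENNReal.toReal_strict_mono (hpfin x hx) (lt_of_le_of_lt h2N (hNp x hx.1))
    simpa using this
  have hq : ∀ᶠ k : ℕ in atTop, ∀ x ∈ Ω \ closure D,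
      truncExponent p k x = (p x).toReal ∧ (p x).toReal ≤ k :=
    hplus.mono fun k hk x hx => truncExponent_of_lt hk hx
  have hcont : ContinuousOn uinf (closure Ω) :=
    hlim.continuousOn ((hσ.tendsto_atTop.eventually hsol).mono fun j hj => hj.1).frequently
  refine ⟨hcont.lowerSemicontinuousOn, fun φ x₀ hφ hx₀ _ hmin => ?_⟩
  have hT : HasBumpTests Ω (truncExponent p) g φ x₀ :=
    hasBumpTests_of_tendstoUniformlyOn hΩo hΩb hsol
      (Eventually.of_forall fun k =>
        aemeasurable_truncExponent hΩo hDo hDΩ' hpD hpfin hpC1.continuousOn k)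
      (by
        filter_upwards [eventually_ge_atTop 2] with k hk x hx
        exact ⟨two_le_truncExponent hk (h2N.trans (hNp x (subset_closure hx)).le),
          truncExponent_le k x⟩)
      hσ hlim (hφ.of_le (by norm_num)) hx₀ hmin
  have hqD : ∀ (k : ℕ), ∀ x ∈ D, truncExponent p k x = k := fun k x hx =>
    truncExponent_of_eq_top (hpD x hx) k
  have hq' : ∀ᶠ k : ℕ in atTop, ∀ x ∈ Ω \ closure D, truncExponent p k x = (p x).toReal :=
    hq.mono fun k hk x hx => (hk x hx).1
  refine ⟨fun h => ?_, fun h => ?_, fun h => ?_, fun h => ?_⟩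
  · exact neg_nonneg.2 (hT.varLaplacianWithin_nonpos hΩo hΩb hφ hs hpC1 hq' h
      (hq2 x₀ ⟨hx₀, fun hD => h.2 (subset_closure hD)⟩))
  · exact neg_nonneg.2 (hT.infLaplacian_nonpos hΩo hΩb hφ hDo hDΩ' hqD h)
  · by_cases hvar : varLaplacianWithin (closure Ω \ D) (fun y => (p y).toReal) φ x₀ ≤ 0
    · exact le_max_of_le_left (le_max_of_le_left (EReal.coe_nonneg.2 (neg_nonneg.2 hvar)))
    by_cases hinf : infLaplacian φ x₀ ≤ 0
    · exact le_max_of_le_left (le_max_of_le_right (EReal.coe_nonneg.2 (neg_nonneg.2 hinf)))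
    obtain ⟨ν, hν, hsgn⟩ := hT.exists_transmission_nonneg hΩo hΩb hφ hDo hDΩ hDl hs hpC1 hqD hq h
      (hq2 x₀ ⟨hx₀, fun hD => h.2 (by rwa [hDo.interior_eq])⟩) (not_le.1 hinf) (not_le.1 hvar)
    exact le_max_of_le_right (le_iSup₂_of_le ν hν (EReal.coe_nonneg.2 hsgn))
  · obtain ⟨e, ρ, hdef, hρ⟩ := hΩs.exists_isDefiningFunction h
    have hρ1 : ContDiff ℝ 1 ρ := hρ.of_le (by norm_cast)
    obtain ⟨hβ, hν⟩ := hdef.isOutwardUnitNormal hdef.mem_iff (hdef.apply_eq_zero h)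
      (hρ1.differentiable one_ne_zero x₀)
    refine ⟨_, hν, ?_⟩
    by_cases hflux : ‖∇ φ x₀‖ ^ ((p x₀).toReal - 2) * ⟪∇ φ x₀, -(‖∇ ρ x₀‖⁻¹ • ∇ ρ x₀)⟫ < g x₀
    · have hx₀D : x₀ ∉ D := fun hD => h.2 (by rw [hΩo.interior_eq]; exact hDΩ' hD)
      exact le_max_of_le_right (neg_nonneg.2 (hT.varLaplacianWithin_nonpos_of_flux_lt hΩo hΩb hφ hDΩ
        hs hg hpC1 hq' h (hq2 x₀ ⟨hx₀, hx₀D⟩) hdef hρ1 hβ hflux))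
    · exact le_max_of_le_left (sub_nonneg.2 (not_lt.1 hflux))

theorem IsWeakSolution.neg {q v : EuclideanSpace ℝ (Fin N) → ℝ} (h : IsWeakSolution Ω q g v) :
    IsWeakSolution Ω q (fun x => -g x) (fun x => -v x) := by
  obtain ⟨hc, G, ⟨⟨hv, hG, hint⟩, ⟨hvm, c, hc0, hvi⟩, ⟨hGm, c', hc'0, hGi⟩⟩, hweak⟩ := h
  refine ⟨hc.neg, fun x => -G x, ⟨⟨hv.neg, hG.neg, fun φ h1 h2 h3 => ?_⟩,
    ⟨hvm.neg, c, hc0, by simpa only [norm_neg] using hvi⟩,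
    ⟨hGm.neg, c', hc'0, by simpa only [norm_neg] using hGi⟩⟩, fun w W hw hW => ?_⟩
  · simp only [neg_smul, smul_neg, integral_neg, hint φ h1 h2 h3]
  · simp only [norm_neg, inner_neg_left, mul_neg, neg_mul, integral_neg, hweak w W hw hW]

theorem gradient_fun_neg (φ : EuclideanSpace ℝ (Fin N) → ℝ) (x : EuclideanSpace ℝ (Fin N)) :
    ∇ (fun x => -φ x) x = -∇ φ x := by
  simp only [gradient, fderiv_fun_neg, map_neg]

theorem varLaplacianWithin_neg {s : Set (EuclideanSpace ℝ (Fin N))}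
    {x : EuclideanSpace ℝ (Fin N)} (hs : UniqueDiffWithinAt ℝ s x)
    (q φ : EuclideanSpace ℝ (Fin N) → ℝ) :
    varLaplacianWithin s q (fun x => -φ x) x = -varLaplacianWithin s q φ x := by
  simp only [varLaplacianWithin, gradient_fun_neg, norm_neg, smul_neg, fderivWithin_fun_neg hs]
  exact map_neg (LinearMap.trace ℝ (EuclideanSpace ℝ (Fin N))) _

theorem infLaplacian_neg {φ : EuclideanSpace ℝ (Fin N) → ℝ} (hφ : ContDiff ℝ 2 φ)
    (x : EuclideanSpace ℝ (Fin N)) : infLaplacian (fun x => -φ x) x = -infLaplacian φ x := by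
  have h : ∇ (fun x => -φ x) = fun x => -∇ φ x := funext (gradient_fun_neg φ)
  rw [infLaplacian_eq_inner hφ.neg, infLaplacian_eq_inner hφ, h, fderiv_fun_neg]
  simp only [FunLike.coe_neg, Pi.neg_apply, map_neg, neg_neg, inner_neg_left]

/-- The problem is odd: changing the signs of `u` and `g` exchanges super- and subsolutions. -/
theorem IsViscositySupersolution.isViscositySubsolution_of_neg {v : EuclideanSpace ℝ (Fin N) → ℝ}
    (h : IsViscositySupersolution Ω D p (fun x => -g x) (fun x => -v x))
    (hΩ : IsOpen Ω) (hDo : IsOpen D) (hDΩ : closure D ⊆ Ω) (hs : UniqueDiffOn ℝ (closure Ω \ D)) :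
    IsViscositySubsolution Ω D p g v := by
  obtain ⟨hsc, h⟩ := h
  refine ⟨fun x hx y hy => ?_, fun φ x₀ hφ hx₀ hv hmax => ?_⟩
  · filter_upwards [hsc x hx (-y) (neg_lt_neg hy)] with z hz using neg_lt_neg_iff.1 hz
  obtain ⟨h1, h2, h3, h4⟩ := h (fun x => -φ x) x₀ hφ.neg hx₀ (neg_inj.2 hv) fun y hy hne => by
    have := hmax y hy hne
    linarith
  by_cases hxD : x₀ ∈ D
  · have hxc : x₀ ∈ closure D := subset_closure hxD
    simp only [infLaplacian_neg hφ, neg_neg] at h2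
    refine ⟨fun hx => absurd hxc hx.2, fun hx => by have := h2 hx; linarith,
      fun hx => absurd (hDo.interior_eq.symm ▸ hxD) hx.2,
      fun hx => absurd (hΩ.interior_eq.symm ▸ hDΩ hxc) hx.2⟩
  simp only [varLaplacianWithin_neg (hs x₀ ⟨hx₀, hxD⟩), infLaplacian_neg hφ, gradient_fun_neg, norm_neg, inner_neg_left,
    neg_neg] at h1 h2 h3 h4
  refine ⟨fun hx => by have := h1 hx; linarith, fun hx => by have := h2 hx; linarith,
    fun hx => ?_, fun hx => ?_⟩
  · rcases le_max_iff.1 (h3 hx) with h | h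
    · rcases le_max_iff.1 h with h | h
      · have h := EReal.coe_nonneg.1 h
        exact min_le_of_left_le (min_le_of_left_le (EReal.coe_nonpos.2 (by linarith)))
      · have h := EReal.coe_nonneg.1 h
        exact min_le_of_left_le (min_le_of_right_le (EReal.coe_nonpos.2 (by linarith)))
    · refine min_le_of_right_le (not_lt.1 fun hpos => ?_)
      refine absurd h (not_le.2 (lt_of_le_of_lt (iSup₂_le fun ν hν => ?_) (EReal.neg_lt_zero.2 hpos)))
      have hle := iInf₂_le (f := fun ν (_ : ν ∈ generalizedNormals D x₀) =>
        ((Real.sign (‖∇ φ x₀‖ - 1) * Real.sign ⟪∇ φ x₀, ν⟫ : ℝ) : EReal)) ν hν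
      rw [Real.sign_neg, mul_neg, EReal.coe_neg, EReal.neg_le_neg_iff]
      exact hle
  · obtain ⟨ν, hν, hle⟩ := h4 hx
    refine ⟨ν, hν, ?_⟩
    rcases le_max_iff.1 hle with h | h
    · exact min_le_of_left_le (by linarith)
    · exact min_le_of_right_le (by linarith)

end Viscosity

end PxNeumann

theorem theorem4p3 {N : ℕ} (hN : 2 ≤ N)
    -- a bounded smooth domain and a compactly contained Lipschitz subdomain
    (Ω D : Set (EuclideanSpace ℝ (Fin N)))
    (hΩo : IsOpen Ω) (hΩc : IsConnected Ω) (hΩb : Bornology.IsBounded Ω)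
    (hΩs : PxNeumann.HasSmoothBoundary Ω)
    (hDo : IsOpen D) (hDc : IsConnected D) (hDΩ : closure D ⊆ Ω)
    (hDl : PxNeumann.HasLipschitzBoundary D)
    -- the exponent
    (p : EuclideanSpace ℝ (Fin N) → ℝ≥0∞)
    (hpD : ∀ x ∈ D, p x = ⊤)
    (hpfin : ∀ x ∈ closure Ω \ D, p x ≠ ⊤)
    (hpC1 : ContDiffOn ℝ 1 (fun x => (p x).toReal) (closure Ω \ D))
    (hpplus : (⨆ x ∈ closure Ω \ closure D, p x) < ⊤)
    (hpminus : (N : ℝ≥0∞) < ⨅ x ∈ closure Ω, p x)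
    -- the boundary datum
    (g : EuclideanSpace ℝ (Fin N) → ℝ) (hg : ContinuousOn g (closure Ω))
    (hg0 : ∫ x in frontier Ω, g x ∂μHE[N - 1] = 0)
    -- the solutions of the intermediate problems and a uniform limit of a subsequence
    (u : ℕ → EuclideanSpace ℝ (Fin N) → ℝ)
    (hu : ∀ k : ℕ, (⨆ x ∈ closure Ω \ closure D, p x) < (k : ℝ≥0∞) →
      PxNeumann.IsWeakSolution Ω (PxNeumann.truncExponent p k) g (u k))
    (σ : ℕ → ℕ) (hσ : StrictMono σ)
    (uinf : EuclideanSpace ℝ (Fin N) → ℝ)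
    (hlim : TendstoUniformlyOn (fun j => u (σ j)) uinf atTop (closure Ω)) :
    PxNeumann.IsViscositySolution Ω D p g uinf := by
  refine ⟨PxNeumann.isViscositySupersolution_of_tendstoUniformlyOn hN hΩo hΩb hΩs hDo hDΩ hDl hpD
    hpfin hpC1 hpplus hpminus hg hu hσ hlim,
    PxNeumann.IsViscositySupersolution.isViscositySubsolution_of_neg
      (PxNeumann.isViscositySupersolution_of_tendstoUniformlyOn hN hΩo hΩb hΩs hDo hDΩ hDl hpD
        hpfin hpC1 hpplus hpminus hg.neg (u := fun k x => -u k x) (fun k hk => (hu k hk).neg) hσ ?_)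
      hΩo hDo hDΩ (PxNeumann.uniqueDiffOn_closure_sdiff hΩo hΩs hDo hDΩ hDl)⟩
  rw [Metric.tendstoUniformlyOn_iff] at hlim ⊢
  intro ε hε
  filter_upwards [hlim ε hε] with j hj x hx
  rw [dist_neg_neg]
  exact hj x hx
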